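/- Let $\Omega\subset\mathbb R^2\simeq\mathbb C$ be a bounded domain with smooth boundary, let $g\in C^1(\partial\Omega,\mathbb S^1)$, let $n\in\mathbb N$, $d=(d_1,\dots,d_n)\in\mathbb Z^n$, and let $\Omega^n_*$ be the set of $n$-tuples $x=(x_1,\dots,x_n)$ of pairwise distinct points of $\Omega$. A \emph{singular harmonic map} with singular set $(x,d)$ is a map of the form $$u(z)=\prod_{j=1}^n\Bigl(\frac{z-x_j}{|z-x_j|}\Bigr)^{d_j}v(z)\qquad (z\in\Omega\setminus\{x_1,\dots,x_n\}),$$ where $v\in C^2(\Omega,\mathbb S^1)$ is a harmonic map ($-\Delta v=|\nabla v|^2v$). Let $U\subseteq\Omega^n_*$ be open, and let $(u_x)_{x\in U}$ be a family of singular harmonic maps, $u_x$ having singular set $(x,d)$ and attaining the boundary datum $g$ continuously on $\partial\Omega$, that depends continuously on $x$ in $W^{1,p}(\Omega)$ for some $p\in[1,2)$. Then the following hold. (1) For every $x\in U$, $|\nabla u_x|^2$ is integrable on $\Omega\setminus\bigcup_{j}B_\rho(x_j)$ for every $\rho>0$, and the renormalised energy $$W(x)=\lim_{\rho\to0}\Bigl(\int_{\Omega\setminus\bigcup_{j=1}^nB_\rho(x_j)}|\nabla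 u_x|^2-2\pi\sum_{j=1}^nd_j^2\ln\frac1\rho\Bigr)$$ exists as a finite limit. (2) $W$ is differentiable at every $x\in U$. Moreover, let $\chi\in C^\infty(\mathbb R^2,\mathbb R)$ be equal to $1$ in $B_1(0)$ and to $0$ outside $B_2(0)$, let $\delta>0$ satisfy $2\delta<|x_j-x_k|$ for all $j\neq k$ and $2\delta<\operatorname{dist}(x_j,\partial\Omega)$ for all $j$, let $h=(h_1,\dots,h_n)\in(\mathbb R^2)^n$, and set $X_h(z)=\sum_{j=1}^n\chi\bigl(\frac{z-x_j}\delta\bigr)h_j$. Then $\langle S_2(u_x),DX_h\rangle$ is integrable on $\Omega$ and $$DW(x)[h]=-\int_\Omega\langle S_2(u_x),DX_h\rangle,$$ where $S_2(u)=2\,\nabla u\otimes\nabla u-|\nabla u|^2I$ with $(\nabla u\otimes\nabla u)_{ik}=(\partial_iu,\partial_ku)$ is the Dirichlet stress-energy tensor, and $\langle A,B\rangle=\sum_{i,k}A_{ik}B_{ik}$. (3) $W$ is of class $C^1$ on $U$. -/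

import Mathlib

open Set Filter Topology MeasureTheory
open scoped ContDiff ENNReal

noncomputable section

namespace SingularHarmonic

/-! The plane `ℝ²` is identified with `ℂ`, both as the domain and as the target. -/

/-- The standard basis `e₁ = 1`, `e₂ = i` of the plane. -/
def e : Fin 2 → ℂ := ![1, Complex.I]

/-- The partial derivative `∂ᵢ u` at `z`. -/
def pd (u : ℂ → ℂ) (i : Fin 2) (z : ℂ) : ℂ := fderiv ℝ u z (e i)

/-- The squared Euclidean norm `|∇u|² = |∂₁u|² + |∂₂u|²`. -/
def gradSq (u : ℂ → ℂ) (z : ℂ) : ℝ := ∑ i : Fin 2, ‖pd u i z‖ ^ 2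

/-- `Ω` has a smooth boundary: near each boundary point it is the sublevel set `{ρ < 0}` of a
smooth function with nonvanishing differential. -/
def HasSmoothBoundary (Ω : Set ℂ) : Prop :=
  ∀ z ∈ frontier Ω, ∃ V : Set ℂ, IsOpen V ∧ z ∈ V ∧ ∃ ρ : ℂ → ℝ,
    ContDiff ℝ ∞ ρ ∧ (∀ w ∈ V, fderiv ℝ ρ w ≠ 0) ∧ ∀ w ∈ V, (w ∈ Ω ↔ ρ w < 0)

/-- A bounded planar domain with smooth boundary. -/
structure IsSmoothBoundedDomain (Ω : Set ℂ) : Prop where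
  isOpen : IsOpen Ω
  isConnected : IsConnected Ω
  isBounded : Bornology.IsBounded Ω
  smoothBoundary : HasSmoothBoundary Ω

/-- A boundary datum `g : ∂Ω → 𝕊¹` of class `C¹`, i.e. the restriction to `∂Ω` of a `C¹` map of
the plane. -/
def IsC1Datum {Ω : Set ℂ} (g : frontier Ω → Circle) : Prop :=
  ∃ G : ℂ → ℂ, ContDiff ℝ 1 G ∧ ∀ y : frontier Ω, G y = (g y : ℂ)

/-- The configuration space `Ω_*ⁿ` of `n` distinct points of `Ω`. -/
def configSpace (Ω : Set ℂ) (n : ℕ) : Set (Fin n → ℂ) :=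
  {x | (∀ j, x j ∈ Ω) ∧ ∀ j k, j ≠ k → x j ≠ x k}

/-- `v` is a `C²` harmonic map from `Ω` to the unit circle: `-Δv = |∇v|² v`. -/
structure IsCircleHarmonic (Ω : Set ℂ) (v : ℂ → ℂ) : Prop where
  contDiffOn : ContDiffOn ℝ 2 v Ω
  norm_eq_one : ∀ z ∈ Ω, ‖v z‖ = 1
  equation : ∀ z ∈ Ω, -(Laplacian.laplacian v z) = gradSq v z • v z

/-- `u` is a singular harmonic map on `Ω` with singular set `(x, d)`: a product of the vortices
`((z - x_j) / |z - x_j|) ^ d_j` and of a harmonic map `v : Ω → 𝕊¹` of class `C²`. -/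
def IsSingularHarmonicMap (Ω : Set ℂ) {n : ℕ} (x : Fin n → ℂ) (d : Fin n → ℤ) (u : ℂ → ℂ) :
    Prop :=
  ∃ v : ℂ → ℂ, IsCircleHarmonic Ω v ∧
    ∀ z ∈ Ω, (∀ j, z ≠ x j) →
      u z = (∏ j, ((z - x j) / ((‖z - x j‖ : ℝ) : ℂ)) ^ d j) * v z

/-- `u = g` on `∂Ω`, attained continuously. -/
def HasBoundaryDatum {Ω : Set ℂ} (g : frontier Ω → Circle) (u : ℂ → ℂ) : Prop :=
  ∀ y : frontier Ω, Tendsto u (𝓝[Ω] (y : ℂ)) (𝓝 (g y : ℂ))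

/-- `(u_x)_{x ∈ U}` depends continuously on `x` in `W^{1,p}(Ω)`. It is only used for maps that
are `C²` in `Ω` outside of finitely many points and of the form above, whose weak gradient is
their classical one. -/
def ContinuousInSobolev (p : ℝ≥0∞) (Ω : Set ℂ) {n : ℕ} (U : Set (Fin n → ℂ))
    (u : (Fin n → ℂ) → ℂ → ℂ) : Prop :=
  ∀ x ∈ U,
    Tendsto (fun y => eLpNorm (fun z => u y z - u x z) p (volume.restrict Ω)) (𝓝[U] x) (𝓝 0) ∧
    Tendsto (fun y => eLpNorm (fun z => fderiv ℝ (u y) z - fderiv ℝ (u x) z) p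
      (volume.restrict Ω)) (𝓝[U] x) (𝓝 0)

/-- A family, indexed by the configurations `x ∈ U`, of singular harmonic maps `u_x` with singular
set `(x, d)` and boundary datum `g`, depending continuously on `x` in `W^{1,p}(Ω)`. -/
structure IsSingularHarmonicFamily (p : ℝ≥0∞) (Ω : Set ℂ) (g : frontier Ω → Circle) {n : ℕ}
    (d : Fin n → ℤ) (U : Set (Fin n → ℂ)) (u : (Fin n → ℂ) → ℂ → ℂ) : Prop where
  singularHarmonic : ∀ x ∈ U, IsSingularHarmonicMap Ω x d (u x)
  boundary : ∀ x ∈ U, HasBoundaryDatum g (u x)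
  continuous : ContinuousInSobolev p Ω U u

/-- `Ω` with the disks `B_ρ(x_j)` removed. -/
def perforated (Ω : Set ℂ) {n : ℕ} (x : Fin n → ℂ) (ρ : ℝ) : Set ℂ :=
  Ω \ ⋃ j, Metric.ball (x j) ρ

/-- `W_ρ(x) = ∫_{Ω ∖ ⋃ B_ρ(x_j)} |∇u_x|² - 2π ∑ d_j² ln (1/ρ)`. -/
def truncatedEnergy (Ω : Set ℂ) {n : ℕ} (d : Fin n → ℤ) (u : (Fin n → ℂ) → ℂ → ℂ) (ρ : ℝ)
    (x : Fin n → ℂ) : ℝ :=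
  (∫ z in perforated Ω x ρ, gradSq (u x) z) -
    2 * Real.pi * (∑ j, (d j : ℝ) ^ 2) * Real.log (1 / ρ)

/-- The renormalised energy `W(x) = lim_{ρ → 0} W_ρ(x)` of the family `u`. -/
def renormEnergy (Ω : Set ℂ) {n : ℕ} (d : Fin n → ℤ) (u : (Fin n → ℂ) → ℂ → ℂ)
    (x : Fin n → ℂ) : ℝ :=
  limUnder (𝓝[>] (0 : ℝ)) (fun ρ => truncatedEnergy Ω d u ρ x)

/-- The Dirichlet stress-energy tensor `S₂(u) = 2 ∇u ⊗ ∇u - |∇u|² I`, where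
`(∇u ⊗ ∇u)_{ik} = (∂ᵢu, ∂ₖu)`. -/
def stressEnergy (u : ℂ → ℂ) (z : ℂ) : Matrix (Fin 2) (Fin 2) ℝ :=
  Matrix.of fun i k => 2 * inner ℝ (pd u i z) (pd u k z) - if i = k then gradSq u z else 0

/-- The differential `DX` of a planar vector field as a matrix, `(DX)_{ik} = ∂ₖ Xⁱ`. -/
def jacobian (X : ℂ → ℂ) (z : ℂ) : Matrix (Fin 2) (Fin 2) ℝ :=
  Matrix.of fun i k => inner ℝ (e i) (pd X k z)

/-- The inner product `⟨A, B⟩ = ∑ A_{ik} B_{ik}` of `2 × 2` matrices. -/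
def matInner (A B : Matrix (Fin 2) (Fin 2) ℝ) : ℝ := ∑ i, ∑ k, A i k * B i k

/-- A smooth cut-off function, equal to `1` in `B₁` and to `0` outside of `B₂`. -/
structure IsCutoff (χ : ℂ → ℝ) : Prop where
  smooth : ContDiff ℝ ∞ χ
  eq_one : ∀ z ∈ Metric.ball (0 : ℂ) 1, χ z = 1
  eq_zero : ∀ z ∉ Metric.ball (0 : ℂ) 2, χ z = 0

/-- The vector field `X_h(z) = ∑ χ((z - x_j)/δ) h_j`. -/
def cutoffField (χ : ℂ → ℝ) (δ : ℝ) {n : ℕ} (x h : Fin n → ℂ) (z : ℂ) : ℂ :=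
  ∑ j, χ ((z - x j) / (δ : ℂ)) • h j

end SingularHarmonic

end

/-! A harmonic map into the circle is locally `e^{iφ}` with `φ` harmonic, so `du = i u Re(H dz)`
with `H = ∂₁φ - i ∂₂φ` holomorphic; a vortex of degree `d_j` adds `-i d_j / (z - x_j)`. Everything
is read off this current: `|∇u|² = |H|²`, and `⟨S₂(u), DX⟩` is the real part of `H² (∂₁X + i ∂₂X)`,
that is, the Hopf differential paired with `∂̄X`.

Existence of `W`. Near `x_j` the density is `d_j² / |z - x_j|²` up to an error of order `1 / |z -
x_j|`, which is integrable in the plane; the leading term on annuli gives the logarithm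
(`integrableOn_renormalised`, `tendsto_truncatedEnergy`). Near `∂Ω` the energy is finite because the
current, being divergence free, can be tested with a truncation of the sine of the phase difference
between `u` and a `C¹` extension of `g` (`IsCurrent.exists_compact_integrableOn`).

Differentiability. For two configurations `x, y` near `x₀`, let `X` be the cut-off field carrying
`x` to `y`, and `Φ = id + X`. If `u_y ∘ Φ / u_x` stays within distance `1` of `1`, its argument `ψ`
is a single-valued phase difference. It vanishes at `∂Ω`, and the current of `u_x` is tangential to
leading order at the vortices, so `∫ H_x · dψ = 0`. Convexity of the square then shows that the
pulled-back current has at least the energy of `H_x`, and the change of variables costs exactly the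
contraction of the stress-energy tensor with `DX`, up to a quadratic error. This is
`renormalised_energy_comparison`, with the pointwise algebra in `le_abs_det_mul_norm_sq`: `W(y) ≥
W(x) - ∫ ⟨S₂, DX⟩ - o(|y - x|)`, uniformly for `(x, y)` near `(x₀, x₀)`. Exchanging `x` and `y`
gives the opposite inequality, so `W` is strictly differentiable at `x₀`, with no need to
differentiate `u_x` in `x`. Strict differentiability at every point of `U` yields `C¹`.

Closeness of `u_y ∘ Φ` and `u_x`. In the interior, the mean value property upgrades `W^{1,1}`
convergence of the maps to locally uniform convergence of their currents, and then of the maps. At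
the boundary, in coordinates that flatten `∂Ω`, Fubini provides transversals on which the maps are
uniformly close, since they agree at the boundary; the maximum principle for the phase fills in the
rectangle between two transversals (`tendstoUniformlyOn_of_boundary`). Near a vortex the moved maps
have the same singular current, so the quotient has a holomorphic current controlled by its values
on a circle (`norm_div_sub_one_lt_near_vortex`). -/

namespace SingularHarmonic

/-! ### Circle-valued maps and their holomorphic currents. -/

/-- The real linear form `ξ ↦ Re (H ξ)`. -/
noncomputable def curForm (H : ℂ) : ℂ →L[ℝ] ℝ :=
  Complex.reCLM.comp (ContinuousLinearMap.mul ℝ ℂ H)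

@[simp] theorem curForm_apply (H ξ : ℂ) : curForm H ξ = (H * ξ).re := rfl

theorem curForm_add (H K : ℂ) : curForm (H + K) = curForm H + curForm K := by
  ext ξ; simp [add_mul]

theorem curForm_zero : curForm 0 = 0 := by
  ext ξ; simp

theorem continuous_curForm : Continuous curForm := by
  unfold curForm; fun_prop

theorem norm_curForm_le (H : ℂ) : ‖curForm H‖ ≤ ‖H‖ := by
  refine ContinuousLinearMap.opNorm_le_bound _ (norm_nonneg _) fun ξ => ?_
  rw [curForm_apply, Real.norm_eq_abs, ← norm_mul]
  exact Complex.abs_re_le_norm _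

/-- `u` is a circle-valued map on `O` with current `Re H dx - Im H dy`, where `H` is
holomorphic: `du = i u Re (H dz)`. -/
structure IsCurrent (O : Set ℂ) (u H : ℂ → ℂ) : Prop where
  norm_eq_one : ∀ z ∈ O, ‖u z‖ = 1
  hasFDerivAt : ∀ z ∈ O, HasFDerivAt u ((curForm (H z)).smulRight (Complex.I * u z)) z
  differentiableOn : DifferentiableOn ℂ H O

namespace IsCurrent

variable {O O' : Set ℂ} {u v H K : ℂ → ℂ}

theorem ne_zero (h : IsCurrent O u H) {z : ℂ} (hz : z ∈ O) : u z ≠ 0 := by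
  intro h0
  have := h.norm_eq_one z hz
  simp [h0] at this

theorem mono (h : IsCurrent O u H) (hO : O' ⊆ O) : IsCurrent O' u H :=
  ⟨fun z hz => h.1 z (hO hz), fun z hz => h.2 z (hO hz), h.3.mono hO⟩

theorem congr (h : IsCurrent O u H) (hO : IsOpen O) (huv : ∀ z ∈ O, v z = u z)
    (hHK : ∀ z ∈ O, K z = H z) : IsCurrent O v K := by
  refine ⟨fun z hz => by rw [huv z hz]; exact h.1 z hz, fun z hz => ?_,
    h.3.congr hHK⟩
  rw [huv z hz, hHK z hz]
  refine (h.2 z hz).congr_of_eventuallyEq ?_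
  filter_upwards [hO.mem_nhds hz] with w hw using huv w hw

theorem one : IsCurrent O (fun _ => 1) (fun _ => 0) := by
  refine ⟨by simp, fun z _ => ?_, differentiableOn_const _⟩
  convert! hasFDerivAt_const (𝕜 := ℝ) (1 : ℂ) z
  ext ξ; simp

theorem mul (h : IsCurrent O u H) (k : IsCurrent O v K) :
    IsCurrent O (fun z => u z * v z) (fun z => H z + K z) := by
  refine ⟨fun z hz => by simp [h.1 z hz, k.1 z hz], fun z hz => ?_, h.3.add k.3⟩
  refine ((h.2 z hz).mul (k.2 z hz)).congr_fderiv ?_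
  ext ξ
  simp only [curForm_add]
  simp
  ring

theorem zpow (h : IsCurrent O u H) (d : ℤ) :
    IsCurrent O (fun z => u z ^ d) (fun z => d * H z) := by
  refine ⟨fun z hz => by simp [h.1 z hz], fun z hz => ?_, h.3.const_mul _⟩
  have h1 := (hasDerivAt_zpow d (u z) (Or.inl (h.ne_zero hz))).hasFDerivAt.restrictScalars ℝ
  refine (h1.comp z (h.2 z hz)).congr_fderiv ?_
  ext ξ
  simp only [ContinuousLinearMap.comp_apply, ContinuousLinearMap.smulRight_apply, curForm_apply,
    ContinuousLinearMap.coe_restrictScalars', Complex.real_smul]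
  rw [zpow_sub_one₀ (h.ne_zero hz)]
  have : ((d : ℂ) * H z * ξ).re = d * (H z * ξ).re := by
    rw [mul_assoc, ← Complex.ofReal_intCast, Complex.re_ofReal_mul]
  simp only [ContinuousLinearMap.toSpanSingleton_apply, smul_eq_mul]
  rw [this]
  push_cast
  field_simp [h.ne_zero hz]

theorem inv (h : IsCurrent O u H) : IsCurrent O (fun z => (u z)⁻¹) (fun z => -H z) := by
  simpa using h.zpow (-1)

theorem div (h : IsCurrent O u H) (k : IsCurrent O v K) :
    IsCurrent O (fun z => u z / v z) (fun z => H z - K z) := by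
  simpa [div_eq_mul_inv, sub_eq_add_neg] using h.mul k.inv

theorem prod {n : ℕ} {u H : Fin n → ℂ → ℂ} (h : ∀ j, IsCurrent O (u j) (H j)) :
    IsCurrent O (fun z => ∏ j, u j z) (fun z => ∑ j, H j z) := by
  induction n with
  | zero => simpa using one
  | succ n ih =>
    simp only [Fin.prod_univ_succ, Fin.sum_univ_succ]
    exact (h 0).mul (ih fun j => h j.succ)

theorem comp_add_const (h : IsCurrent O u H) (c : ℂ) :
    IsCurrent ((fun z => z + c) ⁻¹' O) (fun z => u (z + c)) (fun z => H (z + c)) := by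
  refine ⟨fun z hz => h.1 _ hz, fun z hz => ?_, ?_⟩
  · exact (h.2 (z + c) hz).comp z ((hasFDerivAt_id (𝕜 := ℝ) z).add_const c)
  · exact h.3.comp (by fun_prop) (fun z hz => hz)

theorem continuousOn (h : IsCurrent O u H) : ContinuousOn u O :=
  fun z hz => (h.2 z hz).continuousAt.continuousWithinAt

theorem fderiv_apply (h : IsCurrent O u H) {z : ℂ} (hz : z ∈ O) (ξ : ℂ) :
    fderiv ℝ u z ξ = ((H z * ξ).re : ℝ) * (Complex.I * u z) := by
  rw [(h.2 z hz).fderiv]; simp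

theorem norm_fderiv_le (h : IsCurrent O u H) {z : ℂ} (hz : z ∈ O) :
    ‖fderiv ℝ u z‖ ≤ ‖H z‖ := by
  rw [(h.2 z hz).fderiv, ContinuousLinearMap.norm_smulRight_apply]
  simpa [h.1 z hz] using norm_curForm_le (H z)

theorem pd_zero (h : IsCurrent O u H) {z : ℂ} (hz : z ∈ O) :
    pd u 0 z = ((H z).re : ℝ) * (Complex.I * u z) := by
  simp [pd, e, h.fderiv_apply hz]

theorem pd_one (h : IsCurrent O u H) {z : ℂ} (hz : z ∈ O) :
    pd u 1 z = (-(H z).im : ℝ) * (Complex.I * u z) := by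
  simp [pd, e, h.fderiv_apply hz]

theorem gradSq_eq (h : IsCurrent O u H) {z : ℂ} (hz : z ∈ O) :
    gradSq u z = ‖H z‖ ^ 2 := by
  rw [gradSq, Fin.sum_univ_two, h.pd_zero hz, h.pd_one hz]
  simp only [norm_mul, Complex.norm_real, Complex.norm_I, h.1 z hz]
  simp only [Real.norm_eq_abs, mul_one, sq_abs]
  rw [← Complex.normSq_eq_norm_sq, Complex.normSq_apply]; ring

theorem inner_aux (h : IsCurrent O u H) {z : ℂ} (hz : z ∈ O) (a b : ℝ) :
    inner ℝ ((a : ℂ) * (Complex.I * u z)) (b * (Complex.I * u z)) = a * b := by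
  rw [← Complex.real_smul, ← Complex.real_smul, inner_smul_left, inner_smul_right,
    real_inner_self_eq_norm_sq]
  simp [h.1 z hz]

end IsCurrent

/-- The map is `e^{iθ}` with `θ` the polar angle around `a`, and `dθ = Im (dz / (z - a)) = Re (-i dz
/ (z - a))`. -/
theorem isCurrent_vortex (a : ℂ) :
    IsCurrent {a}ᶜ (fun z => (z - a) / ((‖z - a‖ : ℝ) : ℂ)) (fun z => -Complex.I / (z - a)) := by
  have key : ∀ z : ℂ, z ≠ 0 → HasFDerivAt (fun z : ℂ => z / ((‖z‖ : ℝ) : ℂ))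
      ((curForm (-Complex.I / z)).smulRight (Complex.I * (z / ((‖z‖ : ℝ) : ℂ)))) z := by
    intro z hz
    have hn : (‖z‖ : ℂ) ≠ 0 := by simpa using hz
    have h1 : HasFDerivAt (fun z : ℂ => ‖z‖) ((‖z‖⁻¹ : ℝ) • innerSL ℝ z) z := by
      have h2 := (hasStrictFDerivAt_norm_sq z).hasFDerivAt.sqrt (by simpa using hz)
      simp only [Real.sqrt_sq (norm_nonneg _)] at h2
      refine h2.congr_fderiv ?_
      ext ξ
      simp
      field_simp
    have h3 := (hasFDerivAt_id (𝕜 := ℝ) z).mul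
      (((hasDerivAt_inv hn).hasFDerivAt.restrictScalars ℝ).comp z
        (Complex.ofRealCLM.hasFDerivAt.comp z h1))
    have h4 : HasFDerivAt (fun z : ℂ => z / ((‖z‖ : ℝ) : ℂ)) _ z := h3
    refine h4.congr_fderiv ?_
    ext ξ
    simp only [_root_.add_apply, _root_.smul_apply, id,
      ContinuousLinearMap.comp_apply, ContinuousLinearMap.coe_restrictScalars',
      Complex.ofRealCLM_apply, innerSL_apply_apply, smul_eq_mul,
      ContinuousLinearMap.smulRight_apply, curForm_apply, Complex.real_smul,
      ContinuousLinearMap.id_apply, ContinuousLinearMap.toSpanSingleton_apply]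
    -- Writing the increment as a multiple of `z` separates its radial part `w.re` from its angular
    -- part `w.im`; only the latter survives.
    have hw : ∃ w, ξ = z * w := ⟨ξ / z, by field_simp⟩
    obtain ⟨w, rfl⟩ := hw
    have e1 : inner ℝ z (z * w) = ‖z‖ ^ 2 * w.re := by
      rw [Complex.inner, mul_comm, ← mul_assoc, ← Complex.normSq_eq_conj_mul_self, Complex.re_ofReal_mul,
        Complex.normSq_eq_norm_sq]
    have e2 : (-Complex.I / z * (z * w)).re = w.im := by
      rw [show -Complex.I / z * (z * w) = -Complex.I * w by field_simp]; simp
    rw [e1, e2]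
    have := Complex.re_add_im w
    simp only [Function.comp_apply, Complex.ofRealCLM_apply]
    push_cast
    field_simp
    linear_combination -this
  refine ⟨fun z hz => ?_, fun z hz => ?_, ?_⟩
  · have : ‖z - a‖ ≠ 0 := by simpa [sub_eq_zero] using hz
    simp [this]
  · exact (key (z - a) (sub_ne_zero.2 hz)).comp z ((hasFDerivAt_id (𝕜 := ℝ) z).sub_const a)
  · intro z hz
    have : z - a ≠ 0 := sub_ne_zero.2 hz
    exact ((differentiableAt_const (-Complex.I)).fun_div (differentiableAt_id.sub_const a)
      this).differentiableWithinAt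


/-- Since `|v| = 1`, the derivative of `v` is `i v` times a real form `a`. The components of `a`
satisfy the Cauchy–Riemann equations: `a` is closed by symmetry of the second derivative, and
co-closed by the harmonic map equation. No local lift of `v` is needed. -/
theorem IsCircleHarmonic.exists_isCurrent {Ω : Set ℂ} {v : ℂ → ℂ} (hΩ : IsOpen Ω)
    (h : IsCircleHarmonic Ω v) : ∃ f, IsCurrent Ω v f := by
  set c : ℂ →L[ℝ] ℂ := Complex.conjCLE.toContinuousLinearMap with hc
  have hcd : ∀ z ∈ Ω, ContDiffAt ℝ 2 v z := fun z hz => h.contDiffOn.contDiffAt (hΩ.mem_nhds hz)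
  have hd : ∀ z ∈ Ω, HasFDerivAt v (fderiv ℝ v z) z := fun z hz =>
    ((hcd z hz).differentiableAt (by norm_num)).hasFDerivAt
  have hd2 : ∀ z ∈ Ω, HasFDerivAt (fderiv ℝ v) (fderiv ℝ (fderiv ℝ v) z) z := fun z hz =>
    (((hcd z hz).fderiv_right (m := 1) (by norm_num)).differentiableAt (by norm_num)).hasFDerivAt
  have hcc : ∀ z ∈ Ω, c (v z) * v z = 1 := by
    intro z hz
    have : c (v z) = (starRingEnd ℂ) (v z) := by simp [hc]
    rw [this, ← Complex.normSq_eq_conj_mul_self, Complex.normSq_eq_norm_sq,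
      h.norm_eq_one z hz]; simp
  set a : ℂ → ℂ → ℝ := fun z ξ => (c (v z) * fderiv ℝ v z ξ).im with ha
  have hdv : ∀ z ∈ Ω, ∀ ξ, fderiv ℝ v z ξ = a z ξ * (Complex.I * v z) := by
    intro z hz ξ
    have h1 : HasFDerivAt (fun w => c (v w) * v w) _ z :=
      (c.hasFDerivAt.comp z (hd z hz)).mul (hd z hz)
    have h2 : HasFDerivAt (fun w => c (v w) * v w) (0 : ℂ →L[ℝ] ℂ) z := by
      refine (hasFDerivAt_const (1 : ℂ) z).congr_of_eventuallyEq ?_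
      filter_upwards [hΩ.mem_nhds hz] with w hw using hcc w hw
    have h3 := congrArg (fun L => (L ξ).re) (h1.unique h2)
    have h4 : (c (v z) * fderiv ℝ v z ξ).re = 0 := by
      simp [hc] at h3 ⊢
      linarith
    have h5 : c (v z) * fderiv ℝ v z ξ = Complex.I * a z ξ := by
      apply Complex.ext <;> simp [h4, ha]
    calc fderiv ℝ v z ξ = (c (v z) * v z) * fderiv ℝ v z ξ := by rw [hcc z hz, one_mul]
      _ = v z * (c (v z) * fderiv ℝ v z ξ) := by ring
      _ = _ := by rw [h5]; ring
  set f : ℂ → ℂ := fun z => a z 1 - Complex.I * a z Complex.I with hf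
  have haf : ∀ z ξ, a z ξ = (f z * ξ).re := by
    intro z ξ
    have e1 : fderiv ℝ v z ξ = ξ.re * fderiv ℝ v z 1 + ξ.im * fderiv ℝ v z Complex.I := by
      have : ξ = ξ.re • (1 : ℂ) + ξ.im • Complex.I := by simp
      conv_lhs => rw [this]
      rw [map_add, map_smul, map_smul]; simp
    simp only [hf, ha, e1]
    simp
    ring
  refine ⟨f, h.norm_eq_one, fun z hz => ?_, fun z hz => ?_⟩
  · refine (hd z hz).congr_fderiv ?_
    ext1 ξ
    rw [hdv z hz, haf]; simp
  · refine DifferentiableAt.differentiableWithinAt ?_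
    have hda : ∀ ξ, HasFDerivAt (fun w => a w ξ) (Complex.imCLM.comp
        (c (v z) • (ContinuousLinearMap.apply ℝ ℂ ξ).comp (fderiv ℝ (fderiv ℝ v) z))) z := by
      intro ξ
      have h1 := (c.hasFDerivAt.comp z (hd z hz)).mul
        ((ContinuousLinearMap.apply ℝ ℂ ξ).hasFDerivAt.comp z (hd2 z hz))
      have h2 : HasFDerivAt (fun w => a w ξ) _ z := Complex.imCLM.hasFDerivAt.comp z h1
      refine h2.congr_fderiv ?_
      ext1 η
      -- Both derivatives are real multiples of `i v`, so the first-order part of the product rule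
      -- is real and does not contribute to the derivative of `a`.
      have : (fderiv ℝ v z ξ * c (fderiv ℝ v z η)).im = 0 := by
        rw [hdv z hz ξ, hdv z hz η]
        have e2 : c (a z η * (Complex.I * v z)) = -(a z η * Complex.I * c (v z)) := by
          simp [hc]; ring
        rw [e2]
        have e3 : (a z ξ : ℂ) * (Complex.I * v z) * -(a z η * Complex.I * c (v z))
          = -(a z ξ * a z η * (Complex.I * Complex.I) * (c (v z) * v z)) := by ring
        rw [e3, hcc z hz, Complex.I_mul_I]
        simp
      simpa using this
    set A : ℂ → ℂ → ℝ := fun ξ η => (c (v z) * fderiv ℝ (fderiv ℝ v) z η ξ).im with hA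
    have hdf : HasFDerivAt f _ z := (Complex.ofRealCLM.hasFDerivAt.comp z (hda 1)).sub
      ((Complex.ofRealCLM.hasFDerivAt.comp z (hda Complex.I)).const_mul Complex.I)
    have hsymm : fderiv ℝ (fderiv ℝ v) z 1 Complex.I = fderiv ℝ (fderiv ℝ v) z Complex.I 1 :=
      (hcd z hz).isSymmSndFDerivAt (by simp) 1 Complex.I
    -- Multiplied by the conjugate of `v`, the right-hand side of the equation becomes the real
    -- number `|∇v|²`, so the imaginary part of the left-hand side vanishes.
    have hlap : A 1 1 + A Complex.I Complex.I = 0 := by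
      have h1 := h.equation z hz
      rw [InnerProductSpace.laplacian_eq_iteratedFDeriv_complexPlane] at h1
      simp only [iteratedFDeriv_two_apply] at h1
      simp at h1
      have h2 := congrArg (fun w => (c (v z) * w).im) h1
      rw [mul_left_comm, hcc z hz] at h2
      simp [mul_add] at h2
      simp [hA]
      linarith
    refine differentiableAt_complex_iff_differentiableAt_real.2 ⟨hdf.differentiableAt, ?_⟩
    rw [hdf.fderiv]
    have h1 : A 1 Complex.I = A Complex.I 1 := by simp only [hA, hsymm]
    apply Complex.ext
    · simp [hA] at h1 ⊢
      linarith
    · simp [hA] at hlap ⊢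
      linarith

/-! ### Radial integrals and the mean value property. -/

theorem integrableOn_inv_norm_ball_zero (r : ℝ) :
    IntegrableOn (fun z : ℂ => ‖z‖⁻¹) (Metric.ball 0 r) := by
  rw [integrableOn_fun_norm_addHaar volume (f := fun t => t⁻¹)]
  have : IntegrableOn (fun _ : ℝ => (1 : ℝ)) (Ioo 0 r) := integrableOn_const (by simp)
  refine this.congr_fun (fun y hy => ?_) measurableSet_Ioo
  have : y ≠ 0 := hy.1.ne'
  simp [this]

theorem integrableOn_ball_iff_sub {f : ℂ → ℝ} (a : ℂ) (r : ℝ) :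
    IntegrableOn (fun z => f (z - a)) (Metric.ball a r) ↔ IntegrableOn f (Metric.ball 0 r) := by
  have h := (measurePreserving_sub_right (volume : Measure ℂ) a).integrableOn_comp_preimage
    (MeasurableEquiv.subRight a).measurableEmbedding (f := f) (s := Metric.ball 0 r)
  have e : (fun z => z - a) ⁻¹' Metric.ball 0 r = Metric.ball a r := by
    ext z; simp [dist_eq_norm]
  rw [e] at h
  exact h

theorem integrableOn_inv_norm_sub {s : Set ℂ} (hs : Bornology.IsBounded s) (a : ℂ) :
    IntegrableOn (fun z : ℂ => ‖z - a‖⁻¹) s := by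
  obtain ⟨r, hr⟩ := hs.subset_ball a
  exact ((integrableOn_ball_iff_sub a r).2 (integrableOn_inv_norm_ball_zero r)).mono_set hr

/-- In polar coordinates the integrand becomes `1/t`. This is the source of the logarithmic
divergence that the renormalisation subtracts. -/
theorem integral_annulus (a : ℂ) {ρ r : ℝ} (hρ : 0 < ρ) (hr : ρ ≤ r) :
    ∫ z in Metric.ball a r \ Metric.ball a ρ, (‖z - a‖ ^ 2)⁻¹ = 2 * Real.pi * Real.log (r / ρ) := by
  have h0 : ∫ z in Metric.ball a r \ Metric.ball a ρ, (‖z - a‖ ^ 2)⁻¹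
      = ∫ z : ℂ, (Ico ρ r).indicator (fun t => (t ^ 2)⁻¹) ‖z‖ := by
    rw [← integral_indicator (measurableSet_ball.diff measurableSet_ball),
      ← integral_sub_right_eq_self (fun z : ℂ => (Ico ρ r).indicator (fun t => (t ^ 2)⁻¹) ‖z‖) a]
    congr 1
    ext z
    by_cases h : z ∈ Metric.ball a r \ Metric.ball a ρ
    · have h' : ‖z - a‖ ∈ Ico ρ r := by
        simpa [dist_eq_norm, and_comm] using h
      simp [indicator_of_mem h, indicator_of_mem h']
    · have h' : ‖z - a‖ ∉ Ico ρ r := by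
        simpa [dist_eq_norm, and_comm] using h
      simp [indicator_of_notMem h, indicator_of_notMem h']
  rw [h0, integral_fun_norm_addHaar volume]
  have h1 : ∀ y ∈ Ioi (0 : ℝ), y ^ (Module.finrank ℝ ℂ - 1) •
      (Ico ρ r).indicator (fun t => (t ^ 2)⁻¹) y = (Ico ρ r).indicator (fun t => t⁻¹) y := by
    intro y hy
    have : y ≠ 0 := ne_of_gt hy
    by_cases h : y ∈ Ico ρ r
    · simp [indicator_of_mem h]; field_simp
    · simp [indicator_of_notMem h]
  rw [setIntegral_congr_fun measurableSet_Ioi h1, setIntegral_indicator measurableSet_Ico]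
  have h2 : Ioi (0 : ℝ) ∩ Ico ρ r = Ico ρ r :=
    inter_eq_right.2 fun y hy => hρ.trans_le hy.1
  rw [h2, integral_Ico_eq_integral_Ioc, ← intervalIntegral.integral_of_le hr,
    integral_inv_of_pos hρ (hρ.trans_le hr)]
  simp [Measure.real, Complex.volume_ball]
  ring

theorem integrableOn_annulus (a : ℂ) {ρ : ℝ} (hρ : 0 < ρ) (r : ℝ) :
    IntegrableOn (fun z : ℂ => (‖z - a‖ ^ 2)⁻¹) (Metric.ball a r \ Metric.ball a ρ) := by
  have hK : IsCompact (Metric.closedBall a r \ Metric.ball a ρ) :=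
    (isCompact_closedBall a r).diff Metric.isOpen_ball
  refine IntegrableOn.mono_set (t := Metric.closedBall a r \ Metric.ball a ρ) ?_
    (sdiff_subset_sdiff_left Metric.ball_subset_closedBall)
  refine ContinuousOn.integrableOn_compact hK fun z hz => ?_
  have : ‖z - a‖ ≠ 0 := by
    have h : ρ ≤ ‖z - a‖ := by simpa [dist_eq_norm] using hz.2
    exact (hρ.trans_le h).ne'
  exact ContinuousAt.continuousWithinAt (by fun_prop (disch := positivity))

/-- The mean value property of holomorphic functions on disks. -/
theorem integral_closedBall_of_differentiableOn {f : ℂ → ℂ} {z : ℂ} {R : ℝ} (hR : 0 < R)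
    (hf : DifferentiableOn ℂ f (Metric.closedBall z R)) :
    ∫ w in Metric.ball z R, f w = (Real.pi * R ^ 2 : ℝ) • f z := by
  have h0 : ∫ w in Metric.ball z R, f w
      = ∫ w : ℂ, (Metric.ball (0 : ℂ) R).indicator (fun w => f (z + w)) w := by
    rw [← integral_indicator measurableSet_ball, ← integral_add_left_eq_self _ z]
    congr 1
    ext w
    by_cases h : w ∈ Metric.ball (0 : ℂ) R
    · have h' : z + w ∈ Metric.ball z R := by simpa [dist_eq_norm] using h
      simp [indicator_of_mem h, indicator_of_mem h']
    · have h' : z + w ∉ Metric.ball z R := by simpa [dist_eq_norm] using h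
      simp [indicator_of_notMem h, indicator_of_notMem h']
  rw [h0, ← Complex.integral_comp_polarCoord_symm, polarCoord_target]
  have h1 : ∀ p ∈ Ioi (0 : ℝ) ×ˢ Ioo (-Real.pi) Real.pi,
      p.1 • (Metric.ball (0 : ℂ) R).indicator (fun w => f (z + w)) (Complex.polarCoord.symm p)
      = (Iio R ×ˢ (univ : Set ℝ)).indicator (fun p : ℝ × ℝ => p.1 • f (circleMap z p.1 p.2)) p := by
    rintro ⟨s, θ⟩ ⟨hs, hθ⟩
    have e1 : z + Complex.polarCoord.symm (s, θ) = circleMap z s θ := by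
      simp only [Complex.polarCoord_symm_apply, circleMap, Complex.exp_mul_I]
      push_cast; ring
    have e2 : Complex.polarCoord.symm (s, θ) ∈ Metric.ball (0 : ℂ) R ↔
        ((s, θ) : ℝ × ℝ) ∈ Iio R ×ˢ (univ : Set ℝ) := by
      rw [mem_ball_zero_iff, Complex.norm_polarCoord_symm]
      have : |s| = s := abs_of_pos hs
      simp [this]
    by_cases h : ((s, θ) : ℝ × ℝ) ∈ Iio R ×ˢ (univ : Set ℝ)
    · rw [indicator_of_mem h, indicator_of_mem (e2.2 h), e1]
    · rw [indicator_of_notMem h, indicator_of_notMem (fun h' => h (e2.1 h')), smul_zero]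
  rw [setIntegral_congr_fun (measurableSet_Ioi.prod measurableSet_Ioo) h1,
    setIntegral_indicator (measurableSet_Iio.prod MeasurableSet.univ)]
  have h2 : Ioi (0 : ℝ) ×ˢ Ioo (-Real.pi) Real.pi ∩ Iio R ×ˢ (univ : Set ℝ)
      = Ioo 0 R ×ˢ Ioo (-Real.pi) Real.pi := by
    rw [prod_inter_prod, Ioi_inter_Iio, inter_univ]
  have hcont : ContinuousOn (fun p : ℝ × ℝ => p.1 • f (circleMap z p.1 p.2))
      (Icc 0 R ×ˢ Icc (-Real.pi) Real.pi) := by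
    refine continuous_fst.continuousOn.smul (hf.continuousOn.comp ?_ ?_)
    · unfold circleMap; fun_prop
    · rintro ⟨s, θ⟩ ⟨hs, -⟩
      simp [circleMap, abs_of_nonneg hs.1, hs.2]
  rw [h2, Measure.volume_eq_prod, setIntegral_prod]
  · have h3 : ∀ s ∈ Ioo 0 R, ∫ θ in Ioo (-Real.pi) Real.pi, s • f (circleMap z s θ)
        = s • ((2 * Real.pi) • f z) := by
      intro s hs
      have hd : DiffContOnCl ℂ f (Metric.ball z |s|) := by
        refine DifferentiableOn.diffContOnCl (hf.mono ?_)
        rw [abs_of_pos hs.1, closure_ball z hs.1.ne']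
        exact Metric.closedBall_subset_closedBall hs.2.le
      have h4 := hd.circleAverage
      rw [Real.circleAverage_eq_integral_add (-Real.pi),
        intervalIntegral.integral_comp_add_right (fun θ => f (circleMap z s θ))] at h4
      rw [← h4, integral_smul, ← integral_Ioc_eq_integral_Ioo,
        ← intervalIntegral.integral_of_le (by linarith [Real.pi_pos]), smul_smul (2 * Real.pi),
        mul_inv_cancel₀ (by positivity), one_smul]
      congr 2 <;> ring
    rw [setIntegral_congr_fun measurableSet_Ioo h3, integral_smul_const,
      ← integral_Ioc_eq_integral_Ioo, ← intervalIntegral.integral_of_le hR.le, integral_id,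
      smul_smul]
    congr 1; ring
  · refine IntegrableOn.mono_set (hcont.integrableOn_compact (isCompact_Icc.prod isCompact_Icc)) ?_
    exact prod_mono Ioo_subset_Icc_self Ioo_subset_Icc_self

/-- The step from `L¹` to pointwise bounds: it turns integral convergence of currents into locally
uniform convergence. -/
theorem norm_le_integral_ball {f : ℂ → ℂ} {z : ℂ} {R : ℝ} (hR : 0 < R)
    (hf : DifferentiableOn ℂ f (Metric.closedBall z R)) :
    ‖f z‖ ≤ (Real.pi * R ^ 2)⁻¹ * ∫ w in Metric.ball z R, ‖f w‖ := by
  have h1 := integral_closedBall_of_differentiableOn hR hf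
  have h2 := norm_integral_le_integral_norm (μ := volume.restrict (Metric.ball z R)) f
  rw [h1, norm_smul, Real.norm_of_nonneg (by positivity)] at h2
  have : 0 < Real.pi * R ^ 2 := by positivity
  rw [inv_mul_eq_div, le_div_iff₀ this]
  linarith

/-! ### Weak divergence-freeness of holomorphic currents. -/

/-- The pairing of the current `Re (H dz)` with a linear form. -/
noncomputable def curDot (H : ℂ) (L : ℂ →L[ℝ] ℝ) : ℝ := H.re * L 1 - H.im * L Complex.I

theorem curDot_smul (H : ℂ) (c : ℝ) (L : ℂ →L[ℝ] ℝ) : curDot H (c • L) = c * curDot H L := by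
  simp [curDot]; ring

theorem curDot_add (H : ℂ) (L L' : ℂ →L[ℝ] ℝ) :
    curDot H (L + L') = curDot H L + curDot H L' := by
  simp [curDot]; ring

theorem curDot_zero (H : ℂ) : curDot H 0 = 0 := by simp [curDot]

theorem curDot_curForm (H K : ℂ) : curDot H (curForm K) = H.re * K.re + H.im * K.im := by
  simp [curDot]

theorem curDot_curForm_self (H : ℂ) : curDot H (curForm H) = ‖H‖ ^ 2 := by
  rw [curDot_curForm, ← Complex.normSq_eq_norm_sq, Complex.normSq_apply]

theorem abs_curDot_le (H : ℂ) (L : ℂ →L[ℝ] ℝ) : |curDot H L| ≤ 2 * ‖H‖ * ‖L‖ := by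
  have h1 : |L 1| ≤ ‖L‖ := by simpa using L.le_opNorm 1
  have h2 : |L Complex.I| ≤ ‖L‖ := by simpa using L.le_opNorm Complex.I
  have h3 := Complex.abs_re_le_norm H
  have h4 := Complex.abs_im_le_norm H
  calc |curDot H L| ≤ |H.re * L 1| + |H.im * L Complex.I| := abs_sub _ _
    _ = |H.re| * |L 1| + |H.im| * |L Complex.I| := by rw [abs_mul, abs_mul]
    _ ≤ ‖H‖ * ‖L‖ + ‖H‖ * ‖L‖ := by gcongr
    _ = _ := by ring

theorem continuous_curDot : Continuous fun p : ℂ × (ℂ →L[ℝ] ℝ) => curDot p.1 p.2 := by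
  unfold curDot; fun_prop

theorem contDiff_of_eq_zero_off_compact {O K : Set ℂ} (hO : IsOpen O) (hK : IsCompact K)
    (hKO : K ⊆ O) {φ : ℂ → ℝ} (hφ : ContDiffOn ℝ 1 φ O) (h0 : ∀ z ∉ K, φ z = 0) :
    ContDiff ℝ 1 φ := by
  refine contDiff_iff_contDiffAt.2 fun z => ?_
  by_cases hz : z ∈ K
  · exact hφ.contDiffAt (hO.mem_nhds (hKO hz))
  · refine (contDiffAt_const (c := (0 : ℝ))).congr_of_eventuallyEq ?_
    filter_upwards [hK.isClosed.isOpen_compl.mem_nhds hz] with w hw using h0 w hw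

theorem tsupport_subset_of_eq_zero_off {K : Set ℂ} (hK : IsCompact K) {φ : ℂ → ℝ}
    (h0 : ∀ z ∉ K, φ z = 0) : tsupport φ ⊆ K :=
  closure_minimal (fun z hz => by_contra fun h => hz (h0 z h)) hK.isClosed

theorem integrable_mul_of_tsupport_subset {O : Set ℂ} (hO : IsOpen O) {f φ : ℂ → ℝ}
    (hf : ContinuousOn f O) (hφ : Continuous φ) (hc : HasCompactSupport φ)
    (hs : tsupport φ ⊆ O) : Integrable (fun z => f z * φ z) := by
  have h1 : tsupport (fun z => f z * φ z) ⊆ tsupport φ :=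
    closure_mono (Function.support_mul_subset_right f φ)
  refine Continuous.integrable_of_hasCompactSupport ?_ (hc.mul_left (f := f))
  refine continuous_of_tsupport fun z hz => ?_
  exact (hf.continuousAt (hO.mem_nhds (hs (h1 hz)))).mul hφ.continuousAt

/-- A holomorphic current is weakly divergence free. -/
theorem integral_curDot_fderiv_eq_zero {O K : Set ℂ} (hO : IsOpen O) (hK : IsCompact K)
    (hKO : K ⊆ O) {H : ℂ → ℂ} (hH : DifferentiableOn ℂ H O) {φ : ℂ → ℝ}
    (hφ : ContDiffOn ℝ 1 φ O) (h0 : ∀ z ∉ K, φ z = 0) :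
    Integrable (fun z => curDot (H z) (fderiv ℝ φ z)) ∧
      ∫ z, curDot (H z) (fderiv ℝ φ z) = 0 := by
  have hφ' := contDiff_of_eq_zero_off_compact hO hK hKO hφ h0
  have hs := (tsupport_subset_of_eq_zero_off hK h0).trans hKO
  have hc : HasCompactSupport φ := HasCompactSupport.intro hK h0
  have hcH : ContDiffOn ℝ 1 H O := (hH.contDiffOn hO).restrict_scalars ℝ
  have hder : ∀ z ∈ O, HasFDerivAt H (fderiv ℝ H z) z := fun z hz =>
    ((hcH.contDiffAt (hO.mem_nhds hz)).differentiableAt (by norm_num)).hasFDerivAt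
  have hre : ∀ z ∈ O, HasFDerivAt (fun w => (H w).re) (Complex.reCLM.comp (fderiv ℝ H z)) z :=
    fun z hz => Complex.reCLM.hasFDerivAt.comp z (hder z hz)
  have him : ∀ z ∈ O, HasFDerivAt (fun w => (H w).im) (Complex.imCLM.comp (fderiv ℝ H z)) z :=
    fun z hz => Complex.imCLM.hasFDerivAt.comp z (hder z hz)
  have hCR : ∀ z ∈ O, fderiv ℝ H z Complex.I = Complex.I • fderiv ℝ H z 1 := fun z hz =>
    (differentiableAt_complex_iff_differentiableAt_real.1
      (hH.differentiableAt (hO.mem_nhds hz))).2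
  have hcont : ContinuousOn (fun z => fderiv ℝ H z) O :=
    hcH.continuousOn_fderiv_of_isOpen hO (by norm_num)
  have hdφ : ∀ v, Continuous fun z => fderiv ℝ φ z v := fun v =>
    (hφ'.continuous_fderiv (by norm_num)).clm_apply continuous_const
  have hdc : ∀ v, HasCompactSupport fun z => fderiv ℝ φ z v := fun v =>
    hc.fderiv_apply (𝕜 := ℝ) v
  have hds : ∀ v, tsupport (fun z => fderiv ℝ φ z v) ⊆ O := fun v =>
    (tsupport_fderiv_apply_subset ℝ v).trans hs
  have hd : ∀ z, DifferentiableAt ℝ φ z := fun z => (hφ'.differentiable (by norm_num)) z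
  have hIre : ContinuousOn (fun z => (H z).re) O :=
    Complex.continuous_re.comp_continuousOn hH.continuousOn
  have hIim : ContinuousOn (fun z => (H z).im) O :=
    Complex.continuous_im.comp_continuousOn hH.continuousOn
  have i1 := integrable_mul_of_tsupport_subset hO hIre (hdφ 1) (hdc 1) (hds 1)
  have i2 := integrable_mul_of_tsupport_subset hO hIim (hdφ Complex.I) (hdc _) (hds _)
  refine ⟨i1.sub i2, ?_⟩
  have j1 : Integrable fun z => (Complex.reCLM.comp (fderiv ℝ H z)) 1 * φ z :=
    integrable_mul_of_tsupport_subset hO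
      (Complex.continuous_re.comp_continuousOn (hcont.clm_apply continuousOn_const))
      hφ'.continuous hc hs
  have j2 : Integrable fun z => (Complex.imCLM.comp (fderiv ℝ H z)) Complex.I * φ z :=
    integrable_mul_of_tsupport_subset hO
      (Complex.continuous_im.comp_continuousOn (hcont.clm_apply continuousOn_const))
      hφ'.continuous hc hs
  have e1 := integral_bilinear_hasFDerivAt_right_eq_neg_left_of_integrable
    (B := ContinuousLinearMap.mul ℝ ℝ) (v := (1 : ℂ)) (μ := volume)
    (f := fun z => (H z).re) (g := φ) (g' := fderiv ℝ φ) j1 i1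
    (integrable_mul_of_tsupport_subset hO hIre hφ'.continuous hc hs)
    (fun z hz => hre z (hs hz)) (fun z _ => (hd z).hasFDerivAt)
  have e2 := integral_bilinear_hasFDerivAt_right_eq_neg_left_of_integrable
    (B := ContinuousLinearMap.mul ℝ ℝ) (v := Complex.I) (μ := volume)
    (f := fun z => (H z).im) (g := φ) (g' := fderiv ℝ φ) j2 i2
    (integrable_mul_of_tsupport_subset hO hIim hφ'.continuous hc hs)
    (fun z hz => him z (hs hz)) (fun z _ => (hd z).hasFDerivAt)
  simp only [ContinuousLinearMap.mul_apply'] at e1 e2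
  have e3 : ∫ z, curDot (H z) (fderiv ℝ φ z)
      = (∫ z, (H z).re * fderiv ℝ φ z 1) - ∫ z, (H z).im * fderiv ℝ φ z Complex.I :=
    integral_sub i1 i2
  rw [e3, e1, e2, neg_sub_neg, sub_eq_zero]
  congr 1
  -- After integration by parts, what remains is the real part of the Cauchy–Riemann equation for
  -- `H`, multiplied by `φ`.
  ext z
  by_cases hz : z ∈ O
  · simp [hCR z hz]
  · have : φ z = 0 := image_eq_zero_of_notMem_tsupport fun h => hz (hs h)
    simp [this]

theorem isOpen_inter_preimage_compl_zero {O : Set ℂ} (hO : IsOpen O) {ψ : ℂ → ℝ}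
    (hψ : ContinuousOn ψ O) : IsOpen (O ∩ ψ ⁻¹' {0}ᶜ) :=
  hψ.isOpen_inter_preimage hO isOpen_compl_singleton

/-- The gradient vanishes almost everywhere on a level set. -/
theorem ae_fderiv_eq_zero_of_eq_zero {O : Set ℂ} (hO : IsOpen O) {ψ : ℂ → ℝ}
    (hψ : DifferentiableOn ℝ ψ O) : ∀ᵐ z, z ∈ O → ψ z = 0 → fderiv ℝ ψ z = 0 := by
  set s : Set ℂ := O ∩ ψ ⁻¹' {0}
  have hs : MeasurableSet s := by
    have : s = O \ (O ∩ ψ ⁻¹' {0}ᶜ) := by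
      ext z; simp [s]
    rw [this]
    exact hO.measurableSet.diff (isOpen_inter_preimage_compl_zero hO hψ.continuousOn).measurableSet
  -- On its zero set `ψ` is approximated by the zero map with error constant `0`, so at almost every
  -- point its derivative is within `0` of zero. The cast to `ℂ` makes `ψ` a self-map of the plane.
  have ha : ApproximatesLinearOn (fun z => (ψ z : ℂ)) (0 : ℂ →L[ℝ] ℂ) s 0 := by
    refine fun z hz w hw => ?_
    have h1 : ψ z = 0 := hz.2
    have h2 : ψ w = 0 := hw.2
    simp [h1, h2]
  have h := ha.norm_fderiv_sub_le volume hs (fun z => Complex.ofRealCLM.comp (fderiv ℝ ψ z))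
    (fun z hz => (Complex.ofRealCLM.hasFDerivAt.comp z
      (hψ.differentiableAt (hO.mem_nhds hz.1)).hasFDerivAt).hasFDerivWithinAt)
  rw [ae_restrict_iff' hs] at h
  filter_upwards [h] with z hz h1 h2
  have h3 : Complex.ofRealCLM.comp (fderiv ℝ ψ z) = 0 := by
    have := hz ⟨h1, h2⟩
    simpa using this
  ext ξ
  have := congrArg (fun L => (L ξ)) h3
  simpa using this

/-! ### Smooth truncations of values and radial cut-offs. -/

theorem differentiable_smoothTransition : Differentiable ℝ Real.smoothTransition :=
  (Real.smoothTransition.contDiff (n := 1)).differentiable (by norm_num)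

theorem continuous_deriv_smoothTransition : Continuous (deriv Real.smoothTransition) :=
  (Real.smoothTransition.contDiff (n := 1)).continuous_deriv (by norm_num)

theorem deriv_smoothTransition_of_one_lt {t : ℝ} (ht : 1 < t) :
    deriv Real.smoothTransition t = 0 := by
  have : Real.smoothTransition =ᶠ[𝓝 t] fun _ => 1 := by
    filter_upwards [lt_mem_nhds ht] with s hs using Real.smoothTransition.one_of_one_le hs.le
  rw [this.deriv_eq]; simp

theorem deriv_smoothTransition_of_neg {t : ℝ} (ht : t < 0) :
    deriv Real.smoothTransition t = 0 := by
  have : Real.smoothTransition =ᶠ[𝓝 t] fun _ => 0 := by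
    filter_upwards [gt_mem_nhds ht] with s hs using Real.smoothTransition.zero_of_nonpos hs.le
  rw [this.deriv_eq]; simp

theorem exists_deriv_smoothTransition_le :
    ∃ B, 0 < B ∧ ∀ t, |deriv Real.smoothTransition t| ≤ B := by
  obtain ⟨B, hB⟩ := (isCompact_Icc (a := (0 : ℝ)) (b := 1)).exists_bound_of_continuousOn
    continuous_deriv_smoothTransition.continuousOn
  refine ⟨max B 1, by positivity, fun t => ?_⟩
  by_cases h0 : t < 0
  · simp [deriv_smoothTransition_of_neg h0]
  by_cases h1 : 1 < t
  · simp [deriv_smoothTransition_of_one_lt h1]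
  · exact (hB t ⟨not_lt.1 h0, not_lt.1 h1⟩).trans (le_max_left _ _)

/-- A monotone truncation, vanishing on `[-1, 1]` and equal to the identity at infinity. -/
noncomputable def trunc (t : ℝ) : ℝ := t * Real.smoothTransition (t ^ 2 - 1)

/-- The derivative of `trunc`. -/
noncomputable def truncDeriv (t : ℝ) : ℝ :=
  Real.smoothTransition (t ^ 2 - 1) + t * (deriv Real.smoothTransition (t ^ 2 - 1) * (2 * t))

theorem hasDerivAt_trunc (t : ℝ) : HasDerivAt trunc (truncDeriv t) t := by
  have h1 : HasDerivAt (fun s : ℝ => s ^ 2 - 1) (2 * t) t := by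
    simpa using (hasDerivAt_pow 2 t).sub_const 1
  have h2 := (differentiable_smoothTransition (t ^ 2 - 1)).hasDerivAt.comp t h1
  have h3 := (hasDerivAt_id t).mul h2
  have h4 : HasDerivAt trunc _ t := h3
  refine h4.congr_deriv ?_
  simp [truncDeriv]

theorem contDiff_trunc : ContDiff ℝ 1 trunc := by
  refine contDiff_id.mul ((Real.smoothTransition.contDiff (n := 1)).comp ?_)
  fun_prop

theorem continuous_truncDeriv : Continuous truncDeriv := by
  have h1 := continuous_deriv_smoothTransition
  have h2 := differentiable_smoothTransition.continuous
  unfold truncDeriv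
  fun_prop

/-- The sign is what makes truncation compatible with energy estimates: testing a current with the
truncation of its own phase gives a nonnegative integrand. -/
theorem truncDeriv_nonneg (t : ℝ) : 0 ≤ truncDeriv t := by
  have h1 := Real.smoothTransition.monotone.deriv_nonneg (x := t ^ 2 - 1)
  have h2 := Real.smoothTransition.nonneg (t ^ 2 - 1)
  have : t * (deriv Real.smoothTransition (t ^ 2 - 1) * (2 * t))
    = 2 * t ^ 2 * deriv Real.smoothTransition (t ^ 2 - 1) := by ring
  rw [truncDeriv, this]
  positivity

theorem trunc_eq_zero {t : ℝ} (ht : |t| ≤ 1) : trunc t = 0 := by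
  have : t ^ 2 - 1 ≤ 0 := by
    have := (sq_le_one_iff_abs_le_one t).2 ht
    linarith
  rw [trunc, Real.smoothTransition.zero_of_nonpos this, mul_zero]

theorem trunc_ne_zero {t : ℝ} (ht : 1 < |t|) : trunc t ≠ 0 := by
  have h1 : 0 < t ^ 2 - 1 := by
    have := (one_lt_sq_iff_one_lt_abs t).2 ht
    linarith
  have h2 : t ≠ 0 := by rintro rfl; simp at ht; linarith
  exact mul_ne_zero h2 (Real.smoothTransition.pos_of_pos h1).ne'

theorem abs_trunc_le (t : ℝ) : |trunc t| ≤ |t| := by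
  rw [trunc, abs_mul, abs_of_nonneg (Real.smoothTransition.nonneg _)]
  exact mul_le_of_le_one_right (abs_nonneg _) (Real.smoothTransition.le_one _)

theorem truncDeriv_eq_one {t : ℝ} (ht : 2 < t ^ 2) : truncDeriv t = 1 := by
  rw [truncDeriv, Real.smoothTransition.one_of_one_le (by linarith),
    deriv_smoothTransition_of_one_lt (by linarith)]
  simp

theorem exists_truncDeriv_le : ∃ B, 0 < B ∧ ∀ t, truncDeriv t ≤ B := by
  obtain ⟨B, hB, h⟩ := exists_deriv_smoothTransition_le
  refine ⟨1 + 4 * B, by positivity, fun t => ?_⟩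
  by_cases ht : 2 < t ^ 2
  · rw [truncDeriv_eq_one ht]; linarith
  · have h1 := Real.smoothTransition.le_one (t ^ 2 - 1)
    have h2 : t * (deriv Real.smoothTransition (t ^ 2 - 1) * (2 * t))
      = 2 * t ^ 2 * deriv Real.smoothTransition (t ^ 2 - 1) := by ring
    have h3 := le_of_abs_le (h (t ^ 2 - 1))
    rw [truncDeriv, h2]
    nlinarith [sq_nonneg t]

theorem hasFDerivAt_trunc_comp {ψ : ℂ → ℝ} {z : ℂ} (hψ : DifferentiableAt ℝ ψ z) (ε : ℝ)
    (hε : ε ≠ 0) :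
    HasFDerivAt (fun w => ε * trunc (ψ w / ε)) (truncDeriv (ψ z / ε) • fderiv ℝ ψ z) z := by
  have h1 : HasFDerivAt (fun w => ψ w / ε) (ε⁻¹ • fderiv ℝ ψ z) z := by
    simpa [div_eq_mul_inv, mul_comm] using hψ.hasFDerivAt.const_mul ε⁻¹
  have h2 := ((hasDerivAt_trunc (ψ z / ε)).comp_hasFDerivAt z h1).const_mul ε
  refine h2.congr_fderiv ?_
  rw [smul_smul, smul_smul]
  congr 1
  field_simp

/-- A smooth radial cut-off at scale `ε` around `a`. -/
noncomputable def radialBump (a : ℂ) (ε : ℝ) (z : ℂ) : ℝ :=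
  Real.smoothTransition (2 - ‖z - a‖ ^ 2 / ε ^ 2)

theorem contDiff_radialBump (a : ℂ) (ε : ℝ) : ContDiff ℝ 1 (radialBump a ε) := by
  refine (Real.smoothTransition.contDiff (n := 1)).comp ?_
  have : ContDiff ℝ 1 fun z : ℂ => ‖z - a‖ ^ 2 :=
    (contDiff_norm_sq ℝ).comp (contDiff_id.sub contDiff_const)
  exact contDiff_const.sub (this.div_const _)

theorem fderiv_radialBump (a : ℂ) (ε : ℝ) (z : ℂ) :
    fderiv ℝ (radialBump a ε) z =
      (-(2 / ε ^ 2) * deriv Real.smoothTransition (2 - ‖z - a‖ ^ 2 / ε ^ 2)) •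
        (innerSL ℝ (z - a)) := by
  have h0 : HasFDerivAt (fun w : ℂ => ‖w - a‖ ^ 2) (2 • innerSL ℝ (z - a)) z := by
    refine (HasFDerivAt.comp z (g := fun w : ℂ => ‖w‖ ^ 2)
      (hasStrictFDerivAt_norm_sq (z - a)).hasFDerivAt
      ((hasFDerivAt_id (𝕜 := ℝ) z).sub_const a)).congr_fderiv ?_
    ext ξ; simp
  have h1 := ((h0.mul_const (ε ^ 2)⁻¹).const_sub 2)
  have h2 := (differentiable_smoothTransition _).hasDerivAt.comp_hasFDerivAt z h1
  have h3 : HasFDerivAt (radialBump a ε) _ z := h2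
  rw [h3.fderiv]
  ext ξ
  simp [div_eq_mul_inv]
  ring

theorem curDot_innerSL (H w : ℂ) : curDot H (innerSL ℝ w) = (H * w).re := by
  simp [curDot, Complex.inner]

theorem radialBump_eq_one {a : ℂ} {ε : ℝ} (hε : 0 < ε) {z : ℂ} (h : ‖z - a‖ ≤ ε) :
    radialBump a ε z = 1 := by
  refine Real.smoothTransition.one_of_one_le ?_
  have : ‖z - a‖ ^ 2 / ε ^ 2 ≤ 1 := by
    rw [div_le_one (by positivity)]; gcongr
  linarith

theorem radialBump_eq_zero {a : ℂ} {ε : ℝ} (hε : 0 < ε) {z : ℂ} (h : 2 * ε ≤ ‖z - a‖) :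
    radialBump a ε z = 0 := by
  refine Real.smoothTransition.zero_of_nonpos ?_
  have : 2 ≤ ‖z - a‖ ^ 2 / ε ^ 2 := by
    rw [le_div_iff₀ (by positivity)]; nlinarith
  linarith

theorem fderiv_radialBump_eq_zero {a : ℂ} {ε : ℝ} (hε : 0 < ε) {z : ℂ} (h : 2 * ε ≤ ‖z - a‖) :
    fderiv ℝ (radialBump a ε) z = 0 := by
  have : 2 < ‖z - a‖ ^ 2 / ε ^ 2 := by
    rw [lt_div_iff₀ (by positivity)]; nlinarith
  rw [fderiv_radialBump, deriv_smoothTransition_of_neg (by linarith)]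
  simp

/-- A radial function only sees the radial component of the current, which is where `Re (H (z - a))`
comes from. The bound does not depend on `ε`, so it can serve as a dominating function when the
cut-off shrinks. -/
theorem exists_abs_curDot_radialBump_le : ∃ B, 0 < B ∧ ∀ (a : ℂ) (ε : ℝ), 0 < ε → ∀ H z : ℂ,
    |curDot H (fderiv ℝ (radialBump a ε) z)| ≤ B * |(H * (z - a)).re| * (‖z - a‖ ^ 2)⁻¹ := by
  obtain ⟨B, hB, h⟩ := exists_deriv_smoothTransition_le
  refine ⟨8 * B, by positivity, fun a ε hε H z => ?_⟩
  by_cases hz : 2 * ε ≤ ‖z - a‖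
  · rw [fderiv_radialBump_eq_zero hε hz, curDot_zero, abs_zero]; positivity
  · rw [fderiv_radialBump, curDot_smul, curDot_innerSL, abs_mul, abs_mul, abs_neg,
      abs_of_nonneg (by positivity : (0 : ℝ) ≤ 2 / ε ^ 2)]
    rcases eq_or_ne z a with rfl | hza
    · simp
    have hpos : 0 < ‖z - a‖ := by simpa [sub_eq_zero] using hza
    -- The gradient lives in `‖z - a‖ < 2 ε`, which allows `ε⁻²` to be traded for `4 ‖z - a‖⁻²`.
    have h1 : 2 / ε ^ 2 ≤ 8 * (‖z - a‖ ^ 2)⁻¹ := by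
      rw [← div_eq_mul_inv, div_le_div_iff₀ (by positivity) (by positivity)]
      nlinarith
    calc _ ≤ 8 * (‖z - a‖ ^ 2)⁻¹ * B * |(H * (z - a)).re| := by
          gcongr; exact h _
      _ = _ := by ring

/-! ### Testing currents across vortices and up to the boundary. -/

/-- A current with vortices is weakly divergence free, also against test functions that are not
differentiable at the vortices. -/
theorem setIntegral_curDot_fderiv_eq_zero {Ω K : Set ℂ} (hΩ : IsOpen Ω)
    (hΩb : Bornology.IsBounded Ω) (hK : IsCompact K) (hKΩ : K ⊆ Ω) {n : ℕ} {x : Fin n → ℂ}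
    (hx : Function.Injective x) {H : ℂ → ℂ} (hH : DifferentiableOn ℂ H (Ω \ range x))
    (hres : ∀ j, ∃ C, ∀ᶠ z in 𝓝[≠] (x j), |(H z * (z - x j)).re| ≤ C * ‖z - x j‖)
    {φ : ℂ → ℝ} (hφ : ContDiffOn ℝ 1 φ (Ω \ range x)) {M : ℝ} (hM : ∀ z, |φ z| ≤ M)
    (h0 : ∀ z ∉ K, φ z = 0)
    (hint : IntegrableOn (fun z => curDot (H z) (fderiv ℝ φ z)) Ω) :
    ∫ z in Ω, curDot (H z) (fderiv ℝ φ z) = 0 := by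
  set O := Ω \ range x with hO_def
  have hO : IsOpen O := hΩ.sdiff (finite_range x).isClosed
  have hM0 : 0 ≤ M := (abs_nonneg _).trans (hM 0)
  have hnull : ∀ᵐ z : ℂ, z ∉ range x := by
    have : volume (range x) = 0 := (finite_range x).measure_zero _
    exact measure_eq_zero_iff_ae_notMem.1 this
  set ε : ℕ → ℝ := fun m => 1 / ((m : ℝ) + 1) with hε_def
  have hε : ∀ m, 0 < ε m := fun m => by positivity
  have hεt : Tendsto ε atTop (𝓝 0) := tendsto_one_div_add_atTop_nhds_zero_nat
  set θ : ℕ → ℂ → ℝ := fun m z => 1 - ∑ j, radialBump (x j) (ε m) z with hθ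
  have hθc : ∀ m, ContDiff ℝ 1 (θ m) := fun m =>
    contDiff_const.sub (ContDiff.sum fun j _ => contDiff_radialBump _ _)
  have hθd : ∀ m z, fderiv ℝ (θ m) z = -∑ j, fderiv ℝ (radialBump (x j) (ε m)) z := by
    intro m z
    have : HasFDerivAt (θ m) (-∑ j, fderiv ℝ (radialBump (x j) (ε m)) z) z := by
      refine (HasFDerivAt.fun_sum fun j _ => ?_).const_sub 1
      exact ((contDiff_radialBump (x j) (ε m)).differentiable (by norm_num) z).hasFDerivAt
    exact this.fderiv
  have hθb : ∀ m z, |θ m z| ≤ 1 + n := by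
    intro m z
    have h1 : 0 ≤ ∑ j, radialBump (x j) (ε m) z :=
      Finset.sum_nonneg fun j _ => Real.smoothTransition.nonneg _
    have h2 : ∑ j, radialBump (x j) (ε m) z ≤ ∑ _j : Fin n, (1 : ℝ) :=
      Finset.sum_le_sum fun j _ => Real.smoothTransition.le_one _
    simp at h2
    rw [abs_le]; constructor <;> simp only [hθ] <;> linarith
  obtain ⟨B, hB, hBb⟩ := exists_abs_curDot_radialBump_le
  choose C hC using hres
  -- a radius below which all local estimates hold
  obtain ⟨r, hr, hrC, hrx⟩ : ∃ r > 0, (∀ j, ∀ z, z ≠ x j → ‖z - x j‖ < r →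
      |(H z * (z - x j)).re| ≤ C j * ‖z - x j‖) ∧ ∀ j k, j ≠ k → r ≤ ‖x j - x k‖ := by
    have h1 : ∀ j, ∀ᶠ r in 𝓝[>] (0 : ℝ), ∀ z, z ≠ x j → ‖z - x j‖ < r →
        |(H z * (z - x j)).re| ≤ C j * ‖z - x j‖ := by
      intro j
      obtain ⟨s, hs, h⟩ := Metric.eventually_nhds_iff.1 (eventually_nhdsWithin_iff.1 (hC j))
      filter_upwards [Ioo_mem_nhdsGT hs] with r hr z hz hzr
      exact h (by rw [dist_eq_norm]; exact hzr.trans hr.2) hz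
    have h2 : ∀ j k, ∀ᶠ r in 𝓝[>] (0 : ℝ), j ≠ k → r ≤ ‖x j - x k‖ := by
      intro j k
      by_cases hjk : j = k
      · simp [hjk]
      · have : 0 < ‖x j - x k‖ := by simpa [sub_eq_zero] using fun h => hjk (hx h)
        filter_upwards [Ioo_mem_nhdsGT this] with r hr _ using hr.2.le
    have h3 := (eventually_all.2 h1).and (eventually_all.2 fun j => eventually_all.2 (h2 j))
    obtain ⟨r, hr⟩ := (h3.and self_mem_nhdsWithin).exists
    exact ⟨r, hr.2, hr.1.1, hr.1.2⟩
  have hsmall : ∀ᶠ m in atTop, 4 * ε m < r := by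
    have : Tendsto (fun m => 4 * ε m) atTop (𝓝 0) := by simpa using hεt.const_mul 4
    exact this.eventually (gt_mem_nhds hr)
  have hOt : ∀ z ∉ range x, ∀ᶠ m in atTop, ∀ j, 2 * ε m ≤ ‖z - x j‖ := by
    intro z hz
    refine eventually_all.2 fun j => ?_
    have hp : 0 < ‖z - x j‖ := by
      rw [norm_pos_iff, sub_ne_zero]; exact fun h => hz ⟨j, h.symm⟩
    have : Tendsto (fun m => 2 * ε m) atTop (𝓝 0) := by simpa using hεt.const_mul 2
    filter_upwards [this.eventually (gt_mem_nhds hp)] with m hm using hm.le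
  have hθ1 : ∀ z ∉ range x, ∀ᶠ m in atTop, θ m z = 1 ∧ fderiv ℝ (θ m) z = 0 := by
    intro z hz
    filter_upwards [hOt z hz] with m hm
    refine ⟨?_, ?_⟩
    · have : ∑ j, radialBump (x j) (ε m) z = 0 :=
        Finset.sum_eq_zero fun j _ => radialBump_eq_zero (hε m) (hm j)
      simp only [hθ, this, sub_zero]
    · rw [hθd, Finset.sum_eq_zero, neg_zero]
      exact fun j _ => fderiv_radialBump_eq_zero (hε m) (hm j)
  -- the test functions cut off around the vortices
  have hT1 : ∀ᶠ m in atTop, ∫ z in Ω, curDot (H z) (fderiv ℝ (fun w => θ m w * φ w) z) = 0 := by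
    filter_upwards [hsmall] with m hm
    have hK' : IsCompact (K \ ⋃ j, Metric.ball (x j) (ε m)) :=
      hK.diff (isOpen_iUnion fun j => Metric.isOpen_ball)
    have hK'O : K \ ⋃ j, Metric.ball (x j) (ε m) ⊆ O := by
      rintro z ⟨hz, hz'⟩
      refine ⟨hKΩ hz, ?_⟩
      rintro ⟨j, rfl⟩
      exact hz' (mem_iUnion.2 ⟨j, Metric.mem_ball_self (hε m)⟩)
    have hz0 : ∀ z ∉ K \ ⋃ j, Metric.ball (x j) (ε m), θ m z * φ z = 0 := by
      intro z hz
      by_cases hzK : z ∈ K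
      · have : ∃ j, z ∈ Metric.ball (x j) (ε m) := by
          by_contra h
          exact hz ⟨hzK, fun h' => h (mem_iUnion.1 h')⟩
        obtain ⟨j, hj⟩ := this
        rw [Metric.mem_ball, dist_eq_norm] at hj
        -- The bumps have disjoint supports, since `4 ε m < r` and the vortices are at least `r`
        -- apart.
        have h1 : ∑ k, radialBump (x k) (ε m) z = 1 := by
          rw [Finset.sum_eq_single j]
          · exact radialBump_eq_one (hε m) hj.le
          · intro k _ hk
            refine radialBump_eq_zero (hε m) ?_
            have h2 := hrx k j hk
            have h3 : ‖x k - x j‖ ≤ ‖z - x k‖ + ‖z - x j‖ := by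
              rw [norm_sub_rev z (x k)]; exact norm_sub_le_norm_sub_add_norm_sub _ _ _
            have := hε m
            linarith
          · simp
        simp [hθ, h1]
      · rw [h0 z hzK, mul_zero]
    have h := (integral_curDot_fderiv_eq_zero hO hK' hK'O hH
      ((hθc m).contDiffOn.mul hφ) hz0).2
    rw [setIntegral_eq_integral_of_forall_compl_eq_zero]
    · exact h
    · intro z hz
      have : fderiv ℝ (fun w => θ m w * φ w) z = 0 := by
        have : (fun w => θ m w * φ w) =ᶠ[𝓝 z] fun _ => 0 := by
          filter_upwards [hK'.isClosed.isOpen_compl.mem_nhds fun h => hz (hKΩ h.1)] with w hw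
          exact hz0 w hw
        rw [this.fderiv_eq]; simp
      rw [this, curDot_zero]
  have hsplit : ∀ m, ∀ z ∈ O, curDot (H z) (fderiv ℝ (fun w => θ m w * φ w) z) =
      θ m z * curDot (H z) (fderiv ℝ φ z) + φ z * curDot (H z) (fderiv ℝ (θ m) z) := by
    intro m z hz
    rw [fderiv_fun_mul ((hθc m).differentiable (by norm_num) z)
      ((hφ.contDiffAt (hO.mem_nhds hz)).differentiableAt (by norm_num)), curDot_add,
      curDot_smul, curDot_smul]
  have hmeas : ∀ f : ℂ → ℝ, ContinuousOn f O → AEStronglyMeasurable f (volume.restrict Ω) := by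
    intro f hf
    have h1 := hf.aestronglyMeasurable (μ := volume) hO.measurableSet
    have h2 : volume.restrict O = volume.restrict Ω := by
      refine Measure.restrict_congr_set ?_
      filter_upwards [hnull] with z hz
      exact propext ⟨fun h => h.1, fun h => ⟨h, hz⟩⟩
    rwa [h2] at h1
  have hHc : ContinuousOn H O := hH.continuousOn
  have hφd : ContinuousOn (fderiv ℝ φ) O := hφ.continuousOn_fderiv_of_isOpen hO (by norm_num)
  have hdotc : ContinuousOn (fun z => curDot (H z) (fderiv ℝ φ z)) O :=
    continuous_curDot.comp_continuousOn (hHc.prodMk hφd)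
  have hdotθ : ∀ m, ContinuousOn (fun z => curDot (H z) (fderiv ℝ (θ m) z)) O := fun m =>
    continuous_curDot.comp_continuousOn
      (hHc.prodMk ((hθc m).continuous_fderiv (by norm_num)).continuousOn)
  have haeO : ∀ᵐ z ∂(volume.restrict Ω), z ∈ O := by
    filter_upwards [ae_restrict_mem hΩ.measurableSet, ae_restrict_of_ae hnull] with z h1 h2
    exact ⟨h1, h2⟩
  have hlim1 : Tendsto (fun m => ∫ z in Ω, θ m z * curDot (H z) (fderiv ℝ φ z)) atTop
      (𝓝 (∫ z in Ω, curDot (H z) (fderiv ℝ φ z))) := by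
    refine MeasureTheory.tendsto_integral_of_dominated_convergence
      (fun z => (1 + n) * |curDot (H z) (fderiv ℝ φ z)|)
      (fun m => hmeas _ ((hθc m).continuous.continuousOn.mul hdotc)) (hint.abs.const_mul _)
      (fun m => ae_of_all _ fun z => ?_) ?_
    · rw [Real.norm_eq_abs, abs_mul]
      exact mul_le_mul_of_nonneg_right (hθb m z) (abs_nonneg _)
    · filter_upwards [haeO] with z hz
      refine tendsto_const_nhds.congr' ?_
      filter_upwards [hθ1 z hz.2] with m hm
      rw [hm.1, one_mul]
  -- The gradient of the cut-off blows up like `1 / ε m`, and the current may have a simple pole.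
  -- The bound on the radial component removes one of the two singular factors and leaves `‖z - x
  -- j‖⁻¹`, which is integrable.
  have hbnd : ∀ᶠ m in atTop, ∀ z ∈ O, |φ z * curDot (H z) (fderiv ℝ (θ m) z)| ≤
      M * ∑ j, B * |C j| * ‖z - x j‖⁻¹ := by
    filter_upwards [hsmall] with m hm z hz
    rw [abs_mul]
    refine mul_le_mul (hM z) ?_ (abs_nonneg _) hM0
    have h1 : curDot (H z) (fderiv ℝ (θ m) z)
        = -∑ j, curDot (H z) (fderiv ℝ (radialBump (x j) (ε m)) z) := by
      rw [hθd]; simp [curDot, Finset.mul_sum, Finset.sum_sub_distrib]; ring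
    rw [h1, abs_neg]
    refine (Finset.abs_sum_le_sum_abs _ _).trans (Finset.sum_le_sum fun j _ => ?_)
    by_cases hzj : 2 * ε m ≤ ‖z - x j‖
    · rw [fderiv_radialBump_eq_zero (hε m) hzj, curDot_zero, abs_zero]; positivity
    · have hne : z ≠ x j := fun h => hz.2 ⟨j, h.symm⟩
      have hpos : 0 < ‖z - x j‖ := by simpa [sub_eq_zero] using hne
      have h2 := hrC j z hne (by have := hε m; linarith)
      refine (hBb (x j) (ε m) (hε m) (H z) z).trans ?_
      calc B * |(H z * (z - x j)).re| * (‖z - x j‖ ^ 2)⁻¹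
          ≤ B * (|C j| * ‖z - x j‖) * (‖z - x j‖ ^ 2)⁻¹ := by
            gcongr; exact h2.trans (by gcongr; exact le_abs_self _)
        _ = _ := by field_simp
  have hdom : Integrable (fun z => M * ∑ j, B * |C j| * ‖z - x j‖⁻¹) (volume.restrict Ω) :=
    (integrable_finsetSum _ fun j _ =>
      (integrableOn_inv_norm_sub hΩb (x j)).const_mul _).const_mul _
  have hlim2 : Tendsto (fun m => ∫ z in Ω, φ z * curDot (H z) (fderiv ℝ (θ m) z)) atTop (𝓝 0) := by
    have : (0 : ℝ) = ∫ z in Ω, (0 : ℝ) := by simp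
    rw [this]
    refine MeasureTheory.tendsto_integral_filter_of_dominated_convergence
      (fun z => M * ∑ j, B * |C j| * ‖z - x j‖⁻¹)
      (Eventually.of_forall fun m => hmeas _ (hφ.continuousOn.mul (hdotθ m))) ?_ ?_ ?_
    · filter_upwards [hbnd] with m hm
      filter_upwards [haeO] with z hz using hm z hz
    · exact hdom
    · filter_upwards [haeO] with z hz
      refine tendsto_const_nhds.congr' ?_
      filter_upwards [hθ1 z hz.2] with m hm
      rw [hm.2, curDot_zero, mul_zero]
  have hsum := hlim1.add hlim2
  rw [add_zero] at hsum
  refine tendsto_nhds_unique hsum (tendsto_const_nhds.congr' ?_)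
  filter_upwards [hT1, hbnd] with m hm hb
  rw [← hm, ← integral_add]
  · refine integral_congr_ae ?_
    filter_upwards [haeO] with z hz using hsplit m z hz
  · refine (hint.abs.const_mul (1 + n : ℝ)).mono'
      (hmeas _ ((hθc m).continuous.continuousOn.mul hdotc)) (ae_of_all _ fun z => ?_)
    rw [Real.norm_eq_abs, abs_mul]
    exact mul_le_mul_of_nonneg_right (hθb m z) (abs_nonneg _)
  · refine hdom.mono' (hmeas _ (hφ.continuousOn.mul (hdotθ m))) ?_
    filter_upwards [haeO] with z hz using hb z hz

/-- The same for test functions that vanish on the boundary of the domain. -/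
theorem setIntegral_curDot_fderiv_eq_zero_of_vanishing {Ω : Set ℂ} (hΩ : IsOpen Ω)
    (hΩb : Bornology.IsBounded Ω) {n : ℕ} {x : Fin n → ℂ}
    (hx : Function.Injective x) {H : ℂ → ℂ} (hH : DifferentiableOn ℂ H (Ω \ range x))
    (hres : ∀ j, ∃ C, ∀ᶠ z in 𝓝[≠] (x j), |(H z * (z - x j)).re| ≤ C * ‖z - x j‖)
    {ψ : ℂ → ℝ} (hψ : ContDiffOn ℝ 1 ψ (Ω \ range x)) {M : ℝ} (hM : ∀ z, |ψ z| ≤ M)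
    (h0 : ∀ ε > 0, ∃ K, IsCompact K ∧ K ⊆ Ω ∧ ∀ z ∈ Ω, z ∉ K → |ψ z| ≤ ε)
    (hint : IntegrableOn (fun z => curDot (H z) (fderiv ℝ ψ z)) Ω) :
    ∫ z in Ω, curDot (H z) (fderiv ℝ ψ z) = 0 := by
  set O := Ω \ range x with hO_def
  have hO : IsOpen O := hΩ.sdiff (finite_range x).isClosed
  have hnull : ∀ᵐ z : ℂ, z ∉ range x := by
    have : volume (range x) = 0 := (finite_range x).measure_zero _
    exact measure_eq_zero_iff_ae_notMem.1 this
  have haeO : ∀ᵐ z ∂(volume.restrict Ω), z ∈ O := by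
    filter_upwards [ae_restrict_mem hΩ.measurableSet, ae_restrict_of_ae hnull] with z h1 h2
    exact ⟨h1, h2⟩
  obtain ⟨B, hB, hBb⟩ := exists_truncDeriv_le
  have hdiff : ∀ z ∈ O, DifferentiableAt ℝ ψ z := fun z hz =>
    (hψ.contDiffAt (hO.mem_nhds hz)).differentiableAt (by norm_num)
  have hψae : AEStronglyMeasurable ψ (volume.restrict Ω) := by
    have h1 := hψ.continuousOn.aestronglyMeasurable (μ := volume) hO.measurableSet
    have h2 : volume.restrict O = volume.restrict Ω := by
      refine Measure.restrict_congr_set ?_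
      filter_upwards [hnull] with z hz
      exact propext ⟨fun h => h.1, fun h => ⟨h, hz⟩⟩
    rwa [h2] at h1
  have hmeasε : ∀ ε : ℝ, AEStronglyMeasurable
      (fun z => truncDeriv (ψ z / ε) * curDot (H z) (fderiv ℝ ψ z)) (volume.restrict Ω) := by
    intro ε
    refine AEStronglyMeasurable.mul ?_ hint.1
    exact (continuous_truncDeriv.comp (continuous_id.div_const ε)).comp_aestronglyMeasurable hψae
  have hbdε : ∀ (ε : ℝ) (z : ℂ), ‖truncDeriv (ψ z / ε) * curDot (H z) (fderiv ℝ ψ z)‖ ≤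
      B * |curDot (H z) (fderiv ℝ ψ z)| := by
    intro ε z
    rw [Real.norm_eq_abs, abs_mul, abs_of_nonneg (truncDeriv_nonneg _)]
    exact mul_le_mul_of_nonneg_right (hBb _) (abs_nonneg _)
  have hε0 : ∀ ε > 0, ∫ z in Ω, truncDeriv (ψ z / ε) * curDot (H z) (fderiv ℝ ψ z) = 0 := by
    intro ε hε
    obtain ⟨K, hK, hKΩ, hKψ⟩ := h0 ε hε
    -- Truncating at height `ε` gives compact support in `Ω`, since `|ψ| ≤ ε` off `K`.
    set φ : ℂ → ℝ := Ω.indicator fun w => ε * trunc (ψ w / ε) with hφ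
    have hev : ∀ z ∈ Ω, φ =ᶠ[𝓝 z] fun w => ε * trunc (ψ w / ε) := fun z hz => by
      filter_upwards [hΩ.mem_nhds hz] with w hw
      simp [hφ, indicator_of_mem hw]
    have hφd : ∀ z ∈ O, curDot (H z) (fderiv ℝ φ z)
        = truncDeriv (ψ z / ε) * curDot (H z) (fderiv ℝ ψ z) := by
      intro z hz
      rw [(hev z hz.1).fderiv_eq, (hasFDerivAt_trunc_comp (hdiff z hz) ε hε.ne').fderiv,
        curDot_smul]
    have hcongr : (fun z => curDot (H z) (fderiv ℝ φ z)) =ᵐ[volume.restrict Ω]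
        fun z => truncDeriv (ψ z / ε) * curDot (H z) (fderiv ℝ ψ z) := by
      filter_upwards [haeO] with z hz using hφd z hz
    rw [← integral_congr_ae hcongr]
    refine setIntegral_curDot_fderiv_eq_zero hΩ hΩb hK hKΩ hx hH hres (M := M) ?_ ?_ ?_ ?_
    · have : ContDiffOn ℝ 1 (fun w => ε * trunc (ψ w / ε)) O :=
        contDiffOn_const.mul (contDiff_trunc.comp_contDiffOn (hψ.div_const ε))
      exact this.congr fun z hz => by simp [hφ, indicator_of_mem hz.1]
    · intro z
      by_cases hz : z ∈ Ω
      · simp only [hφ, indicator_of_mem hz]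
        rw [abs_mul, abs_of_pos hε]
        calc ε * |trunc (ψ z / ε)| ≤ ε * |ψ z / ε| :=
              mul_le_mul_of_nonneg_left (abs_trunc_le _) hε.le
          _ = |ψ z| := by rw [abs_div, abs_of_pos hε]; field_simp
          _ ≤ M := hM z
      · simp only [hφ, indicator_of_notMem hz, abs_zero]
        exact (abs_nonneg _).trans (hM z)
    · intro z hz
      by_cases hzΩ : z ∈ Ω
      · simp only [hφ, indicator_of_mem hzΩ]
        rw [trunc_eq_zero, mul_zero]
        rw [abs_div, abs_of_pos hε, div_le_one hε]
        exact hKψ z hzΩ hz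
      · simp only [hφ, indicator_of_notMem hzΩ]
    · exact ((hint.abs.const_mul B).mono' (hmeasε ε) (ae_of_all _ (hbdε ε))).congr hcongr.symm
  have hlim : Tendsto (fun m : ℕ => ∫ z in Ω, truncDeriv (ψ z / (1 / ((m : ℝ) + 1))) *
      curDot (H z) (fderiv ℝ ψ z)) atTop (𝓝 (∫ z in Ω, curDot (H z) (fderiv ℝ ψ z))) := by
    refine MeasureTheory.tendsto_integral_of_dominated_convergence
      (fun z => B * |curDot (H z) (fderiv ℝ ψ z)|) (fun m => hmeasε _) (hint.abs.const_mul _)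
      (fun m => ae_of_all _ (hbdε _)) ?_
    filter_upwards [haeO, ae_restrict_of_ae (ae_fderiv_eq_zero_of_eq_zero hO
      (hψ.differentiableOn (by norm_num)))] with z hz hz0
    -- As `ε → 0` the factor `truncDeriv (ψ z / ε)` tends to `1` only where `ψ ≠ 0`; on the zero set
    -- the gradient itself vanishes almost everywhere.
    by_cases hψz : ψ z = 0
    · simp [hz0 hz hψz, curDot_zero]
    · refine tendsto_const_nhds.congr' ?_
      have ht : Tendsto (fun m : ℕ => (ψ z / (1 / ((m : ℝ) + 1))) ^ 2) atTop atTop := by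
        have h1 : Tendsto (fun m : ℕ => (m : ℝ) + 1) atTop atTop :=
          tendsto_atTop_add_const_right _ _ tendsto_natCast_atTop_atTop
        have h2 : Tendsto (fun m : ℕ => ((m : ℝ) + 1) ^ 2) atTop atTop :=
          (tendsto_pow_atTop (by norm_num)).comp h1
        have h3 := h2.const_mul_atTop (by positivity : 0 < (ψ z) ^ 2)
        refine h3.congr fun m => ?_
        rw [div_pow, one_div, inv_pow, div_inv_eq_mul]
      filter_upwards [ht.eventually_gt_atTop 2] with m hm
      rw [truncDeriv_eq_one hm, one_mul]
  refine tendsto_nhds_unique hlim (tendsto_const_nhds.congr fun m => ?_)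
  exact (hε0 _ (by positivity)).symm
-- Finite energy near the boundary.
theorem exists_cutoff {K U : Set ℂ} (hK : IsCompact K) (hU : IsOpen U) (hKU : K ⊆ U) :
    ∃ κ : ℂ → ℝ, ∃ V L : Set ℂ, ContDiff ℝ 1 κ ∧ IsOpen V ∧ K ⊆ V ∧ (∀ z ∈ V, κ z = 1) ∧
      IsCompact L ∧ L ⊆ U ∧ (∀ z ∉ L, κ z = 0) ∧ ∀ z, κ z ∈ Icc (0 : ℝ) 1 := by
  obtain ⟨L, hL, hKL, hLU⟩ := exists_compact_between hK hU hKU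
  obtain ⟨f, hf1, hf0, hf⟩ := exists_contMDiffMap_one_nhds_of_subset_interior
    (modelWithCornersSelf ℝ ℂ) (n := 1) hK.isClosed hKL
  obtain ⟨V, hV, hKV, hVf⟩ := eventually_nhdsSet_iff_exists.1 hf1
  exact ⟨f, V, L, contMDiff_iff_contDiff.1 f.contMDiff, hV, hKV, hVf, hL, hLU, hf0, hf⟩

/-- The points of `closure Ω` outside a neighbourhood of the frontier form a compact subset of `Ω`.
This turns a boundary condition stated point by point into one that holds off a compact set. -/
theorem exists_compact_of_eventually_nhdsWithin_frontier {Ω : Set ℂ} (hΩ : IsOpen Ω)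
    (hΩb : Bornology.IsBounded Ω) {P : ℂ → Prop} (h : ∀ y ∈ frontier Ω, ∀ᶠ z in 𝓝[Ω] y, P z) :
    ∃ K, IsCompact K ∧ K ⊆ Ω ∧ ∀ z ∈ Ω, z ∉ K → P z := by
  have h1 : ∀ᶠ z in 𝓝ˢ (frontier Ω), z ∈ Ω → P z :=
    eventually_nhdsSet_iff_forall.2 fun y hy => eventually_nhdsWithin_iff.1 (h y hy)
  obtain ⟨V, hV, hfV, hVP⟩ := eventually_nhdsSet_iff_exists.1 h1
  refine ⟨closure Ω \ V, hΩb.isCompact_closure.diff hV, ?_, ?_⟩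
  · rintro z ⟨hz, hzV⟩
    by_contra h
    exact hzV (hfV ⟨hz, by rwa [hΩ.interior_eq]⟩)
  · intro z hz hzK
    exact hVP z (by_contra fun h => hzK ⟨subset_closure hz, h⟩) hz

theorem contDiffOn_one_of_continuousOn_fderiv {E F : Type*} [NormedAddCommGroup E]
    [NormedSpace ℝ E] [NormedAddCommGroup F] [NormedSpace ℝ F] {f : E → F} {s : Set E}
    (hs : IsOpen s) (hd : DifferentiableOn ℝ f s) (hc : ContinuousOn (fderiv ℝ f) s) :
    ContDiffOn ℝ 1 f s := by
  have := (contDiffOn_succ_iff_fderiv_of_isOpen (𝕜 := ℝ) (f := f) (n := 0) hs).2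
    ⟨hd, by simp, contDiffOn_zero.2 hc⟩
  simpa using this

theorem IsCurrent.contDiffOn {O : Set ℂ} {u H : ℂ → ℂ} (h : IsCurrent O u H) (hO : IsOpen O) :
    ContDiffOn ℝ 1 u O := by
  refine contDiffOn_one_of_continuousOn_fderiv hO
    (fun z hz => (h.hasFDerivAt z hz).differentiableAt.differentiableWithinAt) ?_
  have h1 : ContinuousOn (fun z => curForm (H z)) O :=
    continuous_curForm.comp_continuousOn h.differentiableOn.continuousOn
  have h2 : ContinuousOn (fun z => Complex.I * u z) O := continuousOn_const.mul h.continuousOn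
  have h3 : ContinuousOn (fun z => (Complex.I * u z) • Complex.ofRealCLM.comp (curForm (H z))) O :=
    h2.smul (continuousOn_const.clm_comp h1)
  refine h3.congr fun z hz => ?_
  rw [(h.hasFDerivAt z hz).fderiv]
  ext ξ
  simp [mul_comm]

/-- A circle-valued harmonic map that attains a `C¹` boundary datum has finite energy near the
boundary. -/
theorem IsCurrent.exists_compact_integrableOn {Ω K0 : Set ℂ} (hΩ : IsOpen Ω)
    (hΩb : Bornology.IsBounded Ω) (hK0 : IsCompact K0) {u H : ℂ → ℂ}
    (hu : IsCurrent (Ω \ K0) u H) {G : ℂ → ℂ} (hG : ContDiff ℝ 1 G)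
    (hGu : ∀ y ∈ frontier Ω, Tendsto u (𝓝[Ω] y) (𝓝 (G y)))
    (hG1 : ∀ y ∈ frontier Ω, ‖G y‖ = 1) (hK0Ω : K0 ⊆ Ω) :
    ∃ K, IsCompact K ∧ K ⊆ Ω ∧ IntegrableOn (fun z => ‖H z‖ ^ 2) (Ω \ K) := by
  set cj : ℂ →L[ℝ] ℂ := Complex.conjCLE.toContinuousLinearMap with hcj
  have hcjn : ∀ w, ‖cj w‖ = ‖w‖ := fun w => by simp [hcj]
  have hlim : ∀ y ∈ frontier Ω, Tendsto (fun z => cj (G z) * u z) (𝓝[Ω] y) (𝓝 1) := by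
    intro y hy
    have h1 := ((cj.continuous.comp hG.continuous).continuousAt.tendsto.mono_left
      (nhdsWithin_le_nhds (a := y) (s := Ω))).mul (hGu y hy)
    have h2 : cj (G y) * G y = 1 := by
      have : cj (G y) = (starRingEnd ℂ) (G y) := by simp [hcj]
      rw [this, ← Complex.normSq_eq_conj_mul_self, Complex.normSq_eq_norm_sq, hG1 y hy]; simp
    simpa only [Function.comp_apply, h2] using h1
  -- Where `|G| = 1`, these are the cosine and the sine of the phase difference between `u` and `G`.
  -- At the boundary `c` tends to `1` and `s` to `0`; `s` is the test function.
  set c : ℂ → ℝ := fun z => (cj (G z) * u z).re with hc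
  set s : ℂ → ℝ := fun z => (cj (G z) * u z).im with hs
  obtain ⟨K1, hK1, hK1Ω, hK1P⟩ := exists_compact_of_eventually_nhdsWithin_frontier hΩ hΩb
    (P := fun z => z ∉ K0 ∧ 1 / 2 < c z) (fun y hy => by
      refine Eventually.and ?_ ?_
      · have : y ∉ K0 := fun h => by
          have := hK0Ω h
          rw [hΩ.frontier_eq] at hy
          exact hy.2 this
        exact mem_nhdsWithin_of_mem_nhds (hK0.isClosed.isOpen_compl.mem_nhds this)
      · have h1 := (Complex.continuous_re.tendsto _).comp (hlim y hy)
        exact h1.eventually (lt_mem_nhds (by norm_num)))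
  have hsmall : ∀ ε > 0, ∃ K, IsCompact K ∧ K ⊆ Ω ∧ ∀ z ∈ Ω, z ∉ K → |s z| ≤ ε := by
    intro ε hε
    refine exists_compact_of_eventually_nhdsWithin_frontier hΩ hΩb fun y hy => ?_
    have h1 : Tendsto s (𝓝[Ω] y) (𝓝 (1 : ℂ).im) :=
      (Complex.continuous_im.tendsto 1).comp (hlim y hy)
    have h2 := h1.abs
    rw [Complex.one_im, abs_zero] at h2
    exact (h2.eventually (gt_mem_nhds hε)).mono fun z hz => le_of_lt hz
  obtain ⟨κ, V, L, hκ, hV, hK1V, hκV, hL, hLΩ, hκL, hκ01⟩ := exists_cutoff hK1 hΩ hK1Ω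
  set O := Ω \ K1 with hO_def
  have hO : IsOpen O := hΩ.sdiff hK1.isClosed
  have huO : IsCurrent O u H := hu.mono fun z hz => ⟨hz.1, (hK1P z hz.1 hz.2).1⟩
  have hcO : ∀ z ∈ O, 1 / 2 < c z := fun z hz => (hK1P z hz.1 hz.2).2
  set χ : ℂ → ℝ := fun z => 1 - κ z with hχ
  have hχc : ContDiff ℝ 1 χ := contDiff_const.sub hκ
  have hχ0 : ∀ z, 0 ≤ χ z := fun z => by have := (hκ01 z).2; simp only [hχ]; linarith
  have hχ1 : ∀ z, χ z ≤ 1 := fun z => by have := (hκ01 z).1; simp only [hχ]; linarith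
  have hχV : ∀ z ∈ V, χ z = 0 := fun z hz => by simp [hχ, hκV z hz]
  -- bounds for the extension of the boundary datum
  obtain ⟨S, hS⟩ := hΩb.isCompact_closure.exists_bound_of_continuousOn hG.continuous.continuousOn
  obtain ⟨C, hC⟩ := hΩb.isCompact_closure.exists_bound_of_continuousOn
    (hG.continuous_fderiv (by norm_num)).continuousOn
  have hsS : ∀ z ∈ O, |s z| ≤ S := fun z hz => by
    refine (Complex.abs_im_le_norm _).trans ?_
    rw [norm_mul, hcjn, huO.norm_eq_one z hz, mul_one]
    exact hS z (subset_closure hz.1)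
  -- the differential of `s`
  set Λ : ℂ → ℂ →L[ℝ] ℝ := fun z =>
    Complex.imCLM.comp (u z • cj.comp (fderiv ℝ G z)) with hΛ
  have hsd : ∀ z ∈ O, HasFDerivAt s (Λ z + c z • curForm (H z)) z := by
    intro z hz
    have h1 := (cj.hasFDerivAt.comp z ((hG.differentiable (by norm_num)) z).hasFDerivAt).mul
      (huO.hasFDerivAt z hz)
    have h2 : HasFDerivAt s _ z := Complex.imCLM.hasFDerivAt.comp z h1
    refine h2.congr_fderiv ?_
    ext ξ
    simp [hΛ, hc]
    ring
  have hΛn : ∀ z ∈ O, ‖Λ z‖ ≤ C := by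
    intro z hz
    refine ContinuousLinearMap.opNorm_le_bound _
      ((norm_nonneg _).trans (hC z (subset_closure hz.1))) fun ξ => ?_
    have h1 : ‖Λ z ξ‖ ≤ ‖u z * cj (fderiv ℝ G z ξ)‖ := Complex.abs_im_le_norm _
    rw [norm_mul, hcjn, huO.norm_eq_one z hz, one_mul] at h1
    exact h1.trans (((fderiv ℝ G z).le_opNorm ξ).trans
      (mul_le_mul_of_nonneg_right (hC z (subset_closure hz.1)) (norm_nonneg _)))
  -- Since `c > 1/2`, the pairing is at least `‖H‖² / 2 - 2 C ‖H‖`. Four times this plus `16 C²`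
  -- equals `‖H‖²` plus the square of `‖H‖ - 4 C`.
  have hlow : ∀ z ∈ O, ‖H z‖ ^ 2 ≤ 4 * curDot (H z) (fderiv ℝ s z) + 16 * C ^ 2 := by
    intro z hz
    rw [(hsd z hz).fderiv, curDot_add, curDot_smul, curDot_curForm_self]
    have h1 := abs_curDot_le (H z) (Λ z)
    have h2 := neg_abs_le (curDot (H z) (Λ z))
    have h3 : 2 * ‖H z‖ * ‖Λ z‖ ≤ 2 * ‖H z‖ * C := by gcongr; exact hΛn z hz
    have h4 := hcO z hz
    nlinarith [sq_nonneg (‖H z‖ - 4 * C), sq_nonneg ‖H z‖]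
  have hsC1 : ContDiffOn ℝ 1 s O := by
    have huC := huO.contDiffOn hO
    exact Complex.imCLM.contDiff.comp_contDiffOn
      (((cj.contDiff.comp hG).contDiffOn).mul huC)
  obtain ⟨B, hB, hBb⟩ := exists_truncDeriv_le
  -- the contribution of the cut-off
  set g : ℂ → ℝ := fun z => curDot (H z) (fderiv ℝ χ z) with hg
  have hHc : ContinuousOn H O := huO.differentiableOn.continuousOn
  have hgc : ContinuousOn g O := continuous_curDot.comp_continuousOn
    (hHc.prodMk (hχc.continuous_fderiv (by norm_num)).continuousOn)
  have hLV : IsCompact (L \ V) := hL.diff hV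
  have hLVO : L \ V ⊆ O := fun z hz => ⟨hLΩ hz.1, fun h => hz.2 (hK1V h)⟩
  have hgi : IntegrableOn g O := by
    -- The gradient of the cut-off is supported in `L \ V`, a compact subset of `O` on which `H` is
    -- continuous.
    refine IntegrableOn.of_forall_sdiff_eq_zero ((hgc.mono hLVO).integrableOn_compact hLV)
      hO.measurableSet fun z hz => ?_
    have : χ =ᶠ[𝓝 z] fun _ => χ z := by
      by_cases hzV : z ∈ V
      · filter_upwards [hV.mem_nhds hzV] with w hw
        rw [hχV w hw, hχV z hzV]
      · have hzL : z ∉ L := fun h => hz.2 ⟨h, hzV⟩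
        filter_upwards [hL.isClosed.isOpen_compl.mem_nhds hzL] with w hw
        simp [hχ, hκL w hw, hκL z hzL]
    simp [hg, this.fderiv_eq, curDot_zero]
  have hOfin : volume O ≠ ⊤ := ((hΩb.subset sdiff_subset).measure_lt_top).ne
  -- the truncated energies
  set F : ℝ → ℂ → ℝ := fun ε z => χ z * truncDeriv (s z / ε) * ‖H z‖ ^ 2 with hF
  set A : ℝ := ∫ z in O, (4 * S * |g z| + 16 * C ^ 2 * B) with hA
  have hAi : IntegrableOn (fun z => 4 * S * |g z| + 16 * C ^ 2 * B) O :=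
    (hgi.abs.const_mul _).add (integrableOn_const hOfin)
  have hF0 : ∀ ε z, 0 ≤ F ε z := fun ε z =>
    mul_nonneg (mul_nonneg (hχ0 z) (truncDeriv_nonneg _)) (sq_nonneg _)
  -- The truncated `s`, times `χ`, is an admissible test function. Its vanishing pairing with the
  -- current bounds the truncated energy by `A`, which does not depend on `ε`; hence Fatou applies
  -- below.
  have hFint : ∀ ε > 0, ∫⁻ z in O, ENNReal.ofReal (F ε z) ≤ ENNReal.ofReal A := by
    intro ε hε
    obtain ⟨K, hK, hKΩ, hKs⟩ := hsmall ε hε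
    have hKV : IsCompact (K \ V) := hK.diff hV
    have hKVO : K \ V ⊆ O := fun z hz => ⟨hKΩ hz.1, fun h => hz.2 (hK1V h)⟩
    set φ : ℂ → ℝ := Ω.indicator fun w => χ w * (ε * trunc (s w / ε)) with hφ
    have hφ0 : ∀ z ∉ K \ V, φ z = 0 := by
      intro z hz
      by_cases hzΩ : z ∈ Ω
      · simp only [hφ, indicator_of_mem hzΩ]
        by_cases hzV : z ∈ V
        · rw [hχV z hzV, zero_mul]
        · rw [trunc_eq_zero, mul_zero, mul_zero]
          rw [abs_div, abs_of_pos hε, div_le_one hε]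
          exact hKs z hzΩ fun h => hz ⟨h, hzV⟩
      · simp only [hφ, indicator_of_notMem hzΩ]
    have hφC : ContDiffOn ℝ 1 φ O := by
      have : ContDiffOn ℝ 1 (fun w => χ w * (ε * trunc (s w / ε))) O :=
        hχc.contDiffOn.mul (contDiffOn_const.mul (contDiff_trunc.comp_contDiffOn
          (hsC1.div_const ε)))
      exact this.congr fun z hz => by simp [hφ, indicator_of_mem hz.1]
    obtain ⟨hi, h0⟩ := integral_curDot_fderiv_eq_zero hO hKV hKVO huO.differentiableOn hφC hφ0
    have h0' : ∫ z in O, curDot (H z) (fderiv ℝ φ z) = 0 := by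
      rw [← h0]
      refine setIntegral_eq_integral_of_forall_compl_eq_zero fun z hz => ?_
      have : φ =ᶠ[𝓝 z] fun _ => 0 := by
        filter_upwards [hKV.isClosed.isOpen_compl.mem_nhds fun h => hz (hKVO h)] with w hw
        exact hφ0 w hw
      rw [this.fderiv_eq]; simp [curDot_zero]
    have hφd : ∀ z ∈ O, curDot (H z) (fderiv ℝ φ z) =
        χ z * (truncDeriv (s z / ε) * curDot (H z) (fderiv ℝ s z)) +
          ε * trunc (s z / ε) * g z := by
      intro z hz
      have hev : φ =ᶠ[𝓝 z] fun w => χ w * (ε * trunc (s w / ε)) := by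
        filter_upwards [hΩ.mem_nhds hz.1] with w hw
        simp [hφ, indicator_of_mem hw]
      have h1 := hasFDerivAt_trunc_comp (hsd z hz).differentiableAt ε hε.ne'
      rw [hev.fderiv_eq, ((hχc.differentiable (by norm_num) z).hasFDerivAt.fun_mul h1).fderiv,
        curDot_add, curDot_smul, curDot_smul, curDot_smul]
    have hle : ∀ z ∈ O, F ε z ≤ 4 * curDot (H z) (fderiv ℝ φ z) +
        (4 * S * |g z| + 16 * C ^ 2 * B) := by
      intro z hz
      rw [hφd z hz]
      have e1 : 0 ≤ χ z * truncDeriv (s z / ε) := mul_nonneg (hχ0 z) (truncDeriv_nonneg _)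
      have e2 : χ z * truncDeriv (s z / ε) ≤ B :=
        (mul_le_of_le_one_left (truncDeriv_nonneg _) (hχ1 z)).trans (hBb _)
      have e3 := mul_le_mul_of_nonneg_left (hlow z hz) e1
      have e4 : |ε * trunc (s z / ε) * g z| ≤ S * |g z| := by
        rw [abs_mul]
        refine mul_le_mul_of_nonneg_right ?_ (abs_nonneg _)
        rw [abs_mul, abs_of_pos hε]
        refine (mul_le_mul_of_nonneg_left (abs_trunc_le _) hε.le).trans ?_
        rw [abs_div, abs_of_pos hε, mul_div_cancel₀ _ hε.ne']
        exact hsS z hz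
      have e5 := neg_abs_le (ε * trunc (s z / ε) * g z)
      have e6 : χ z * truncDeriv (s z / ε) * (16 * C ^ 2) ≤ B * (16 * C ^ 2) :=
        mul_le_mul_of_nonneg_right e2 (by positivity)
      simp only [hF]
      nlinarith
    calc ∫⁻ z in O, ENNReal.ofReal (F ε z)
        ≤ ∫⁻ z in O, ENNReal.ofReal (4 * curDot (H z) (fderiv ℝ φ z) +
          (4 * S * |g z| + 16 * C ^ 2 * B)) := by
          refine setLIntegral_mono_ae' hO.measurableSet (ae_of_all _ fun z hz => ?_)
          exact ENNReal.ofReal_le_ofReal (hle z hz)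
      _ = ENNReal.ofReal (∫ z in O, (4 * curDot (H z) (fderiv ℝ φ z) +
          (4 * S * |g z| + 16 * C ^ 2 * B))) := by
          refine (ofReal_integral_eq_lintegral_ofReal
            ((hi.integrableOn.const_mul 4).add hAi) ?_).symm
          filter_upwards [ae_restrict_mem hO.measurableSet] with z hz
          exact (hF0 ε z).trans (hle z hz)
      _ = ENNReal.ofReal A := by
          rw [integral_add (hi.integrableOn.const_mul 4) hAi, integral_const_mul, h0', mul_zero,
            zero_add]
  have hFc : ∀ ε, ContinuousOn (F ε) O := fun ε =>
    (hχc.continuous.continuousOn.mul (continuous_truncDeriv.comp_continuousOn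
      (hsC1.continuousOn.div_const ε))).mul (hHc.norm.pow 2)
  have hFatou := lintegral_liminf_le' (μ := volume.restrict O) (u := atTop)
    (f := fun (m : ℕ) z => ENNReal.ofReal (F (1 / ((m : ℝ) + 1)) z)) (fun m =>
      ((hFc _).aestronglyMeasurable hO.measurableSet).aemeasurable.ennreal_ofReal)
  have hbound : ∫⁻ z in O, ENNReal.ofReal (χ z * ‖H z‖ ^ 2) ≤
      ENNReal.ofReal A + ENNReal.ofReal (16 * C ^ 2) * volume O := by
    have h1 : ∀ᵐ z ∂(volume.restrict O), ENNReal.ofReal (χ z * ‖H z‖ ^ 2) ≤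
        liminf (fun m : ℕ => ENNReal.ofReal (F (1 / ((m : ℝ) + 1)) z)) atTop +
          ENNReal.ofReal (16 * C ^ 2) := by
      filter_upwards [ae_restrict_mem hO.measurableSet, ae_restrict_of_ae
        (ae_fderiv_eq_zero_of_eq_zero hO (hsC1.differentiableOn (by norm_num)))] with z hz hz0
      -- Fatou says nothing on `{s = 0}`, but there `ds = 0` almost everywhere and `hlow` gives the
      -- pointwise bound `16 C²`.
      by_cases hsz : s z = 0
      · have h2 := hlow z hz
        rw [hz0 hz hsz, curDot_zero, mul_zero, zero_add] at h2
        refine le_trans (ENNReal.ofReal_le_ofReal ?_) le_add_self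
        exact (mul_le_of_le_one_left (sq_nonneg _) (hχ1 z)).trans h2
      · have ht : Tendsto (fun m : ℕ => ENNReal.ofReal (F (1 / ((m : ℝ) + 1)) z)) atTop
            (𝓝 (ENNReal.ofReal (χ z * ‖H z‖ ^ 2))) := by
          refine tendsto_const_nhds.congr' ?_
          have ht : Tendsto (fun m : ℕ => (s z / (1 / ((m : ℝ) + 1))) ^ 2) atTop atTop := by
            have h1 : Tendsto (fun m : ℕ => (m : ℝ) + 1) atTop atTop :=
              tendsto_atTop_add_const_right _ _ tendsto_natCast_atTop_atTop
            have h2 : Tendsto (fun m : ℕ => ((m : ℝ) + 1) ^ 2) atTop atTop :=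
              (tendsto_pow_atTop (by norm_num)).comp h1
            have h3 := h2.const_mul_atTop (sq_pos_iff.2 hsz : 0 < (s z) ^ 2)
            refine h3.congr fun m => ?_
            rw [div_pow, one_div, inv_pow, div_inv_eq_mul]
          filter_upwards [ht.eventually_gt_atTop 2] with m hm
          simp only [hF]
          rw [truncDeriv_eq_one hm, mul_one]
        rw [ht.liminf_eq]
        exact le_self_add
    calc _ ≤ ∫⁻ z in O, (liminf (fun m : ℕ => ENNReal.ofReal (F (1 / ((m : ℝ) + 1)) z)) atTop +
          ENNReal.ofReal (16 * C ^ 2)) := lintegral_mono_ae h1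
      _ = (∫⁻ z in O, liminf (fun m : ℕ => ENNReal.ofReal (F (1 / ((m : ℝ) + 1)) z)) atTop) +
          ENNReal.ofReal (16 * C ^ 2) * volume O := by
          rw [lintegral_add_right _ measurable_const, setLIntegral_const]
      _ ≤ _ := by
          gcongr
          refine hFatou.trans ?_
          refine (liminf_le_liminf (Eventually.of_forall fun m : ℕ =>
            hFint (1 / ((m : ℝ) + 1)) Nat.one_div_pos_of_nat)).trans ?_
          rw [liminf_const]
  have hint : IntegrableOn (fun z => χ z * ‖H z‖ ^ 2) O := by
    refine ⟨(hχc.continuous.continuousOn.mul (hHc.norm.pow 2)).aestronglyMeasurable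
      hO.measurableSet, ?_⟩
    rw [hasFiniteIntegral_iff_ofReal (ae_of_all _ fun z => mul_nonneg (hχ0 z) (sq_nonneg _))]
    refine hbound.trans_lt ?_
    exact ENNReal.add_lt_top.2 ⟨ENNReal.ofReal_lt_top,
      ENNReal.mul_lt_top ENNReal.ofReal_lt_top hOfin.lt_top⟩
  refine ⟨L ∪ K1, hL.union hK1, union_subset hLΩ hK1Ω, ?_⟩
  refine (hint.mono_set fun z hz => ⟨hz.1, fun h => hz.2 (Or.inr h)⟩).congr_fun (fun z hz => ?_)
    (hΩ.measurableSet.diff (hL.union hK1).measurableSet)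
  have : z ∉ L := fun h => hz.2 (Or.inl h)
  simp [hχ, hκL z this]

/-! ### Existence of the renormalised energy. -/

/-- The current of the product of the vortices `(x, d)`. -/
noncomputable def vortexCur {n : ℕ} (d : Fin n → ℤ) (x : Fin n → ℂ) (z : ℂ) : ℂ :=
  ∑ j, (d j : ℂ) * (-Complex.I / (z - x j))

/-- The current of a singular harmonic map with the singular part at `x j` removed. -/
noncomputable def regPart {n : ℕ} (d : Fin n → ℤ) (x : Fin n → ℂ) (f : ℂ → ℂ) (j : Fin n)
    (z : ℂ) : ℂ :=
  f z + ∑ k ∈ Finset.univ.erase j, (d k : ℂ) * (-Complex.I / (z - x k))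

section

variable {n : ℕ} {d : Fin n → ℤ} {x : Fin n → ℂ} {Ω : Set ℂ} {u f : ℂ → ℂ}

theorem add_vortexCur_eq (d : Fin n → ℤ) (x : Fin n → ℂ) (f : ℂ → ℂ) (j : Fin n) (z : ℂ) :
    f z + vortexCur d x z = (d j : ℂ) * (-Complex.I / (z - x j)) + regPart d x f j z := by
  rw [vortexCur, regPart, ← Finset.add_sum_erase _ _ (Finset.mem_univ j)]
  ring

theorem differentiableAt_vortexTerm (c a : ℂ) {z : ℂ} (h : z ≠ a) :
    DifferentiableAt ℂ (fun z => c * (-Complex.I / (z - a))) z :=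
  ((differentiableAt_const (-Complex.I)).fun_div (differentiableAt_id.sub_const a)
    (sub_ne_zero.2 h)).const_mul c

theorem differentiableAt_regPart {j : Fin n} {z : ℂ} (hf : DifferentiableAt ℂ f z)
    (hz : ∀ k, k ≠ j → z ≠ x k) : DifferentiableAt ℂ (regPart d x f j) z := by
  refine hf.fun_add (DifferentiableAt.fun_sum fun k hk => ?_)
  exact differentiableAt_vortexTerm _ _ (hz k (Finset.ne_of_mem_erase hk))

theorem isOpen_diff_range (hΩ : IsOpen Ω) : IsOpen (Ω \ range x) :=
  hΩ.sdiff (finite_range x).isClosed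

theorem ae_mem_diff_range (hΩ : MeasurableSet Ω) (x : Fin n → ℂ) :
    ∀ᵐ z ∂(volume.restrict Ω), z ∈ Ω \ range x := by
  have hnull : ∀ᵐ z : ℂ, z ∉ range x :=
    measure_eq_zero_iff_ae_notMem.1 ((finite_range x).measure_zero _)
  filter_upwards [ae_restrict_mem hΩ, ae_restrict_of_ae hnull] with z h1 h2
  exact ⟨h1, h2⟩

theorem IsSingularHarmonicMap.exists_isCurrent (hΩ : IsOpen Ω)
    (h : IsSingularHarmonicMap Ω x d u) :
    ∃ f, DifferentiableOn ℂ f Ω ∧ IsCurrent (Ω \ range x) u (fun z => f z + vortexCur d x z) := by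
  obtain ⟨v, hv, hu⟩ := h
  obtain ⟨f, hf⟩ := hv.exists_isCurrent hΩ
  refine ⟨f, hf.differentiableOn, ?_⟩
  have h1 : IsCurrent (Ω \ range x)
      (fun z => ∏ j, ((z - x j) / ((‖z - x j‖ : ℝ) : ℂ)) ^ d j)
      (fun z => ∑ j, (d j : ℂ) * (-Complex.I / (z - x j))) := by
    refine IsCurrent.prod fun j => ?_
    refine ((isCurrent_vortex (x j)).zpow (d j)).mono fun z hz hzj => hz.2 ⟨j, ?_⟩
    exact (mem_singleton_iff.1 hzj).symm
  refine (h1.mul (hf.mono sdiff_subset)).congr (isOpen_diff_range hΩ) (fun z hz => ?_)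
    (fun z _ => ?_)
  · exact hu z hz.1 fun j hj => hz.2 ⟨j, hj.symm⟩
  · rw [vortexCur, add_comm]

theorem injective_of_mem_configSpace (hx : x ∈ configSpace Ω n) : Function.Injective x :=
  fun j k h => by_contra fun hjk => hx.2 j k hjk h

theorem measurableSet_perforated (hΩ : MeasurableSet Ω) (x : Fin n → ℂ) (ρ : ℝ) :
    MeasurableSet (perforated Ω x ρ) :=
  hΩ.diff (MeasurableSet.iUnion fun _ => measurableSet_ball)

theorem perforated_subset (Ω : Set ℂ) (x : Fin n → ℂ) (ρ : ℝ) : perforated Ω x ρ ⊆ Ω :=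
  sdiff_subset

theorem perforated_subset_diff_range (Ω : Set ℂ) (x : Fin n → ℂ) {ρ : ℝ} (hρ : 0 < ρ) :
    perforated Ω x ρ ⊆ Ω \ range x := by
  rintro z ⟨hz, hz'⟩
  refine ⟨hz, ?_⟩
  rintro ⟨j, rfl⟩
  exact hz' (mem_iUnion.2 ⟨j, Metric.mem_ball_self hρ⟩)

theorem tendsto_setIntegral_perforated (hΩ : MeasurableSet Ω) (x : Fin n → ℂ) {F : ℂ → ℝ}
    (hF : IntegrableOn F Ω) :
    Tendsto (fun ρ => ∫ z in perforated Ω x ρ, F z) (𝓝[>] 0) (𝓝 (∫ z in Ω, F z)) := by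
  have h1 : ∀ ρ, ∫ z in perforated Ω x ρ, F z = ∫ z in Ω, (perforated Ω x ρ).indicator F z := by
    intro ρ
    rw [setIntegral_indicator (measurableSet_perforated hΩ x ρ),
      inter_eq_right.2 (perforated_subset Ω x ρ)]
  simp only [h1]
  refine tendsto_integral_filter_of_dominated_convergence (fun z => ‖F z‖)
    (Eventually.of_forall fun ρ => hF.1.indicator (measurableSet_perforated hΩ x ρ))
    (Eventually.of_forall fun ρ => ae_of_all _ fun z => norm_indicator_le_norm_self _ _)
    hF.norm ?_
  filter_upwards [ae_mem_diff_range hΩ x] with z hz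
  refine tendsto_const_nhds.congr' ?_
  have h2 : ∀ᶠ ρ in 𝓝[>] (0 : ℝ), ∀ j, ρ ≤ ‖z - x j‖ := by
    refine eventually_all.2 fun j => ?_
    have hp : 0 < ‖z - x j‖ := by
      rw [norm_pos_iff, sub_ne_zero]; exact fun h => hz.2 ⟨j, h.symm⟩
    filter_upwards [Ioo_mem_nhdsGT hp] with ρ hρ using hρ.2.le
  filter_upwards [h2] with ρ hρ
  rw [indicator_of_mem]
  refine ⟨hz.1, fun h => ?_⟩
  obtain ⟨j, hj⟩ := mem_iUnion.1 h
  rw [Metric.mem_ball, dist_eq_norm] at hj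
  exact (hρ j).not_gt hj

theorem integrableOn_norm_sq_perforated {H : ℂ → ℂ}
    (hH : DifferentiableOn ℂ H (Ω \ range x)) {K : Set ℂ} (hK : IsCompact K) (hKΩ : K ⊆ Ω)
    (hfin : IntegrableOn (fun z => ‖H z‖ ^ 2) (Ω \ K)) {ρ : ℝ} (hρ : 0 < ρ) :
    IntegrableOn (fun z => ‖H z‖ ^ 2) (perforated Ω x ρ) := by
  have h1 : IsCompact (K \ ⋃ j, Metric.ball (x j) ρ) :=
    hK.diff (isOpen_iUnion fun _ => Metric.isOpen_ball)
  have h2 : K \ ⋃ j, Metric.ball (x j) ρ ⊆ Ω \ range x :=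
    (sdiff_subset_sdiff_left hKΩ).trans (perforated_subset_diff_range Ω x hρ)
  refine (hfin.union (((hH.continuousOn.norm.pow 2).mono h2).integrableOn_compact h1)).mono_set ?_
  intro z hz
  by_cases hzK : z ∈ K
  · exact Or.inr ⟨hzK, hz.2⟩
  · exact Or.inl ⟨hz.1, hzK⟩

/-- A radius of disjoint disks around the vortices, inside the domain. -/
theorem exists_radius (hΩ : IsOpen Ω) (hx : x ∈ configSpace Ω n) :
    ∃ r > 0, (∀ j, Metric.closedBall (x j) r ⊆ Ω) ∧ ∀ j k, j ≠ k → 4 * r < ‖x j - x k‖ := by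
  have h1 : ∀ j, ∀ᶠ r in 𝓝[>] (0 : ℝ), Metric.closedBall (x j) r ⊆ Ω := by
    intro j
    obtain ⟨s, hs, h⟩ := Metric.isOpen_iff.1 hΩ (x j) (hx.1 j)
    filter_upwards [Ioo_mem_nhdsGT hs] with r hr
    exact (Metric.closedBall_subset_ball hr.2).trans h
  have h2 : ∀ j k, ∀ᶠ r in 𝓝[>] (0 : ℝ), j ≠ k → 4 * r < ‖x j - x k‖ := by
    intro j k
    by_cases hjk : j = k
    · simp [hjk]
    · have hp : 0 < ‖x j - x k‖ / 4 := by
        have := norm_pos_iff.2 (sub_ne_zero.2 (hx.2 j k hjk))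
        positivity
      filter_upwards [Ioo_mem_nhdsGT hp] with r hr _
      have := hr.2
      linarith
  have h3 := (eventually_all.2 h1).and (eventually_all.2 fun j => eventually_all.2 (h2 j))
  obtain ⟨r, hr⟩ := (h3.and self_mem_nhdsWithin).exists
  exact ⟨r, hr.2, hr.1.1, hr.1.2⟩

/-- Subtracting the contribution of the vortices from the energy density gives an integrable
function. -/
theorem integrableOn_renormalised (hΩ : IsOpen Ω)
    (hf : DifferentiableOn ℂ f Ω) {r : ℝ} (hr : 0 < r)
    (hrΩ : ∀ j, Metric.closedBall (x j) r ⊆ Ω) (hrx : ∀ j k, j ≠ k → 4 * r < ‖x j - x k‖)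
    (hfin : IntegrableOn (fun z => ‖f z + vortexCur d x z‖ ^ 2) (perforated Ω x r)) :
    IntegrableOn (fun z => ‖f z + vortexCur d x z‖ ^ 2 -
      ∑ j, (d j : ℝ) ^ 2 * (Metric.ball (x j) r).indicator (fun z => (‖z - x j‖ ^ 2)⁻¹) z) Ω := by
  have hcov : Ω ⊆ perforated Ω x r ∪ ⋃ j, (Metric.ball (x j) r \ {x j} ∪ {x j}) := by
    intro z hz
    by_cases h : z ∈ ⋃ j, Metric.ball (x j) r
    · right
      obtain ⟨j, hj⟩ := mem_iUnion.1 h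
      refine mem_iUnion.2 ⟨j, ?_⟩
      by_cases hzj : z = x j
      · exact Or.inr hzj
      · exact Or.inl ⟨hj, hzj⟩
    · exact Or.inl ⟨hz, h⟩
  refine IntegrableOn.mono_set (IntegrableOn.union ?_ ?_) hcov
  · refine hfin.congr_fun (fun z hz => ?_) (measurableSet_perforated hΩ.measurableSet x r)
    have : ∀ j, z ∉ Metric.ball (x j) r := fun j hj => hz.2 (mem_iUnion.2 ⟨j, hj⟩)
    simp [indicator_of_notMem (this _)]
  · rw [integrableOn_finite_iUnion]
    intro j
    refine IntegrableOn.union ?_ (by simp [IntegrableOn, Measure.restrict_singleton])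
    have hmem : ∀ z ∈ Metric.closedBall (x j) r, ∀ k, k ≠ j → z ∉ Metric.ball (x k) r := by
      intro z hz k hk hzk
      rw [Metric.mem_closedBall, dist_eq_norm] at hz
      rw [Metric.mem_ball, dist_eq_norm] at hzk
      have h1 := hrx k j hk
      have h2 : ‖x k - x j‖ ≤ ‖z - x k‖ + ‖z - x j‖ := by
        rw [norm_sub_rev z (x k)]; exact norm_sub_le_norm_sub_add_norm_sub _ _ _
      linarith
    have hkc : ContinuousOn (regPart d x f j) (Metric.closedBall (x j) r) := by
      intro z hz
      refine (differentiableAt_regPart (hf.differentiableAt (hΩ.mem_nhds (hrΩ j hz)))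
        fun k hk h => ?_).continuousAt.continuousWithinAt
      exact hmem z hz k hk (h ▸ Metric.mem_ball_self hr)
    obtain ⟨C, hC⟩ := (isCompact_closedBall (x j) r).exists_bound_of_continuousOn hkc
    have hms : MeasurableSet (Metric.ball (x j) r \ {x j}) :=
      measurableSet_ball.diff (measurableSet_singleton _)
    -- Expanding the square of vortex term plus regular part and subtracting the square of the
    -- vortex term leaves a cross term of order `‖z - x j‖⁻¹` and a bounded term.
    have hint : IntegrableOn (fun z => 2 * |(d j : ℝ)| * C * ‖z - x j‖⁻¹ + C ^ 2)
        (Metric.ball (x j) r \ {x j}) :=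
      ((integrableOn_inv_norm_sub (Metric.isBounded_ball.subset sdiff_subset) (x j)).const_mul
        _).add (integrableOn_const
          ((Metric.isBounded_ball.subset sdiff_subset).measure_lt_top).ne)
    have hEq : ∀ z ∈ Metric.ball (x j) r \ {x j}, (‖f z + vortexCur d x z‖ ^ 2 -
        ∑ j, (d j : ℝ) ^ 2 * (Metric.ball (x j) r).indicator (fun z => (‖z - x j‖ ^ 2)⁻¹) z) =
        ‖(d j : ℂ) * (-Complex.I / (z - x j)) + regPart d x f j z‖ ^ 2 -
          ‖(d j : ℂ) * (-Complex.I / (z - x j))‖ ^ 2 := by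
      intro z hz
      rw [add_vortexCur_eq d x f j z, Finset.sum_eq_single j]
      · rw [indicator_of_mem hz.1]
        simp [mul_pow, div_eq_mul_inv]
      · intro k _ hk
        rw [indicator_of_notMem (hmem z (Metric.ball_subset_closedBall hz.1) k hk), mul_zero]
      · simp
    refine IntegrableOn.congr_fun ?_ (fun z hz => (hEq z hz).symm) hms
    refine Integrable.mono' hint ?_ ?_
    · refine ContinuousOn.aestronglyMeasurable ?_ hms
      have h1 : ContinuousOn (fun z => (d j : ℂ) * (-Complex.I / (z - x j)))
          (Metric.ball (x j) r \ {x j}) := fun z hz =>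
        (differentiableAt_vortexTerm _ _ hz.2).continuousAt.continuousWithinAt
      have h2 := hkc.mono (sdiff_subset.trans Metric.ball_subset_closedBall :
        Metric.ball (x j) r \ {x j} ⊆ _)
      exact ((h1.add h2).norm.pow 2).sub (h1.norm.pow 2)
    · filter_upwards [ae_restrict_mem hms] with z hz
      have hC' := hC z (Metric.ball_subset_closedBall hz.1)
      set w := (d j : ℂ) * (-Complex.I / (z - x j)) with hw
      have hwn : ‖w‖ = |(d j : ℝ)| * ‖z - x j‖⁻¹ := by
        simp [hw, div_eq_mul_inv]
      have h1 := norm_add_le w (regPart d x f j z)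
      have h2 := norm_sub_le (w + regPart d x f j z) (regPart d x f j z)
      rw [add_sub_cancel_right] at h2
      have h3 := norm_nonneg (regPart d x f j z)
      have h4 := norm_nonneg w
      have h5 := norm_nonneg (w + regPart d x f j z)
      have h6 : ‖w‖ * ‖regPart d x f j z‖ ≤ ‖w‖ * C := by gcongr
      have h7 : ‖regPart d x f j z‖ ^ 2 ≤ C ^ 2 := by gcongr
      have h8 : 2 * |(d j : ℝ)| * C * ‖z - x j‖⁻¹ = 2 * (‖w‖ * C) := by rw [hwn]; ring
      rw [h8, Real.norm_eq_abs, abs_le]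
      constructor
      · rcases le_total ‖w‖ ‖regPart d x f j z‖ with h | h
        · nlinarith
        · have : (‖w‖ - ‖regPart d x f j z‖) ^ 2 ≤ ‖w + regPart d x f j z‖ ^ 2 := by
            gcongr; linarith
          nlinarith
      · have : ‖w + regPart d x f j z‖ ^ 2 ≤ (‖w‖ + ‖regPart d x f j z‖) ^ 2 := by gcongr
        nlinarith

/-- The renormalised energy is well defined. -/
theorem tendsto_truncatedEnergy (hΩ : IsOpen Ω)
    (hx : x ∈ configSpace Ω n) (hf : DifferentiableOn ℂ f Ω)
    {u : (Fin n → ℂ) → ℂ → ℂ}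
    (hu : IsCurrent (Ω \ range x) (u x) (fun z => f z + vortexCur d x z))
    (hfin : ∀ ρ > 0, IntegrableOn (fun z => ‖f z + vortexCur d x z‖ ^ 2) (perforated Ω x ρ)) :
    Tendsto (fun ρ => truncatedEnergy Ω d u ρ x) (𝓝[>] 0) (𝓝 (renormEnergy Ω d u x)) := by
  refine tendsto_nhds_limUnder ?_
  obtain ⟨r, hr, hrΩ, hrx⟩ := exists_radius hΩ hx
  set S : Fin n → ℂ → ℝ := fun j =>
    (Metric.ball (x j) r).indicator (fun z => (‖z - x j‖ ^ 2)⁻¹) with hS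
  set F : ℂ → ℝ := fun z => ‖f z + vortexCur d x z‖ ^ 2 - ∑ j, (d j : ℝ) ^ 2 * S j z with hF
  have hFi : IntegrableOn F Ω :=
    integrableOn_renormalised hΩ hf hr hrΩ hrx (hfin r hr)
  -- Each disk contributes `2π d_j² log (r / ρ)`; subtracting `2π d_j² log (1 / ρ)` leaves the
  -- constant involving `log r`.
  refine ⟨(∫ z in Ω, F z) + ∑ j, (d j : ℝ) ^ 2 * (2 * Real.pi * Real.log r), ?_⟩
  refine ((tendsto_setIntegral_perforated hΩ.measurableSet x hFi).add_const _).congr' ?_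
  filter_upwards [Ioo_mem_nhdsGT hr] with ρ hρ
  have hm := measurableSet_perforated hΩ.measurableSet x ρ
  have hset : ∀ j, perforated Ω x ρ ∩ Metric.ball (x j) r
      = Metric.ball (x j) r \ Metric.ball (x j) ρ := by
    intro j
    ext z
    constructor
    · rintro ⟨hz, hz'⟩
      exact ⟨hz', fun h => hz.2 (mem_iUnion.2 ⟨j, h⟩)⟩
    · rintro ⟨hz, hz'⟩
      refine ⟨⟨hrΩ j (Metric.ball_subset_closedBall hz), fun h => ?_⟩, hz⟩
      obtain ⟨k, hk⟩ := mem_iUnion.1 h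
      by_cases hkj : k = j
      · exact hz' (hkj ▸ hk)
      · rw [Metric.mem_ball, dist_eq_norm] at hk hz
        have h1 := hrx k j hkj
        have h2 : ‖x k - x j‖ ≤ ‖z - x k‖ + ‖z - x j‖ := by
          rw [norm_sub_rev z (x k)]; exact norm_sub_le_norm_sub_add_norm_sub _ _ _
        have := hρ.2
        linarith
  have hSi : ∀ j, IntegrableOn (S j) (perforated Ω x ρ) := by
    intro j
    rw [IntegrableOn, hS, integrable_indicator_iff measurableSet_ball, IntegrableOn,
      Measure.restrict_restrict measurableSet_ball, inter_comm, hset j]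
    exact integrableOn_annulus (x j) hρ.1 r
  have hSint : ∀ j, ∫ z in perforated Ω x ρ, S j z = 2 * Real.pi * Real.log (r / ρ) := by
    intro j
    rw [hS, setIntegral_indicator measurableSet_ball, hset j]
    exact integral_annulus (x j) hρ.1 hρ.2.le
  have hgrad : ∫ z in perforated Ω x ρ, gradSq (u x) z
      = ∫ z in perforated Ω x ρ, (F z + ∑ j, (d j : ℝ) ^ 2 * S j z) := by
    refine setIntegral_congr_fun hm fun z hz => ?_
    rw [hu.gradSq_eq (perforated_subset_diff_range Ω x hρ.1 hz)]
    simp [hF]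
  rw [truncatedEnergy, hgrad, integral_add (hFi.mono_set (perforated_subset Ω x ρ))
    (integrable_finsetSum _ fun j _ => (hSi j).const_mul _),
    integral_finsetSum _ fun j _ => (hSi j).const_mul _]
  simp only [integral_const_mul, hSint]
  rw [add_sub_assoc, Finset.mul_sum, Finset.sum_mul, ← Finset.sum_sub_distrib]
  congr 1
  refine Finset.sum_congr rfl fun j _ => ?_
  rw [Real.log_div hr.ne' hρ.1.ne', one_div, Real.log_inv]
  ring

end

/-! ### Interior uniform convergence from convergence in `W^{1,1}`. -/

theorem norm_sub_le_of_fderiv {O : Set ℂ} {u v H K : ℂ → ℂ} (hu : IsCurrent O u H)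
    (hv : IsCurrent O v K) {z : ℂ} (hz : z ∈ O) :
    ‖H z - K z‖ ≤ ‖fderiv ℝ u z - fderiv ℝ v z‖ + ‖u z - v z‖ * ‖K z‖ := by
  -- In the conjugate direction the form attached to `H - K` attains its full norm, so that
  -- evaluating `du - dv` on this single vector suffices.
  set ξ : ℂ := (starRingEnd ℂ) (H z - K z) with hξ
  have hn : ‖ξ‖ = ‖H z - K z‖ := by rw [hξ, RCLike.norm_conj]
  have h1 : ((H z - K z) * ξ).re = ‖H z - K z‖ ^ 2 := by
    rw [hξ, Complex.mul_conj, Complex.normSq_eq_norm_sq, Complex.ofReal_re]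
  have h2 : (((H z - K z) * ξ).re : ℂ) * (Complex.I * u z) =
      (fderiv ℝ u z - fderiv ℝ v z) ξ - ((K z * ξ).re : ℂ) * (Complex.I * (u z - v z)) := by
    rw [_root_.sub_apply, hu.fderiv_apply hz, hv.fderiv_apply hz, sub_mul, Complex.sub_re]
    push_cast
    ring
  have h3 := congrArg norm h2
  rw [h1, norm_mul, norm_mul, Complex.norm_I, hu.norm_eq_one z hz, Complex.norm_real,
    Real.norm_of_nonneg (sq_nonneg _), mul_one, mul_one] at h3
  have h4 : ‖H z - K z‖ ^ 2 ≤
      (‖fderiv ℝ u z - fderiv ℝ v z‖ + ‖u z - v z‖ * ‖K z‖) * ‖H z - K z‖ := by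
    rw [h3]
    refine (norm_sub_le _ _).trans ?_
    have e1 := (fderiv ℝ u z - fderiv ℝ v z).le_opNorm ξ
    have e2 : ‖((K z * ξ).re : ℂ) * (Complex.I * (u z - v z))‖ ≤ ‖K z‖ * ‖ξ‖ * ‖u z - v z‖ := by
      rw [norm_mul, norm_mul, Complex.norm_I, one_mul, Complex.norm_real]
      gcongr
      rw [← norm_mul]
      exact Complex.abs_re_le_norm _
    rw [hn] at e1 e2
    linarith
  rcases (norm_nonneg (H z - K z)).eq_or_lt with h | h
  · rw [← h]; positivity
  · rw [sq] at h4
    exact le_of_mul_le_mul_right h4 h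

theorem eventually_setIntegral_norm_le {ι E : Type*} [NormedAddCommGroup E] {l : Filter ι}
    {O K : Set ℂ} {F : ι → ℂ → E} (hKO : K ⊆ O)
    (h : Tendsto (fun i => ∫⁻ z in O, ‖F i z‖ₑ) l (𝓝 0)) {ε : ℝ} (hε : 0 < ε) :
    ∀ᶠ i in l, ∀ B ⊆ K, IntegrableOn (F i) B → ∫ z in B, ‖F i z‖ ≤ ε := by
  filter_upwards [h.eventually (gt_mem_nhds (ENNReal.ofReal_pos.2 hε))] with i hi B hB hint
  rw [integral_norm_eq_lintegral_enorm hint.1]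
  refine ENNReal.toReal_le_of_le_ofReal hε.le ?_
  exact (lintegral_mono_set (hB.trans hKO)).trans hi.le

section

variable {ι : Type*} {l : Filter ι} {O : Set ℂ} {u H : ι → ℂ → ℂ} {u₀ H₀ : ℂ → ℂ}

/-- The difference of the currents is holomorphic, so the mean value property bounds it at a point
by its `L¹` norm on a disk of fixed radius; `norm_sub_le_of_fderiv` bounds this by the `W^{1,1}`
distance of the maps. -/
theorem tendstoUniformlyOn_current (hO : IsOpen O) (hu₀ : IsCurrent O u₀ H₀)
    (hu : ∀ᶠ i in l, IsCurrent O (u i) (H i))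
    (h0 : Tendsto (fun i => ∫⁻ z in O, ‖u i z - u₀ z‖ₑ) l (𝓝 0))
    (h1 : Tendsto (fun i => ∫⁻ z in O, ‖fderiv ℝ (u i) z - fderiv ℝ u₀ z‖ₑ) l (𝓝 0))
    {K : Set ℂ} (hK : IsCompact K) (hKO : K ⊆ O) : TendstoUniformlyOn H H₀ l K := by
  obtain ⟨R, hR, hRO⟩ := hK.exists_cthickening_subset_open hO hKO
  set K' := Metric.cthickening R K with hK'
  have hK'c : IsCompact K' := hK.cthickening
  obtain ⟨C, hC⟩ := hK'c.exists_bound_of_continuousOn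
    (hu₀.differentiableOn.continuousOn.mono hRO)
  have hC0 : 0 ≤ |C| := abs_nonneg C
  rw [Metric.tendstoUniformlyOn_iff]
  intro ε hε
  have hA : 0 < Real.pi * R ^ 2 := by positivity
  -- Two integrals of size `η`, the second weighted by `|C|`, then add up to half of `ε` times the
  -- area of the disk.
  set η : ℝ := ε * (Real.pi * R ^ 2) / (2 * (1 + |C|)) with hη
  have hηpos : 0 < η := by positivity
  filter_upwards [hu, eventually_setIntegral_norm_le hRO h0 hηpos,
    eventually_setIntegral_norm_le hRO h1 hηpos] with i hi hi0 hi1 z hz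
  have hball : Metric.closedBall z R ⊆ K' := Metric.closedBall_subset_cthickening hz R
  have hBO := hball.trans hRO
  have hcomp := isCompact_closedBall z R
  have hsub : Metric.ball z R ⊆ Metric.closedBall z R := Metric.ball_subset_closedBall
  have hdu : ContinuousOn (fderiv ℝ (u i)) O :=
    (hi.contDiffOn hO).continuousOn_fderiv_of_isOpen hO (by norm_num)
  have hdu₀ : ContinuousOn (fderiv ℝ u₀) O :=
    (hu₀.contDiffOn hO).continuousOn_fderiv_of_isOpen hO (by norm_num)
  have c1 : IntegrableOn (fun z => u i z - u₀ z) (Metric.ball z R) :=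
    (((hi.continuousOn.sub hu₀.continuousOn).mono hBO).integrableOn_compact hcomp).mono_set hsub
  have c2 : IntegrableOn (fun z => fderiv ℝ (u i) z - fderiv ℝ u₀ z) (Metric.ball z R) :=
    (((hdu.sub hdu₀).mono hBO).integrableOn_compact hcomp).mono_set hsub
  have c3 : IntegrableOn (fun z => ‖H i z - H₀ z‖) (Metric.ball z R) :=
    ((((hi.differentiableOn.continuousOn.sub hu₀.differentiableOn.continuousOn).norm).mono
      hBO).integrableOn_compact hcomp).mono_set hsub
  have hmv := norm_le_integral_ball (f := fun z => H i z - H₀ z) hR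
    ((hi.differentiableOn.sub hu₀.differentiableOn).mono hBO)
  have hint : ∫ w in Metric.ball z R, ‖H i w - H₀ w‖ ≤ η + η * |C| := by
    calc ∫ w in Metric.ball z R, ‖H i w - H₀ w‖
        ≤ ∫ w in Metric.ball z R, (‖fderiv ℝ (u i) w - fderiv ℝ u₀ w‖ + ‖u i w - u₀ w‖ * |C|) := by
          refine setIntegral_mono_on c3 (c2.norm.add (c1.norm.mul_const _))
            measurableSet_ball fun w hw => ?_
          refine (norm_sub_le_of_fderiv hi hu₀ (hBO (hsub hw))).trans ?_
          gcongr
          exact (hC w (hball (hsub hw))).trans (le_abs_self C)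
      _ = (∫ w in Metric.ball z R, ‖fderiv ℝ (u i) w - fderiv ℝ u₀ w‖) +
          (∫ w in Metric.ball z R, ‖u i w - u₀ w‖) * |C| := by
          rw [integral_add c2.norm (c1.norm.mul_const _), integral_mul_const]
      _ ≤ η + η * |C| := by
          gcongr
          · exact hi1 _ (hsub.trans hball) c2
          · exact hi0 _ (hsub.trans hball) c1
  rw [dist_comm, dist_eq_norm]
  refine hmv.trans_lt ?_
  rw [inv_mul_lt_iff₀ hA]
  refine hint.trans_lt ?_
  have : η + η * |C| = ε * (Real.pi * R ^ 2) / 2 := by rw [hη]; field_simp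
  rw [this]
  nlinarith [mul_pos hε hA]

/-- Because the currents converge, `u i - u₀` is eventually Lipschitz on small disks with a fixed
constant. A large value at one point would persist on a disk of fixed radius and contradict `L¹`
smallness. -/
theorem tendstoUniformlyOn_map (hO : IsOpen O) (hu₀ : IsCurrent O u₀ H₀)
    (hu : ∀ᶠ i in l, IsCurrent O (u i) (H i))
    (h0 : Tendsto (fun i => ∫⁻ z in O, ‖u i z - u₀ z‖ₑ) l (𝓝 0))
    (h1 : Tendsto (fun i => ∫⁻ z in O, ‖fderiv ℝ (u i) z - fderiv ℝ u₀ z‖ₑ) l (𝓝 0))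
    {K : Set ℂ} (hK : IsCompact K) (hKO : K ⊆ O) : TendstoUniformlyOn u u₀ l K := by
  obtain ⟨R, hR, hRO⟩ := hK.exists_cthickening_subset_open hO hKO
  set K' := Metric.cthickening R K with hK'
  have hK'c : IsCompact K' := hK.cthickening
  obtain ⟨C, hC⟩ := hK'c.exists_bound_of_continuousOn
    (hu₀.differentiableOn.continuousOn.mono hRO)
  have hunif := Metric.tendstoUniformlyOn_iff.1
    (tendstoUniformlyOn_current hO hu₀ hu h0 h1 hK'c hRO) 1 one_pos
  rw [Metric.tendstoUniformlyOn_iff]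
  intro ε hε
  -- Bounds `‖H i‖ + ‖H₀‖` as soon as the two currents are within `1` of each other.
  set Λ : ℝ := 2 * |C| + 1 with hΛ
  have hΛ0 : 0 < Λ := by positivity
  set t : ℝ := min R (ε / (4 * Λ)) with ht
  have ht0 : 0 < t := lt_min hR (by positivity)
  have htε : Λ * t ≤ ε / 4 := by
    calc Λ * t ≤ Λ * (ε / (4 * Λ)) := by gcongr; exact min_le_right _ _
      _ = ε / 4 := by field_simp
  have hA : 0 < Real.pi * t ^ 2 := by positivity
  filter_upwards [hu, hunif, eventually_setIntegral_norm_le hRO h0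
    (by positivity : 0 < Real.pi * t ^ 2 * (ε / 4))] with i hi hiH hi0 z hz
  have hball : Metric.closedBall z t ⊆ K' :=
    (Metric.closedBall_subset_closedBall (min_le_left _ _)).trans
      (Metric.closedBall_subset_cthickening hz R)
  have hBO := hball.trans hRO
  have hsub : Metric.ball z t ⊆ Metric.closedBall z t := Metric.ball_subset_closedBall
  set D : ℂ → ℂ := fun w => u i w - u₀ w with hD
  have hDd : ∀ w ∈ K', DifferentiableAt ℝ D w := fun w hw =>
    (hi.hasFDerivAt w (hRO hw)).differentiableAt.fun_sub
      (hu₀.hasFDerivAt w (hRO hw)).differentiableAt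
  have hDn : ∀ w ∈ K', ‖fderiv ℝ D w‖ ≤ Λ := by
    intro w hw
    rw [hD, fderiv_fun_sub (hi.hasFDerivAt w (hRO hw)).differentiableAt
      (hu₀.hasFDerivAt w (hRO hw)).differentiableAt]
    have e1 := hi.norm_fderiv_le (hRO hw)
    have e2 := hu₀.norm_fderiv_le (hRO hw)
    have e3 := hiH w hw
    rw [dist_comm, dist_eq_norm] at e3
    have e4 := (hC w hw).trans (le_abs_self C)
    have e5 := norm_sub_norm_le (H i w) (H₀ w)
    have e6 := norm_sub_le (fderiv ℝ (u i) w) (fderiv ℝ u₀ w)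
    linarith
  have c1 : IntegrableOn D (Metric.ball z t) :=
    (((hi.continuousOn.sub hu₀.continuousOn).mono hBO).integrableOn_compact
      (isCompact_closedBall z t)).mono_set hsub
  have hlip : ∀ w ∈ Metric.ball z t, ‖D z‖ - Λ * t ≤ ‖D w‖ := by
    intro w hw
    have h2 := (convex_closedBall z t).norm_image_sub_le_of_norm_fderiv_le
      (fun y hy => hDd y (hball hy)) (fun y hy => hDn y (hball hy)) (hsub hw)
      (Metric.mem_closedBall_self ht0.le)
    have h3 := norm_sub_norm_le (D z) (D w)
    have h4 : ‖z - w‖ ≤ t := by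
      rw [← dist_eq_norm, dist_comm]; exact (Metric.mem_ball.1 hw).le
    have h5 : Λ * ‖z - w‖ ≤ Λ * t := by gcongr
    linarith
  have hconst : ∫ w in Metric.ball z t, (‖D z‖ - Λ * t) = Real.pi * t ^ 2 * (‖D z‖ - Λ * t) := by
    rw [setIntegral_const]
    simp [Measure.real, Complex.volume_ball, ENNReal.toReal_ofReal ht0.le]
    left; ring
  have hmono : ∫ w in Metric.ball z t, (‖D z‖ - Λ * t) ≤ ∫ w in Metric.ball z t, ‖D w‖ :=
    setIntegral_mono_on (integrableOn_const (by simp [Complex.volume_ball, ENNReal.mul_eq_top]))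
      c1.norm measurableSet_ball hlip
  rw [hconst] at hmono
  have h6 := hmono.trans (hi0 _ (hsub.trans hball) c1)
  have h7 := le_of_mul_le_mul_left h6 hA
  rw [dist_comm, dist_eq_norm]
  have : ‖u i z - u₀ z‖ = ‖D z‖ := rfl
  linarith

end

/-! ### Differentials of phases. -/

theorem hasFDerivAt_arg_comp {w : ℂ → ℂ} {J z : ℂ} (hn : w z ≠ 0)
    (hw : HasFDerivAt w ((curForm J).smulRight (Complex.I * w z)) z)
    (hs : w z ∈ Complex.slitPlane) :
    HasFDerivAt (fun y => Complex.arg (w y)) (curForm J) z := by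
  have h1 := ((Complex.hasDerivAt_log hs).hasFDerivAt.restrictScalars ℝ).comp z hw
  have h2 := (Complex.imCLM.hasFDerivAt.comp z h1).congr_of_eventuallyEq
    (f₁ := fun y => Complex.arg (w y)) (Eventually.of_forall fun y => (Complex.log_im (w y)).symm)
  refine h2.congr_fderiv ?_
  ext1 ξ
  change ((((J * ξ).re : ℝ) • (Complex.I * w z)) • (w z)⁻¹).im = (J * ξ).re
  rw [Complex.real_smul, smul_eq_mul, mul_assoc, mul_assoc, mul_inv_cancel₀ hn]
  simp

/-- A continuous phase of a circle-valued map is differentiable. -/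
theorem hasFDerivAt_of_exp_eq {w : ℂ → ℂ} {ψ : ℂ → ℝ} {J z : ℂ}
    (hw : HasFDerivAt w ((curForm J).smulRight (Complex.I * w z)) z)
    (hψ : ContinuousAt ψ z) (he : ∀ᶠ y in 𝓝 z, Complex.exp (ψ y * Complex.I) = w y) :
    HasFDerivAt ψ (curForm J) z := by
  have hez := he.self_of_nhds
  have hn : w z ≠ 0 := by rw [← hez]; exact Complex.exp_ne_zero _
  have h1 : HasFDerivAt (fun y => w y / w z) ((curForm J).smulRight (Complex.I * (w z / w z))) z := by
    have := hw.mul_const (w z)⁻¹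
    refine this.congr_fderiv ?_
    ext ξ
    simp
    field_simp
  have h2 := hasFDerivAt_arg_comp (w := fun y => w y / w z) (by simp [hn]) h1
    (by simp [hn, Complex.slitPlane])
  refine (h2.add_const (ψ z)).congr_of_eventuallyEq ?_
  -- As long as the phase has moved by less than `π`, the principal argument of `w y / w z` recovers
  -- its increment.
  have h3 : ∀ᶠ y in 𝓝 z, |ψ y - ψ z| < Real.pi := by
    have : ContinuousAt (fun y => |ψ y - ψ z|) z := (hψ.sub continuousAt_const).abs
    rw [ContinuousAt, sub_self, abs_zero] at this
    exact this.eventually (gt_mem_nhds Real.pi_pos)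
  filter_upwards [he, h3] with y hy hy3
  rw [← hy, ← hez, ← Complex.exp_sub]
  have : (ψ y : ℂ) * Complex.I - ψ z * Complex.I = ((ψ y - ψ z : ℝ) : ℂ) * Complex.I := by
    push_cast; ring
  rw [abs_lt] at hy3
  rw [this, Complex.arg_exp_mul_I, toIocMod_eq_self (by positivity) |>.2 ⟨hy3.1, by linarith⟩]
  ring

/-! ### Coordinates near the boundary -/

/-- The shear chart `(a, c) ↦ z₀ + e (γ a - c + i a)`. -/
noncomputable def collar (z₀ e : ℂ) (he : e ≠ 0) (γ : ℝ → ℝ) (hγ : Continuous γ) : ℝ × ℝ ≃ₜ ℂ where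
  toFun p := z₀ + e * (((γ p.1 - p.2 : ℝ) : ℂ) + p.1 * Complex.I)
  invFun z := (((z - z₀) / e).im, γ ((z - z₀) / e).im - ((z - z₀) / e).re)
  left_inv p := by
    dsimp only
    rw [add_sub_cancel_left, mul_div_cancel_left₀ _ he]
    ext <;> simp
  right_inv z := by
    have : (((γ ((z - z₀) / e).im - (γ ((z - z₀) / e).im - ((z - z₀) / e).re) : ℝ) : ℂ) +
        (((z - z₀) / e).im : ℝ) * Complex.I) = (z - z₀) / e := by
      rw [sub_sub_cancel, Complex.re_add_im]
    dsimp only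
    rw [this, mul_div_cancel₀ _ he, add_sub_cancel]
  continuous_toFun := by fun_prop
  continuous_invFun := by fun_prop

theorem collar_apply (z₀ e : ℂ) (he : e ≠ 0) (γ : ℝ → ℝ) (hγ : Continuous γ) (a c : ℝ) :
    collar z₀ e he γ hγ (a, c) = z₀ + e * (((γ a - c : ℝ) : ℂ) + a * Complex.I) := rfl

theorem hasDerivAt_collar (z₀ e : ℂ) (he : e ≠ 0) (γ : ℝ → ℝ) (hγ : Continuous γ) (a c : ℝ) :
    HasDerivAt (fun c => collar z₀ e he γ hγ (a, c)) (-e) c := by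
  simp only [collar_apply]
  have h1 : HasDerivAt (fun c : ℝ => ((γ a - c : ℝ) : ℂ)) (-1) c := by
    have := ((hasDerivAt_id c).const_sub (γ a)).ofReal_comp
    simpa using this
  have h2 := ((h1.add_const (a * Complex.I)).const_mul e).const_add z₀
  simpa using h2

/-- The chart is a translation and reflection on each line `a = const`, followed by a rotation and a
translation of the plane, so Fubini gives invariance even though `γ` is merely continuous. -/
theorem lintegral_collar {z₀ e : ℂ} (he1 : ‖e‖ = 1) (he : e ≠ 0) {γ : ℝ → ℝ} (hγ : Continuous γ)
    {G : ℂ → ℝ≥0∞} (hG : Measurable G) :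
    ∫⁻ a, ∫⁻ c, G (collar z₀ e he γ hγ (a, c)) = ∫⁻ z, G z := by
  have e1 : ∀ a : ℝ, ∫⁻ c, G (collar z₀ e he γ hγ (a, c)) =
      ∫⁻ b : ℝ, G (z₀ + e * ((b : ℂ) + a * Complex.I)) := fun a =>
    lintegral_sub_left_eq_self (μ := volume) (fun b : ℝ => G (z₀ + e * ((b : ℂ) + a * Complex.I)))
      (γ a)
  simp_rw [e1]
  have hF : Measurable fun p : ℝ × ℝ => G (z₀ + e * ((p.1 : ℂ) + p.2 * Complex.I)) :=
    hG.comp (by fun_prop)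
  have e2 := lintegral_prod_symm (μ := (volume : Measure ℝ)) (ν := (volume : Measure ℝ)) _
    hF.aemeasurable
  rw [← e2, ← Measure.volume_eq_prod]
  have e3 := Complex.volume_preserving_equiv_real_prod.lintegral_comp hF
  rw [← e3]
  have e4 : ∀ w : ℂ, (((Complex.measurableEquivRealProd w).1 : ℝ) : ℂ) +
      ((Complex.measurableEquivRealProd w).2 : ℝ) * Complex.I = w := fun w => by
    simp
  simp_rw [e4]
  set θ : Circle := ⟨e, by simp [Submonoid.unitSphere, he1]⟩ with hθ
  have e5 := (rotation θ).measurePreserving.lintegral_comp (f := fun w => G (z₀ + w))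
    (hG.comp (by fun_prop))
  have e6 : ∀ w, rotation θ w = e * w := fun w => by rw [rotation_apply]
  simp only [e6] at e5
  rw [e5]
  exact lintegral_add_left_eq_self (μ := volume) G z₀

/-- Near a boundary point of a smooth domain, the domain lies below the graph of a continuous
function over a line. -/
theorem HasSmoothBoundary.exists_collar {Ω N : Set ℂ} (hΩ : IsOpen Ω) (hs : HasSmoothBoundary Ω)
    {z₀ : ℂ} (hz₀ : z₀ ∈ frontier Ω) (hN : N ∈ 𝓝 z₀) :
    ∃ (e : ℂ) (he : e ≠ 0) (γ : ℝ → ℝ) (hγ : Continuous γ) (α c₀ : ℝ), ‖e‖ = 1 ∧ 0 < α ∧ 0 < c₀ ∧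
      (∀ a ∈ Icc (-α) α, ∀ c ∈ Ioc 0 c₀, collar z₀ e he γ hγ (a, c) ∈ Ω ∩ N) ∧
      (∀ a ∈ Icc (-α) α, collar z₀ e he γ hγ (a, 0) ∈ frontier Ω) ∧
      ∃ W ∈ 𝓝 z₀, ∀ z ∈ W ∩ Ω, ∃ a ∈ Icc (-(α / 2)) (α / 2), ∃ c ∈ Ioo 0 c₀,
        z = collar z₀ e he γ hγ (a, c) := by
  obtain ⟨V, hV, hzV, ρ, hρ, hρ0, hρΩ⟩ := hs z₀ hz₀
  have hρd : Differentiable ℝ ρ := hρ.differentiable (by simp)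
  have hρc : Continuous ρ := hρd.continuous
  have hz₀Ω : z₀ ∉ Ω := by
    rw [hΩ.frontier_eq] at hz₀; exact hz₀.2
  have hρz : ρ z₀ = 0 := by
    refine le_antisymm ?_ (not_lt.1 fun h => hz₀Ω ((hρΩ z₀ hzV).2 h))
    have hcl : z₀ ∈ closure (Ω ∩ V) :=
      mem_closure_iff_nhds.2 fun t ht => by
        obtain ⟨y, hy, hyΩ⟩ := mem_closure_iff_nhds.1 (frontier_subset_closure hz₀) _
          (inter_mem ht (hV.mem_nhds hzV))
        exact ⟨y, hy.1, hyΩ, hy.2⟩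
    have : closure (Ω ∩ V) ⊆ {z | ρ z ≤ 0} :=
      closure_minimal (fun y hy => ((hρΩ y hy.2).1 hy.1).le) (isClosed_le hρc continuous_const)
    exact this hcl
  obtain ⟨e, he1, hde⟩ : ∃ e : ℂ, ‖e‖ = 1 ∧ 0 < fderiv ℝ ρ z₀ e := by
    obtain ⟨v, hv⟩ : ∃ v, fderiv ℝ ρ z₀ v ≠ 0 := by
      by_contra! h
      exact hρ0 z₀ hzV (ContinuousLinearMap.ext h)
    have hv0 : v ≠ 0 := by rintro rfl; simp at hv
    have hn : 0 < ‖v‖ := norm_pos_iff.2 hv0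
    rcases hv.lt_or_gt with h | h
    · refine ⟨-(‖v‖⁻¹ • v), by rw [norm_neg, norm_smul]; simp [hn.ne'], ?_⟩
      rw [map_neg, map_smul, smul_eq_mul]
      have := mul_neg_of_pos_of_neg (inv_pos.2 hn) h
      linarith
    · refine ⟨‖v‖⁻¹ • v, by rw [norm_smul]; simp [hn.ne'], ?_⟩
      rw [map_smul, smul_eq_mul]
      exact mul_pos (inv_pos.2 hn) h
  have he : e ≠ 0 := by rintro rfl; simp at he1
  have hdc : Continuous fun z => fderiv ℝ ρ z e :=
    (hρ.continuous_fderiv (by simp)).clm_apply continuous_const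
  have hnb : {z | 0 < fderiv ℝ ρ z e} ∩ V ∩ N ∈ 𝓝 z₀ :=
    inter_mem (inter_mem ((isOpen_lt continuous_const hdc).mem_nhds hde) (hV.mem_nhds hzV)) hN
  obtain ⟨r', hr', hball⟩ := Metric.mem_nhds_iff.1 hnb
  set r := r' / 4 with hr
  have hr0 : 0 < r := by positivity
  set q : ℝ → ℝ → ℂ := fun a b => z₀ + e * ((b : ℂ) + a * Complex.I) with hq
  have hqball : ∀ a b, |a| ≤ r → |b| ≤ r → q a b ∈ Metric.ball z₀ r' := by
    intro a b ha hb
    rw [Metric.mem_ball, dist_eq_norm, hq]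
    simp only [add_sub_cancel_left, norm_mul, he1, one_mul]
    calc ‖(b : ℂ) + a * Complex.I‖ ≤ ‖(b : ℂ)‖ + ‖(a : ℂ) * Complex.I‖ := norm_add_le _ _
      _ = |b| + |a| := by simp
      _ < r' := by linarith
  have hqc : Continuous fun p : ℝ × ℝ => q p.1 p.2 := by fun_prop
  set R : ℝ → ℝ → ℝ := fun a b => ρ (q a b) with hR
  have hRc : Continuous fun p : ℝ × ℝ => R p.1 p.2 := hρc.comp hqc
  have hRa : ∀ b, Continuous fun a => R a b := fun b =>
    hRc.comp (continuous_id.prodMk continuous_const)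
  have hRb : ∀ a, Continuous fun b => R a b := fun a =>
    hRc.comp (continuous_const.prodMk continuous_id)
  -- The defining function increases strictly along `e`. On each line the intermediate value theorem
  -- provides its zero, and monotonicity makes this zero unique and continuous in `a`, so that the
  -- boundary is a graph.
  have hmono : ∀ a, |a| ≤ r → StrictMonoOn (R a) (Icc (-r) r) := by
    intro a ha
    refine strictMonoOn_of_deriv_pos (convex_Icc _ _) (hRb a).continuousOn fun b hb => ?_
    rw [interior_Icc] at hb
    have hb' : |b| ≤ r := abs_le.2 ⟨hb.1.le, hb.2.le⟩
    have h1 : HasDerivAt (q a) e b := by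
      have := (((hasDerivAt_id b).ofReal_comp.add_const (a * Complex.I)).const_mul e).const_add z₀
      rwa [Complex.ofReal_one, mul_one] at this
    have h2 : HasDerivAt (R a) (fderiv ℝ ρ (q a b) e) b :=
      (hρd (q a b)).hasFDerivAt.comp_hasDerivAt b h1
    rw [h2.deriv]
    exact (hball (hqball a b ha hb')).1.1
  have hR00 : R 0 0 = 0 := by simp [hR, hq, hρz]
  have hm0 := hmono 0 (by simpa using hr0.le)
  have hneg : R 0 (-(r / 8)) < 0 := by
    have := hm0 (a := -(r / 8)) (b := 0) ⟨by linarith, by linarith⟩ ⟨by linarith, by linarith⟩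
      (by linarith)
    rwa [hR00] at this
  have hpos : 0 < R 0 (r / 8) := by
    have := hm0 (a := 0) (b := r / 8) ⟨by linarith, by linarith⟩ ⟨by linarith, by linarith⟩
      (by linarith)
    rwa [hR00] at this
  have hev : ∀ᶠ a in 𝓝 (0 : ℝ), R a (-(r / 8)) < 0 ∧ 0 < R a (r / 8) :=
    ((hRa _).continuousAt.eventually (gt_mem_nhds hneg)).and
      ((hRa _).continuousAt.eventually (lt_mem_nhds hpos))
  obtain ⟨α', hα', hαball⟩ := Metric.eventually_nhds_iff_ball.1 hev
  set α := min (α' / 2) r with hα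
  have hα0 : 0 < α := lt_min (by positivity) hr0
  have hαr : α ≤ r := min_le_right _ _
  have hαα : -α ≤ α := by linarith
  have habs : ∀ a ∈ Icc (-α) α, |a| ≤ r := fun a ha => (abs_le.2 ha).trans hαr
  have hsgn : ∀ a ∈ Icc (-α) α, R a (-(r / 8)) < 0 ∧ 0 < R a (r / 8) := by
    intro a ha
    refine hαball a ?_
    rw [Metric.mem_ball, dist_zero_right, Real.norm_eq_abs]
    have h1 := abs_le.2 ha
    have h2 : α ≤ α' / 2 := min_le_left _ _
    linarith
  have hex : ∀ a : Icc (-α) α, ∃ b ∈ Ioo (-(r / 8)) (r / 8), R a b = 0 := fun a =>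
    intermediate_value_Ioo (by linarith) (hRb a).continuousOn (hsgn a a.2)
  choose g hg hg0 using hex
  have hgc : Continuous g := by
    rw [continuous_iff_continuousAt]
    intro a
    rw [Metric.continuousAt_iff']
    intro ε hε
    set η := min ε (r / 8) / 2 with hη
    have hm : 0 < min ε (r / 8) := lt_min hε (by positivity)
    have hη0 : 0 < η := by positivity
    have hηε : η < ε := by have := min_le_left ε (r / 8); linarith
    have hηr : η < r / 8 := by have := min_le_right ε (r / 8); linarith
    have hga := hg a
    have hma := hmono a (habs a a.2)
    have h1 : R a (g a - η) < 0 := by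
      rw [← hg0 a]
      exact hma ⟨by linarith [hga.1], by linarith [hga.2]⟩ ⟨by linarith [hga.1], by linarith [hga.2]⟩
        (by linarith)
    have h2 : 0 < R a (g a + η) := by
      rw [← hg0 a]
      exact hma ⟨by linarith [hga.1], by linarith [hga.2]⟩ ⟨by linarith [hga.1], by linarith [hga.2]⟩
        (by linarith)
    have hR' : ∀ b, Continuous fun a : Icc (-α) α => R a b := fun b =>
      (hRa b).comp continuous_subtype_val
    filter_upwards [(hR' (g a - η)).continuousAt.eventually (gt_mem_nhds h1),
      (hR' (g a + η)).continuousAt.eventually (lt_mem_nhds h2)] with a' h1' h2'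
    have hga' := hg a'
    have hma' := hmono a' (habs a' a'.2)
    rw [← hg0 a'] at h1' h2'
    have k1 := (hma'.lt_iff_lt ⟨by linarith [hga.1], by linarith [hga.2]⟩
      ⟨by linarith [hga'.1], by linarith [hga'.2]⟩).1 h1'
    have k2 := (hma'.lt_iff_lt ⟨by linarith [hga'.1], by linarith [hga'.2]⟩
      ⟨by linarith [hga.1], by linarith [hga.2]⟩).1 h2'
    rw [Real.dist_eq, abs_lt]
    constructor <;> linarith
  set γ : ℝ → ℝ := IccExtend hαα g with hγ
  have hγc : Continuous γ := hgc.Icc_extend'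
  have hγm : ∀ a ∈ Icc (-α) α, γ a ∈ Ioo (-(r / 8)) (r / 8) ∧ R a (γ a) = 0 := by
    intro a ha
    rw [hγ, IccExtend_of_mem hαα g ha]
    exact ⟨hg ⟨a, ha⟩, hg0 ⟨a, ha⟩⟩
  have hcq : ∀ a c, collar z₀ e he γ hγc (a, c) = q a (γ a - c) := fun a c => rfl
  have hmem : ∀ a ∈ Icc (-α) α, ∀ c ∈ Ioc 0 (r / 2), collar z₀ e he γ hγc (a, c) ∈ Ω ∩ N := by
    intro a ha c hc
    obtain ⟨h1, h2⟩ := hγm a ha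
    have h3 : γ a - c ∈ Icc (-r) r := ⟨by linarith [h1.1, hc.2], by linarith [h1.2, hc.1]⟩
    have h4 := hball (hqball a (γ a - c) (habs a ha) (abs_le.2 h3))
    rw [hcq]
    refine ⟨(hρΩ _ h4.1.2).2 ?_, h4.2⟩
    change R a (γ a - c) < 0
    rw [← h2]
    exact hmono a (habs a ha) h3 ⟨by linarith [h1.1], by linarith [h1.2]⟩ (by linarith [hc.1])
  refine ⟨e, he, γ, hγc, α, r / 2, he1, hα0, by positivity, hmem, ?_, ?_⟩
  · intro a ha
    rw [hΩ.frontier_eq]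
    obtain ⟨h1, h2⟩ := hγm a ha
    constructor
    · have hT : Tendsto (fun c => collar z₀ e he γ hγc (a, c)) (𝓝[>] 0)
          (𝓝 (collar z₀ e he γ hγc (a, 0))) :=
        ((hasDerivAt_collar z₀ e he γ hγc a 0).continuousAt.tendsto).mono_left nhdsWithin_le_nhds
      refine mem_closure_of_tendsto hT ?_
      filter_upwards [Ioc_mem_nhdsGT (by positivity : 0 < r / 2)] with c hc
      exact (hmem a ha c hc).1
    · intro h
      have h4 := hball (hqball a (γ a) (habs a ha)
        (abs_le.2 ⟨by linarith [h1.1], by linarith [h1.2]⟩))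
      rw [hcq, sub_zero] at h
      have := (hρΩ _ h4.1.2).1 h
      change R a (γ a) < 0 at this
      linarith
  · refine ⟨{z | |((z - z₀) / e).im| < α / 2} ∩ {z | |((z - z₀) / e).re| < r / 8} ∩ V, ?_, ?_⟩
    · refine (((isOpen_lt (by fun_prop) continuous_const).inter
        (isOpen_lt (by fun_prop) continuous_const)).inter hV).mem_nhds ⟨⟨?_, ?_⟩, hzV⟩
      · simpa using hα0
      · simpa using hr0
    · rintro z ⟨⟨⟨hz1, hz2⟩, hzV'⟩, hzΩ⟩
      rw [mem_ofPred_eq, abs_lt] at hz1 hz2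
      set a := ((z - z₀) / e).im
      set b := ((z - z₀) / e).re
      have ha : a ∈ Icc (-α) α := ⟨by linarith [hz1.1], by linarith [hz1.2]⟩
      obtain ⟨h1, h2⟩ := hγm a ha
      have hzq : q a b = z := by
        simp only [hq, a, b, Complex.re_add_im]
        rw [mul_div_cancel₀ _ he, add_sub_cancel]
      have h3 : R a b < R a (γ a) := by
        rw [h2]; change ρ (q a b) < 0; rw [hzq]; exact (hρΩ z hzV').1 hzΩ
      have h4 := ((hmono a (habs a ha)).lt_iff_lt ⟨by linarith [hz2.1], by linarith [hz2.2]⟩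
        ⟨by linarith [h1.1], by linarith [h1.2]⟩).1 h3
      refine ⟨a, ⟨hz1.1.le, hz1.2.le⟩, γ a - b, ⟨by linarith, by linarith [h1.2, hz2.1]⟩, ?_⟩
      rw [hcq, sub_sub_cancel, hzq]

/-! ### Maximum principle and uniform convergence up to the boundary. -/

/-- Maximum principle for a phase whose differential is a holomorphic current. -/
theorem abs_le_of_frontier {A K : Set ℂ} (hA : IsOpen A) (hK : IsCompact K) (hKA : K ⊆ A)
    {J : ℂ → ℂ} (hJ : DifferentiableOn ℂ J A) {ψ : ℂ → ℝ}
    (hψ : ∀ z ∈ A, HasFDerivAt ψ (curForm (J z)) z) {m : ℝ} (hm : 0 < m)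
    (hfr : ∀ z ∈ frontier K, |ψ z| < m) {z : ℂ} (hz : z ∈ K) : |ψ z| ≤ m := by
  have hψ1 : ContDiffOn ℝ 1 ψ A := by
    refine contDiffOn_one_of_continuousOn_fderiv hA (fun z hz => (hψ z hz).differentiableAt.differentiableWithinAt) ?_
    exact (continuous_curForm.comp_continuousOn hJ.continuousOn).congr fun z hz => (hψ z hz).fderiv
  -- As `|ψ| < m` on the frontier of `K`, the truncation vanishes near it, so extending by zero
  -- keeps `φ` of class `C¹`.
  set φ : ℂ → ℝ := K.indicator fun w => m * trunc (ψ w / m) with hφ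
  have hin : ∀ w ∈ interior K, φ =ᶠ[𝓝 w] fun w => m * trunc (ψ w / m) := fun w hw => by
    filter_upwards [isOpen_interior.mem_nhds hw] with y hy
    exact indicator_of_mem (interior_subset hy) _
  have hout : ∀ w ∉ interior K, φ =ᶠ[𝓝 w] fun _ => 0 := fun w hw => by
    by_cases hwK : w ∈ K
    · have h1 : |ψ w| < m := hfr w ⟨subset_closure hwK, hw⟩
      have h2 : ContinuousAt (fun y => |ψ y|) w := (hψ w (hKA hwK)).continuousAt.abs
      filter_upwards [h2.eventually (gt_mem_nhds h1)] with y hy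
      rw [hφ]
      by_cases hyK : y ∈ K
      · rw [indicator_of_mem hyK, trunc_eq_zero, mul_zero]
        rw [abs_div, abs_of_pos hm, div_le_one hm]
        exact hy.le
      · exact indicator_of_notMem hyK _
    · filter_upwards [hK.isClosed.isOpen_compl.mem_nhds hwK] with y hy
      exact indicator_of_notMem hy _
  have hφ1 : ContDiffOn ℝ 1 φ A := by
    intro w hw
    refine ContDiffAt.contDiffWithinAt ?_
    by_cases hwK : w ∈ interior K
    · refine ContDiffAt.congr_of_eventuallyEq ?_ (hin w hwK)
      exact contDiffAt_const.mul (contDiff_trunc.contDiffAt.comp w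
        ((hψ1.contDiffAt (hA.mem_nhds hw)).div_const m))
    · exact contDiffAt_const.congr_of_eventuallyEq (hout w hwK)
  have h0 : ∀ w ∉ K, φ w = 0 := fun w hw => indicator_of_notMem hw _
  have hφc := contDiff_of_eq_zero_off_compact hA hK hKA hφ1 h0
  obtain ⟨hint, hzero⟩ := integral_curDot_fderiv_eq_zero hA hK hKA hJ hφ1 h0
  have hder : ∀ w ∈ interior K, fderiv ℝ φ w = truncDeriv (ψ w / m) • curForm (J w) := by
    intro w hw
    have h1 := hψ w (hKA (interior_subset hw))
    have h2 := hasFDerivAt_trunc_comp h1.differentiableAt m hm.ne'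
    rw [(hin w hw).fderiv_eq, h2.fderiv, h1.fderiv]
  have hder0 : ∀ w ∉ interior K, fderiv ℝ φ w = 0 := fun w hw => by
    rw [(hout w hw).fderiv_eq]; simp
  have hval : ∀ w ∈ interior K, curDot (J w) (fderiv ℝ φ w) = truncDeriv (ψ w / m) * ‖J w‖ ^ 2 :=
    fun w hw => by rw [hder w hw, curDot_smul, curDot_curForm_self]
  have hnn : ∀ w, 0 ≤ curDot (J w) (fderiv ℝ φ w) := fun w => by
    by_cases hw : w ∈ interior K
    · rw [hval w hw]; exact mul_nonneg (truncDeriv_nonneg _) (sq_nonneg _)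
    · rw [hder0 w hw, curDot_zero]
  -- Testing the current with its own truncated phase gives a nonnegative integrand with zero
  -- integral. Hence `dφ = 0`, and `φ` is the constant `0`, its value off `K`.
  have hae := (integral_eq_zero_iff_of_nonneg hnn hint).1 hzero
  have hfd : fderiv ℝ φ = fun _ => 0 := by
    refine (Continuous.ae_eq_iff_eq volume (hφc.continuous_fderiv (by norm_num))
      continuous_const).1 ?_
    filter_upwards [hae] with w hw
    by_cases hwK : w ∈ interior K
    · rw [hval w hwK, Pi.zero_apply] at hw
      rw [hder w hwK]
      rcases mul_eq_zero.1 hw with h | h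
      · rw [h, zero_smul]
      · rw [pow_eq_zero_iff two_ne_zero, norm_eq_zero] at h
        rw [h, curForm_zero, smul_zero]
    · exact hder0 w hwK
  obtain ⟨y, hy⟩ : ∃ y, y ∉ K := by
    by_contra! h
    exact noncompact_univ ℂ ((eq_univ_of_forall h) ▸ hK)
  have hzy : φ z = φ y := is_const_of_fderiv_eq_zero (𝕜 := ℝ)
    (hφc.differentiable (by norm_num)) (fun w => congrFun hfd w) z y
  rw [h0 y hy, hφ, indicator_of_mem hz, mul_eq_zero] at hzy
  by_contra! h
  refine trunc_ne_zero ?_ (hzy.resolve_left hm.ne')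
  rwa [abs_div, abs_of_pos hm, one_lt_div hm]

theorem abs_arg_le {w : ℂ} (hw : ‖w‖ = 1) : |Complex.arg w| ≤ 2 * ‖w - 1‖ := by
  have h0 : w ≠ 0 := by rintro rfl; simp at hw
  rw [← Complex.angle_one_right h0]
  refine (Complex.angle_le_mul_norm_sub hw norm_one).trans ?_
  gcongr
  linarith [Real.pi_le_four]

theorem norm_exp_sub_one_le (t : ℝ) : ‖Complex.exp (t * Complex.I) - 1‖ ≤ |t| := by
  rw [mul_comm, ← Real.norm_eq_abs]; exact Real.norm_exp_I_mul_ofReal_sub_one_le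

/-- A phase that is small somewhere on a connected set on which the map is close to `1` is small
everywhere on it. -/
theorem abs_le_of_isPreconnected {X : Type*} [TopologicalSpace X] {S : Set X}
    (hS : IsPreconnected S) {ψ : X → ℝ} (hψ : ContinuousOn ψ S) {ε : ℝ} (hε : 2 * ε < 1)
    (h : ∀ p ∈ S, ‖Complex.exp (ψ p * Complex.I) - 1‖ ≤ ε) {p₀ : X} (hp₀ : p₀ ∈ S)
    (h₀ : |ψ p₀| ≤ 2 * ε) {p : X} (hp : p ∈ S) : |ψ p| ≤ 2 * ε := by
  by_contra! hlt
  -- By connectedness `|ψ|` takes the value `t` in `(2 ε, 1]`. There the phase equals the principal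
  -- argument, which is at most `2 ε`: a contradiction.
  set t := min |ψ p| 1 with ht
  have h1 : 2 * ε < t := lt_min hlt hε
  obtain ⟨q, hq, hqt⟩ := hS.intermediate_value hp₀ hp hψ.abs
    (⟨h₀.trans h1.le, min_le_left _ _⟩ : t ∈ Icc |ψ p₀| |ψ p|)
  replace hqt : |ψ q| = t := hqt
  have h2 : |ψ q| ≤ 1 := by rw [hqt]; exact min_le_right _ _
  have h3 := abs_arg_le (w := Complex.exp (ψ q * Complex.I)) (Complex.norm_exp_ofReal_mul_I _)
  have h4 := abs_le.1 h2
  have hpi := Real.pi_gt_three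
  rw [Complex.arg_exp_mul_I, toIocMod_eq_self (by positivity) |>.2
    ⟨by linarith, by linarith⟩, hqt] at h3
  linarith [h q hq]

theorem norm_le_of_lintegral_deriv_le {f f' : ℝ → ℂ} {c₀ ε : ℝ} (hε : 0 ≤ ε)
    (hf : ∀ c ∈ Ioc 0 c₀, HasDerivAt f (f' c) c) (hf' : ContinuousOn f' (Ioc 0 c₀))
    (h0 : Tendsto f (𝓝[>] 0) (𝓝 0)) (hint : ∫⁻ c in Ioc 0 c₀, ‖f' c‖ₑ ≤ ENNReal.ofReal ε)
    {c : ℝ} (hc : c ∈ Ioc 0 c₀) : ‖f c‖ ≤ ε := by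
  have hT : Tendsto (fun c' => ‖f c - f c'‖) (𝓝[>] 0) (𝓝 ‖f c - 0‖) :=
    (tendsto_const_nhds.sub h0).norm
  rw [sub_zero] at hT
  refine le_of_tendsto hT ?_
  filter_upwards [Ioo_mem_nhdsGT hc.1] with c' hc'
  have hsub : Icc c' c ⊆ Ioc 0 c₀ := fun y hy => ⟨hc'.1.trans_le hy.1, hy.2.trans hc.2⟩
  have hu : uIcc c' c = Icc c' c := uIcc_of_le hc'.2.le
  rw [← intervalIntegral.integral_eq_sub_of_hasDerivAt
    (fun y hy => hf y (hsub (hu ▸ hy))) ((hf'.mono (hu ▸ hsub)).intervalIntegrable),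
    intervalIntegral.integral_of_le hc'.2.le]
  have h1 := (enorm_integral_le_lintegral_enorm (μ := volume.restrict (Ioc c' c)) f').trans
    ((lintegral_mono_set (Ioc_subset_Icc_self.trans hsub)).trans hint)
  rwa [← ofReal_norm, ENNReal.ofReal_le_ofReal_iff hε] at h1

section

variable {ι : Type*} {l : Filter ι} {Ω K₀ : Set ℂ} {u H : ι → ℂ → ℂ} {u₀ H₀ : ℂ → ℂ}

/-- On almost every transversal of a collar, maps with a common boundary datum that are close in
`W^{1,1}` are uniformly close. -/
theorem exists_transversal {O : Set ℂ} (hO : IsOpen O) {z₀ e : ℂ} {he : e ≠ 0} (he1 : ‖e‖ = 1)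
    {γ : ℝ → ℝ} {hγ : Continuous γ} {c₀ a₀ b₀ : ℝ}
    (hmem : ∀ a ∈ Ioo a₀ b₀, ∀ c ∈ Ioc 0 c₀, collar z₀ e he γ hγ (a, c) ∈ O)
    {v v' : ℂ → ℂ} (hv : ContDiffOn ℝ 1 v O) (hv' : ContDiffOn ℝ 1 v' O)
    (h0 : ∀ a ∈ Ioo a₀ b₀,
      Tendsto (fun z => v z - v' z) (𝓝[O] (collar z₀ e he γ hγ (a, 0))) (𝓝 0))
    {ε : ℝ} (hε : 0 < ε)
    (h1 : ∫⁻ z in O, ‖fderiv ℝ v z - fderiv ℝ v' z‖ₑ <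
      ENNReal.ofReal ε * ENNReal.ofReal (b₀ - a₀)) :
    ∃ a ∈ Ioo a₀ b₀, ∀ c ∈ Ioc 0 c₀,
      ‖v (collar z₀ e he γ hγ (a, c)) - v' (collar z₀ e he γ hγ (a, c))‖ ≤ ε := by
  set χ := collar z₀ e he γ hγ with hχ
  set G : ℂ → ℂ →L[ℝ] ℂ := fun z => fderiv ℝ v z - fderiv ℝ v' z with hG
  have hGm : Measurable fun z => ‖G z‖ₑ :=
    ((measurable_fderiv ℝ v).sub (measurable_fderiv ℝ v')).enorm
  -- Chebyshev: if every transversal carried more than `ε`, integrating over `a` would contradict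
  -- `h1`. On the transversal found, the difference is integrated from its limit `0` at the
  -- boundary.
  obtain ⟨a, ha, hal⟩ : ∃ a ∈ Ioo a₀ b₀, ∫⁻ c in Ioc 0 c₀, ‖G (χ (a, c))‖ₑ ≤ ENNReal.ofReal ε := by
    by_contra! hlt
    refine h1.not_ge ?_
    calc ENNReal.ofReal ε * ENNReal.ofReal (b₀ - a₀)
        = ∫⁻ _ in Ioo a₀ b₀, ENNReal.ofReal ε := by rw [setLIntegral_const, Real.volume_Ioo]
      _ ≤ ∫⁻ a in Ioo a₀ b₀, ∫⁻ c, O.indicator (fun z => ‖G z‖ₑ) (χ (a, c)) := by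
          refine lintegral_mono_ae ((ae_restrict_iff' measurableSet_Ioo).2 (ae_of_all _ ?_))
          intro a ha
          refine (hlt a ha).le.trans ?_
          refine le_trans (le_of_eq ?_) (setLIntegral_le_lintegral (Ioc 0 c₀) _)
          refine setLIntegral_congr_fun measurableSet_Ioc fun c hc => ?_
          exact (indicator_of_mem (hmem a ha c hc) (fun z => ‖G z‖ₑ)).symm
      _ ≤ ∫⁻ a, ∫⁻ c, O.indicator (fun z => ‖G z‖ₑ) (χ (a, c)) := setLIntegral_le_lintegral _ _
      _ = ∫⁻ z in O, ‖G z‖ₑ := by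
          rw [lintegral_collar he1 he hγ (hGm.indicator hO.measurableSet),
            lintegral_indicator hO.measurableSet]
  refine ⟨a, ha, fun c hc => ?_⟩
  have hcont : Continuous fun c : ℝ => χ (a, c) :=
    χ.continuous.comp (continuous_const.prodMk continuous_id)
  refine norm_le_of_lintegral_deriv_le (f := fun c => v (χ (a, c)) - v' (χ (a, c)))
    (f' := fun c => G (χ (a, c)) (-e)) hε.le ?_ ?_ ?_ ?_ hc
  · intro c hc
    have hz := hmem a ha c hc
    have d1 := ((hv.contDiffAt (hO.mem_nhds hz)).differentiableAt (by norm_num)).hasFDerivAt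
    have d2 := ((hv'.contDiffAt (hO.mem_nhds hz)).differentiableAt (by norm_num)).hasFDerivAt
    have d3 := hasDerivAt_collar z₀ e he γ hγ a c
    exact (d1.comp_hasDerivAt c d3).sub (d2.comp_hasDerivAt c d3)
  · have hc1 := hv.continuousOn_fderiv_of_isOpen hO (by norm_num)
    have hc2 := hv'.continuousOn_fderiv_of_isOpen hO (by norm_num)
    exact ((hc1.sub hc2).comp hcont.continuousOn fun c hc => hmem a ha c hc).clm_apply
      continuousOn_const
  · refine (h0 a ha).comp (tendsto_nhdsWithin_iff.2 ⟨hcont.continuousAt.tendsto.mono_left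
      nhdsWithin_le_nhds, ?_⟩)
    filter_upwards [Ioc_mem_nhdsGT (hc.1.trans_le hc.2)] with c hc using hmem a ha c hc
  · refine (lintegral_mono fun c => ?_).trans hal
    rw [← ofReal_norm, ← ofReal_norm]
    refine ENNReal.ofReal_le_ofReal ?_
    simpa [he1] using (G (χ (a, c))).le_opNorm (-e)

theorem exp_im_mul_I_eq_of_norm_eq_one {f w : ℂ} (h : Complex.exp f = w) (hw : ‖w‖ = 1) :
    Complex.exp (f.im * Complex.I) = w := by
  have h1 : f.re = 0 := by
    rw [← h, Complex.norm_exp, Real.exp_eq_one_iff] at hw; exact hw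
  rw [← h]
  congr 1
  apply Complex.ext <;> simp [h1]

/-- A circle-valued map with a holomorphic current that is close to `1` on the boundary of a
curvilinear rectangle is close to `1` inside. -/
theorem norm_sub_one_le_of_rectangle {A : Set (ℝ × ℝ)} (hA : IsOpen A) (hAc : Convex ℝ A)
    (χ : ℝ × ℝ ≃ₜ ℂ) {w J : ℂ → ℂ} (hw : IsCurrent (χ '' A) w J) {a₁ a₂ c₁ c₂ : ℝ} (ha : a₁ ≤ a₂)
    (hc : c₁ ≤ c₂) (hR : Icc a₁ a₂ ×ˢ Icc c₁ c₂ ⊆ A) {ε : ℝ} (hε0 : 0 < ε) (hε : 2 * ε < 1)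
    (hbot : ∀ a ∈ Icc a₁ a₂, ‖w (χ (a, c₂)) - 1‖ ≤ ε)
    (htop : ∀ a ∈ Icc a₁ a₂, ‖w (χ (a, c₁)) - 1‖ ≤ ε)
    (hleft : ∀ c ∈ Icc c₁ c₂, ‖w (χ (a₁, c)) - 1‖ ≤ ε)
    (hright : ∀ c ∈ Icc c₁ c₂, ‖w (χ (a₂, c)) - 1‖ ≤ ε)
    {p : ℝ × ℝ} (hp : p ∈ Icc a₁ a₂ ×ˢ Icc c₁ c₂) : ‖w (χ p) - 1‖ ≤ 3 * ε := by
  have hχA : IsOpen (χ '' A) := χ.isOpenMap _ hA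
  have hq : (a₁, c₂) ∈ Icc a₁ a₂ ×ˢ Icc c₁ c₂ := ⟨left_mem_Icc.2 ha, right_mem_Icc.2 hc⟩
  have hsc : IsSimplyConnected (χ '' A) := by
    rw [Homeomorph.isSimplyConnected_image]
    have : ContractibleSpace A := hAc.contractibleSpace ⟨_, hR hq⟩
    exact SimplyConnectedSpace.ofContractible A
  obtain ⟨f, hfc, hf⟩ := Complex.exists_continuousOn_eqOn_exp_comp hsc hχA hw.continuousOn
    (by rintro ⟨z, hz, h0⟩; exact hw.ne_zero hz h0)
  have hfe : ∀ z ∈ χ '' A, Complex.exp ((f z).im * Complex.I) = w z := fun z hz =>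
    exp_im_mul_I_eq_of_norm_eq_one (hf hz) (hw.norm_eq_one z hz)
  set z₁ := χ (a₁, c₂) with hz₁
  have hz₁A : z₁ ∈ χ '' A := mem_image_of_mem _ (hR hq)
  -- The lift is normalised to be the principal argument at a corner, where it is small; smallness
  -- is then propagated along the four sides, each side starting at a corner already treated.
  set ψ : ℂ → ℝ := fun z => (f z).im - ((f z₁).im - Complex.arg (w z₁)) with hψ
  have hψc : ContinuousOn ψ (χ '' A) :=
    (Complex.continuous_im.comp_continuousOn hfc).sub continuousOn_const
  have hψe : ∀ z ∈ χ '' A, Complex.exp (ψ z * Complex.I) = w z := by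
    intro z hz
    have e1 : (ψ z : ℂ) * Complex.I = (f z).im * Complex.I -
        ((f z₁).im * Complex.I - Complex.arg (w z₁) * Complex.I) := by
      rw [hψ]; push_cast; ring
    have e2 : Complex.exp (Complex.arg (w z₁) * Complex.I) = w z₁ := by
      have := Complex.norm_mul_exp_arg_mul_I (w z₁)
      rwa [hw.norm_eq_one _ hz₁A, Complex.ofReal_one, one_mul] at this
    rw [e1, Complex.exp_sub, Complex.exp_sub, hfe z hz, hfe z₁ hz₁A, e2,
      div_self (hw.ne_zero hz₁A), div_one]
  have hψd : ∀ z ∈ χ '' A, HasFDerivAt ψ (curForm (J z)) z := fun z hz =>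
    hasFDerivAt_of_exp_eq (hw.hasFDerivAt z hz) (hψc.continuousAt (hχA.mem_nhds hz))
      (by filter_upwards [hχA.mem_nhds hz] with y hy using hψe y hy)
  have key : ∀ S ⊆ Icc a₁ a₂ ×ˢ Icc c₁ c₂, Convex ℝ S → (∀ q ∈ S, ‖w (χ q) - 1‖ ≤ ε) →
      ∀ q₀ ∈ S, |ψ (χ q₀)| ≤ 2 * ε → ∀ q ∈ S, |ψ (χ q)| ≤ 2 * ε := by
    intro S hS hSc hSw q₀ hq₀ h₀ q hq
    have hSA : ∀ q ∈ S, χ q ∈ χ '' A := fun q hq => mem_image_of_mem _ (hR (hS hq))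
    exact abs_le_of_isPreconnected (ψ := fun q => ψ (χ q)) hSc.isPreconnected
      (hψc.comp χ.continuous.continuousOn hSA) hε
      (fun q hq => by rw [hψe _ (hSA q hq)]; exact hSw q hq) hq₀ h₀ hq
  have hstart : |ψ z₁| ≤ 2 * ε := by
    have : ψ z₁ = Complex.arg (w z₁) := by rw [hψ]; ring
    rw [this]
    refine (abs_arg_le (hw.norm_eq_one _ hz₁A)).trans ?_
    have := hbot a₁ (left_mem_Icc.2 ha)
    linarith
  have sbot : ∀ q ∈ Icc a₁ a₂ ×ˢ {c₂}, |ψ (χ q)| ≤ 2 * ε :=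
    key _ (prod_mono_right (singleton_subset_iff.2 (right_mem_Icc.2 hc)))
      ((convex_Icc _ _).prod (convex_singleton _))
      (by rintro ⟨a, c⟩ ⟨h1, rfl⟩; exact hbot a h1) (a₁, c₂) ⟨left_mem_Icc.2 ha, rfl⟩ hstart
  have sleft : ∀ q ∈ {a₁} ×ˢ Icc c₁ c₂, |ψ (χ q)| ≤ 2 * ε :=
    key _ (prod_mono_left (singleton_subset_iff.2 (left_mem_Icc.2 ha)))
      ((convex_singleton _).prod (convex_Icc _ _))
      (by rintro ⟨a, c⟩ ⟨rfl, h1⟩; exact hleft c h1) (a₁, c₂) ⟨rfl, right_mem_Icc.2 hc⟩ hstart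
  have sright : ∀ q ∈ {a₂} ×ˢ Icc c₁ c₂, |ψ (χ q)| ≤ 2 * ε :=
    key _ (prod_mono_left (singleton_subset_iff.2 (right_mem_Icc.2 ha)))
      ((convex_singleton _).prod (convex_Icc _ _))
      (by rintro ⟨a, c⟩ ⟨rfl, h1⟩; exact hright c h1) (a₂, c₂) ⟨rfl, right_mem_Icc.2 hc⟩
      (sbot _ ⟨right_mem_Icc.2 ha, rfl⟩)
  have stop' : ∀ q ∈ Icc a₁ a₂ ×ˢ {c₁}, |ψ (χ q)| ≤ 2 * ε :=
    key _ (prod_mono_right (singleton_subset_iff.2 (left_mem_Icc.2 hc)))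
      ((convex_Icc _ _).prod (convex_singleton _))
      (by rintro ⟨a, c⟩ ⟨h1, rfl⟩; exact htop a h1) (a₁, c₁) ⟨left_mem_Icc.2 ha, rfl⟩
      (sleft _ ⟨rfl, left_mem_Icc.2 hc⟩)
  have hfr : ∀ z ∈ frontier (χ '' (Icc a₁ a₂ ×ˢ Icc c₁ c₂)), |ψ z| < 3 * ε := by
    intro z hz
    rw [← χ.image_frontier, frontier_prod_eq, closure_Icc, closure_Icc, frontier_Icc ha,
      frontier_Icc hc] at hz
    obtain ⟨⟨a, c⟩, hq, rfl⟩ := hz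
    refine lt_of_le_of_lt ?_ (by linarith : 2 * ε < 3 * ε)
    rcases hq with ⟨h1, rfl | h2⟩ | ⟨rfl | h1, h2⟩
    · exact stop' _ ⟨h1, rfl⟩
    · exact sbot _ ⟨h1, h2⟩
    · exact sleft _ ⟨rfl, h2⟩
    · exact sright _ ⟨h1, h2⟩
  have hpA : χ p ∈ χ '' A := mem_image_of_mem _ (hR hp)
  have := abs_le_of_frontier hχA ((isCompact_Icc.prod isCompact_Icc).image χ.continuous)
    (image_mono hR) hw.differentiableOn hψd (by positivity) hfr (mem_image_of_mem χ hp)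
  rw [← hψe _ hpA]
  exact (norm_exp_sub_one_le _).trans this

/-- A curvilinear rectangle is built in the collar: its inner side lies in a compact subset where
the maps converge uniformly, its outer side is so near the boundary that the common datum makes the
maps close, and its lateral sides are good transversals. `norm_sub_one_le_of_rectangle` applied to
the quotient of the maps controls the inside. -/
theorem exists_nhds_eventually_norm_sub_le (hΩ : IsSmoothBoundedDomain Ω) (hK₀ : IsCompact K₀)
    (hK₀Ω : K₀ ⊆ Ω) (hu₀ : IsCurrent (Ω \ K₀) u₀ H₀)
    (hu : ∀ᶠ i in l, IsCurrent (Ω \ K₀) (u i) (H i))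
    (hb : ∀ᶠ i in l, ∀ y ∈ frontier Ω, Tendsto (fun z => u i z - u₀ z) (𝓝[Ω] y) (𝓝 0))
    (h0 : Tendsto (fun i => ∫⁻ z in Ω \ K₀, ‖u i z - u₀ z‖ₑ) l (𝓝 0))
    (h1 : Tendsto (fun i => ∫⁻ z in Ω \ K₀, ‖fderiv ℝ (u i) z - fderiv ℝ u₀ z‖ₑ) l (𝓝 0))
    {z₀ : ℂ} (hz₀ : z₀ ∈ frontier Ω) :
    ∃ W ∈ 𝓝 z₀, ∀ ε > 0, ∀ᶠ i in l, ∀ z ∈ W ∩ Ω, ‖u i z - u₀ z‖ ≤ ε := by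
  have hO : IsOpen (Ω \ K₀) := hΩ.isOpen.sdiff hK₀.isClosed
  have hz₀Ω : ∀ z ∈ frontier Ω, z ∉ Ω := fun z hz => by
    rw [hΩ.isOpen.frontier_eq] at hz; exact hz.2
  obtain ⟨e, he, γ, hγ, α, c₀, he1, hα, hc₀, hmem, hfr, W, hW, hWχ⟩ :=
    hΩ.smoothBoundary.exists_collar hΩ.isOpen hz₀
      (hK₀.isClosed.isOpen_compl.mem_nhds fun h => hz₀Ω _ hz₀ (hK₀Ω h))
  set χ := collar z₀ e he γ hγ with hχ
  have hmemO : ∀ a ∈ Icc (-α) α, ∀ c ∈ Ioc 0 c₀, χ (a, c) ∈ Ω \ K₀ := hmem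
  refine ⟨W, hW, fun ε hε => ?_⟩
  -- The rectangle lemma loses a factor `3` and requires `2 ε₁ < 1`.
  set ε₁ := min (ε / 4) (1 / 8) with hε₁
  have hε₁0 : 0 < ε₁ := by positivity
  have hε₁ε : 3 * ε₁ ≤ ε := by have := min_le_left (ε / 4) (1 / 8); linarith
  have hε₁1 : 2 * ε₁ < 1 := by have := min_le_right (ε / 4) (1 / 8); linarith
  have hKb : IsCompact (χ '' (Icc (-α) α ×ˢ Icc (c₀ / 2) c₀)) :=
    (isCompact_Icc.prod isCompact_Icc).image χ.continuous
  have hKbO : χ '' (Icc (-α) α ×ˢ Icc (c₀ / 2) c₀) ⊆ Ω \ K₀ := by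
    rintro _ ⟨⟨a, c⟩, ⟨ha, hc⟩, rfl⟩
    exact hmemO a ha c ⟨by linarith [hc.1], hc.2⟩
  have hunif := Metric.tendstoUniformlyOn_iff.1
    (tendstoUniformlyOn_map hO hu₀ hu h0 h1 hKb hKbO) ε₁ hε₁0
  have hpos : 0 < ENNReal.ofReal ε₁ * ENNReal.ofReal (α / 2) := by
    simp [hε₁0, hα]
  filter_upwards [hunif, hu, hb, h1.eventually (gt_mem_nhds hpos)] with i hi1 hi hib hi2
  have hbot : ∀ a ∈ Icc (-α) α, ∀ c ∈ Icc (c₀ / 2) c₀, ‖u i (χ (a, c)) - u₀ (χ (a, c))‖ ≤ ε₁ := by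
    intro a ha c hc
    have := hi1 _ (mem_image_of_mem χ (⟨ha, hc⟩ : (a, c) ∈ Icc (-α) α ×ˢ Icc (c₀ / 2) c₀))
    rw [dist_comm, dist_eq_norm] at this
    exact this.le
  -- The depth `c₁` depends on `i`, since the boundary values are attained at a rate that is not
  -- uniform in `i`. This is harmless: the bound from the rectangle lemma does not involve its
  -- dimensions.
  obtain ⟨c₁, hc₁, hc₁', htop⟩ : ∃ c₁, 0 < c₁ ∧ c₁ < c₀ / 2 ∧ ∀ a ∈ Icc (-α) α, ∀ c ∈ Ioc 0 c₁,
      ‖u i (χ (a, c)) - u₀ (χ (a, c))‖ ≤ ε₁ := by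
    obtain ⟨K, hK, hKΩ, hKP⟩ := exists_compact_of_eventually_nhdsWithin_frontier hΩ.isOpen
      hΩ.isBounded (P := fun z => ‖u i z - u₀ z‖ ≤ ε₁) (fun y hy => by
        have := (hib y hy).norm
        rw [norm_zero] at this
        filter_upwards [this.eventually (gt_mem_nhds hε₁0)] with z hz using hz.le)
    obtain ⟨s, t, -, ht, hs, h0t, hst⟩ := generalized_tube_lemma (isCompact_Icc (a := -α) (b := α))
      (isCompact_singleton (x := (0 : ℝ))) (hK.isClosed.isOpen_compl.preimage χ.continuous)
      (by rintro ⟨a, c⟩ ⟨ha, rfl⟩ hK'; exact hz₀Ω _ (hfr a ha) (hKΩ hK'))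
    obtain ⟨η, hη, hηt⟩ := Metric.mem_nhds_iff.1 (ht.mem_nhds (h0t rfl))
    have hm : 0 < min η (c₀ / 2) := lt_min hη (by positivity)
    refine ⟨min η (c₀ / 2) / 2, by positivity, ?_, fun a ha c hc => ?_⟩
    · have := min_le_right η (c₀ / 2); linarith
    · have h1 := min_le_left η (c₀ / 2)
      have h2 := min_le_right η (c₀ / 2)
      refine hKP _ (hmem a ha c ⟨hc.1, by linarith [hc.2]⟩).1 (hst ⟨hs ha, hηt ?_⟩)
      rw [Metric.mem_ball, dist_zero_right, Real.norm_eq_abs, abs_of_pos hc.1]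
      linarith [hc.2]
  have htr : ∀ a₀ b₀, b₀ - a₀ = α / 2 → Ioo a₀ b₀ ⊆ Icc (-α) α → ∃ a ∈ Ioo a₀ b₀, ∀ c ∈ Ioc 0 c₀,
      ‖u i (χ (a, c)) - u₀ (χ (a, c))‖ ≤ ε₁ := by
    intro a₀ b₀ hab hsub
    refine exists_transversal hO he1 (fun a ha c hc => hmemO a (hsub ha) c hc) (hi.contDiffOn hO)
      (hu₀.contDiffOn hO) (fun a ha => ?_) hε₁0 (by rwa [hab])
    exact (hib _ (hfr a (hsub ha))).mono_left (nhdsWithin_mono _ sdiff_subset)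
  -- One transversal is taken in each outer quarter of the collar, so that the rectangle between
  -- them covers the middle half, where `W` lies.
  obtain ⟨a₁, ha₁, hleft⟩ := htr (-α) (-(α / 2)) (by ring)
    fun a ha => ⟨ha.1.le, by linarith [ha.2]⟩
  obtain ⟨a₂, ha₂, hright⟩ := htr (α / 2) α (by ring) fun a ha => ⟨by linarith [ha.1], ha.2.le⟩
  have hw : ∀ z ∈ Ω \ K₀, ‖u i z - u₀ z‖ = ‖u i z / u₀ z - 1‖ := fun z hz => by
    rw [div_sub_one (hu₀.ne_zero hz), norm_div, hu₀.norm_eq_one z hz, div_one]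
  rintro z ⟨hzW, hzΩ⟩
  obtain ⟨a, ha, c, hc, rfl⟩ := hWχ z ⟨hzW, hzΩ⟩
  have ha' : a ∈ Icc (-α) α := ⟨by linarith [ha.1], by linarith [ha.2]⟩
  rcases le_or_gt c c₁ with hcc | hcc
  · exact (htop a ha' c ⟨hc.1, hcc⟩).trans (by linarith)
  rcases le_or_gt (c₀ / 2) c with hcc' | hcc'
  · exact (hbot a ha' c ⟨hcc', hc.2.le⟩).trans (by linarith)
  have hAO : χ '' (Ioo (-α) α ×ˢ Ioo 0 c₀) ⊆ Ω \ K₀ := by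
    rintro _ ⟨⟨a, c⟩, ⟨ha, hc⟩, rfl⟩
    exact hmemO a ⟨ha.1.le, ha.2.le⟩ c ⟨hc.1, hc.2.le⟩
  have hIcc : Icc a₁ a₂ ⊆ Icc (-α) α := Icc_subset_Icc ha₁.1.le ha₂.2.le
  have h12 : a₁ ≤ a₂ := by linarith [ha₁.2, ha₂.1]
  rw [hw _ (hmemO a ha' c ⟨hc.1, hc.2.le⟩)]
  refine le_trans ?_ hε₁ε
  refine norm_sub_one_le_of_rectangle (isOpen_Ioo.prod isOpen_Ioo)
    ((convex_Ioo _ _).prod (convex_Ioo _ _)) χ ((hi.div hu₀).mono hAO) h12 hc₁'.le ?_ hε₁0 hε₁1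
    ?_ ?_ ?_ ?_ (p := (a, c)) ⟨⟨by linarith [ha₁.2, ha.1], by linarith [ha₂.1, ha.2]⟩, hcc.le,
      hcc'.le⟩
  · rintro ⟨a, c⟩ ⟨ha, hc⟩
    exact ⟨⟨ha₁.1.trans_le ha.1, ha.2.trans_lt ha₂.2⟩, hc₁.trans_le hc.1,
      hc.2.trans_lt (by linarith)⟩
  · intro a ha
    rw [← hw _ (hmemO a (hIcc ha) _ ⟨by positivity, by linarith⟩)]
    exact hbot a (hIcc ha) _ ⟨le_rfl, by linarith⟩
  · intro a ha
    rw [← hw _ (hmemO a (hIcc ha) _ ⟨hc₁, by linarith⟩)]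
    exact htop a (hIcc ha) _ ⟨hc₁, le_rfl⟩
  · intro c hc
    have hc' : c ∈ Ioc 0 c₀ := ⟨hc₁.trans_le hc.1, by linarith [hc.2]⟩
    rw [← hw _ (hmemO a₁ (hIcc (left_mem_Icc.2 h12)) _ hc')]
    exact hleft c hc'
  · intro c hc
    have hc' : c ∈ Ioc 0 c₀ := ⟨hc₁.trans_le hc.1, by linarith [hc.2]⟩
    rw [← hw _ (hmemO a₂ (hIcc (right_mem_Icc.2 h12)) _ hc')]
    exact hright c hc'

/-- Circle-valued maps with holomorphic currents and the same boundary datum that converge in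
`W^{1,1}` converge uniformly up to the boundary. -/
theorem tendstoUniformlyOn_of_boundary (hΩ : IsSmoothBoundedDomain Ω) (hK₀ : IsCompact K₀)
    (hK₀Ω : K₀ ⊆ Ω) (hu₀ : IsCurrent (Ω \ K₀) u₀ H₀)
    (hu : ∀ᶠ i in l, IsCurrent (Ω \ K₀) (u i) (H i))
    (hb : ∀ᶠ i in l, ∀ y ∈ frontier Ω, Tendsto (fun z => u i z - u₀ z) (𝓝[Ω] y) (𝓝 0))
    (h0 : Tendsto (fun i => ∫⁻ z in Ω \ K₀, ‖u i z - u₀ z‖ₑ) l (𝓝 0))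
    (h1 : Tendsto (fun i => ∫⁻ z in Ω \ K₀, ‖fderiv ℝ (u i) z - fderiv ℝ u₀ z‖ₑ) l (𝓝 0))
    {V : Set ℂ} (hV : IsOpen V) (hKV : K₀ ⊆ V) : TendstoUniformlyOn u u₀ l (Ω \ V) := by
  have hO : IsOpen (Ω \ K₀) := hΩ.isOpen.sdiff hK₀.isClosed
  have hfrc : IsCompact (frontier Ω) :=
    hΩ.isBounded.isCompact_closure.of_isClosed_subset isClosed_frontier frontier_subset_closure
  rw [Metric.tendstoUniformlyOn_iff]
  intro ε hε
  have hcov : ∀ y ∈ frontier Ω, ∃ W ∈ 𝓝 y, ∀ᶠ i in l, ∀ z ∈ W ∩ Ω, ‖u i z - u₀ z‖ ≤ ε / 2 :=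
    fun y hy => by
      obtain ⟨W, hW, h⟩ :=
        exists_nhds_eventually_norm_sub_le hΩ hK₀ hK₀Ω hu₀ hu hb h0 h1 hy
      exact ⟨W, hW, h _ (by positivity)⟩
  obtain ⟨W, hW, hWe⟩ : ∃ W, IsOpen W ∧ frontier Ω ⊆ W ∧
      ∀ᶠ i in l, ∀ z ∈ W ∩ Ω, ‖u i z - u₀ z‖ ≤ ε / 2 := by
    choose! W hW h using hcov
    obtain ⟨t, htf, hts⟩ := hfrc.elim_nhds_subcover (fun y => interior (W y))
      fun y hy => interior_mem_nhds.2 (hW y hy)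
    refine ⟨⋃ y ∈ t, interior (W y), isOpen_biUnion fun _ _ => isOpen_interior, hts, ?_⟩
    have := (eventually_all_finset t).2 fun y hy => h y (htf y hy)
    filter_upwards [this] with i hi z hz
    obtain ⟨y, hy, hzy⟩ := mem_iUnion₂.1 hz.1
    exact hi y hy z ⟨interior_subset hzy, hz.2⟩
  have hK : IsCompact ((closure Ω \ W) \ V) := (hΩ.isBounded.isCompact_closure.diff hW).diff hV
  have hKO : (closure Ω \ W) \ V ⊆ Ω \ K₀ := by
    rintro z ⟨⟨hz1, hz2⟩, hz3⟩
    refine ⟨by_contra fun h => hz2 (hWe.1 ?_), fun h => hz3 (hKV h)⟩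
    rw [hΩ.isOpen.frontier_eq]; exact ⟨hz1, h⟩
  filter_upwards [hWe.2, Metric.tendstoUniformlyOn_iff.1
    (tendstoUniformlyOn_map hO hu₀ hu h0 h1 hK hKO) ε hε] with i hi1 hi2 z hz
  by_cases hzW : z ∈ W
  · rw [dist_comm, dist_eq_norm]
    exact (hi1 z ⟨hzW, hz.1⟩).trans_lt (by linarith)
  · exact hi2 z ⟨⟨subset_closure hz.1, hzW⟩, hz.2⟩

end

/-! ### The domain variation -/

/-- The complex number representing a real linear form through `curForm`. -/
noncomputable def ofForm (L : ℂ →L[ℝ] ℝ) : ℂ := L 1 - L Complex.I * Complex.I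

theorem curForm_ofForm (L : ℂ →L[ℝ] ℝ) : curForm (ofForm L) = L := by
  ext ξ
  have h : ξ = ξ.re • (1 : ℂ) + ξ.im • Complex.I := by
    simp [Complex.re_add_im]
  conv_rhs => rw [h, map_add, map_smul, map_smul]
  simp [ofForm]
  ring

theorem ofForm_curForm (H : ℂ) : ofForm (curForm H) = H := by
  apply Complex.ext <;> simp [ofForm]

theorem continuous_ofForm : Continuous ofForm := by
  unfold ofForm; fun_prop

/-- The contraction of the stress-energy tensor of a current with a matrix. -/
noncomputable def stressDot (H : ℂ) (A : ℂ →L[ℝ] ℂ) : ℝ :=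
  (H ^ 2 * (A 1 + Complex.I * A Complex.I)).re

theorem det_eq (A : ℂ →L[ℝ] ℂ) :
    A.det = (A 1).re * (A Complex.I).im - (A Complex.I).re * (A 1).im := by
  rw [ContinuousLinearMap.det, ← LinearMap.det_toMatrix Complex.basisOneI, Matrix.det_fin_two]
  simp [LinearMap.toMatrix_apply]

theorem abs_stressDot_sub_le (H K : ℂ) (A : ℂ →L[ℝ] ℂ) :
    |stressDot H A - stressDot K A| ≤ 2 * ‖H - K‖ * (‖H‖ + ‖K‖) * ‖A‖ := by
  have h1 : stressDot H A - stressDot K A =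
      ((H - K) * (H + K) * (A 1 + Complex.I * A Complex.I)).re := by
    rw [stressDot, stressDot, ← Complex.sub_re]; ring_nf
  rw [h1]
  refine (Complex.abs_re_le_norm _).trans ?_
  rw [norm_mul, norm_mul]
  have e1 : ‖A 1‖ ≤ ‖A‖ := by simpa using A.le_opNorm 1
  have e2 : ‖A Complex.I‖ ≤ ‖A‖ := by simpa using A.le_opNorm Complex.I
  have e3 : ‖A 1 + Complex.I * A Complex.I‖ ≤ ‖A‖ + ‖A‖ := by
    refine (norm_add_le _ _).trans ?_
    rw [norm_mul, Complex.norm_I, one_mul]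
    exact add_le_add e1 e2
  calc ‖H - K‖ * ‖H + K‖ * ‖A 1 + Complex.I * A Complex.I‖
      ≤ ‖H - K‖ * (‖H‖ + ‖K‖) * (‖A‖ + ‖A‖) := by gcongr; exact norm_add_le _ _
    _ = _ := by ring

/-- The pointwise content of the energy comparison. Here `p` is the current at the moved point and
`J` the current of the other map. Changing variables by `id + A` turns the density `‖p‖²` into that
of the pulled-back form, minus the stress term and an error quadratic in `A`; convexity then
linearises the pulled-back density around `J`. -/
theorem le_abs_det_mul_norm_sq (J p : ℂ) (A : ℂ →L[ℝ] ℂ) :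
    ‖J‖ ^ 2 + 2 * curDot J (curForm
      (ofForm ((curForm p).comp (ContinuousLinearMap.id ℝ ℂ + A)) - J)) -
      (stressDot p A + 4 * ‖A‖ ^ 2 * ‖p‖ ^ 2) ≤
      |(ContinuousLinearMap.id ℝ ℂ + A).det| * ‖p‖ ^ 2 := by
  set Q := ofForm ((curForm p).comp (ContinuousLinearMap.id ℝ ℂ + A)) with hQ
  set B := ofForm ((curForm p).comp A) with hB
  have e1 : ‖A 1‖ ≤ ‖A‖ := by simpa using A.le_opNorm 1
  have e2 : ‖A Complex.I‖ ≤ ‖A‖ := by simpa using A.le_opNorm Complex.I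
  have nsq : ∀ w : ℂ, ‖w‖ ^ 2 = w.re * w.re + w.im * w.im := fun w => by
    rw [← Complex.normSq_eq_norm_sq, Complex.normSq_apply]
  have h1 : (ContinuousLinearMap.id ℝ ℂ + A).det * ‖p‖ ^ 2 =
      ‖Q‖ ^ 2 - stressDot p A + A.det * ‖p‖ ^ 2 - ‖B‖ ^ 2 := by
    rw [det_eq, det_eq, nsq, nsq, nsq, hQ, hB, stressDot]
    simp [ofForm, sq]
    ring
  -- The tangent-line inequality for the square. The dropped term `‖Q - J‖²` is nonnegative, so no
  -- estimate of `Q - J` is needed.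
  have h2 : ‖J‖ ^ 2 + 2 * curDot J (curForm (Q - J)) ≤ ‖Q‖ ^ 2 := by
    rw [nsq, nsq, curDot_curForm, Complex.sub_re, Complex.sub_im]
    nlinarith [sq_nonneg (Q.re - J.re), sq_nonneg (Q.im - J.im)]
  have h3 : ‖B‖ ^ 2 ≤ 2 * (‖A‖ ^ 2 * ‖p‖ ^ 2) := by
    have k1 : |((p * A 1).re)| ≤ ‖p‖ * ‖A‖ := (Complex.abs_re_le_norm _).trans (by
      rw [norm_mul]; gcongr)
    have k2 : |((p * A Complex.I).re)| ≤ ‖p‖ * ‖A‖ := (Complex.abs_re_le_norm _).trans (by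
      rw [norm_mul]; gcongr)
    have : ‖B‖ ^ 2 = (p * A 1).re ^ 2 + (p * A Complex.I).re ^ 2 := by
      rw [nsq, hB]; simp [ofForm]; ring
    rw [this]
    have k3 := sq_le_sq' (abs_le.1 k1).1 (abs_le.1 k1).2
    have k4 := sq_le_sq' (abs_le.1 k2).1 (abs_le.1 k2).2
    nlinarith
  have h4 : |A.det| ≤ 2 * ‖A‖ ^ 2 := by
    rw [det_eq]
    have k1 := (Complex.abs_re_le_norm (A 1)).trans e1
    have k2 := (Complex.abs_im_le_norm (A 1)).trans e1
    have k3 := (Complex.abs_re_le_norm (A Complex.I)).trans e2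
    have k4 := (Complex.abs_im_le_norm (A Complex.I)).trans e2
    calc _ ≤ |(A 1).re * (A Complex.I).im| + |(A Complex.I).re * (A 1).im| := abs_sub _ _
      _ = |(A 1).re| * |(A Complex.I).im| + |(A Complex.I).re| * |(A 1).im| := by
          rw [abs_mul, abs_mul]
      _ ≤ ‖A‖ * ‖A‖ + ‖A‖ * ‖A‖ := by gcongr
      _ = _ := by ring
  have h5 : -(2 * ‖A‖ ^ 2 * ‖p‖ ^ 2) ≤ A.det * ‖p‖ ^ 2 := by
    rw [← neg_mul]
    gcongr
    exact (abs_le.1 h4).1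
  have h6 : (ContinuousLinearMap.id ℝ ℂ + A).det * ‖p‖ ^ 2 ≤
      |(ContinuousLinearMap.id ℝ ℂ + A).det| * ‖p‖ ^ 2 := by
    gcongr; exact le_abs_self _
  linarith

/-- A function on a punctured domain with at most simple poles is integrable as soon as it is so
near the boundary. -/
theorem integrableOn_of_simple_poles {Ω K : Set ℂ} (hK : IsCompact K) (hKΩ : K ⊆ Ω) {n : ℕ}
    {x : Fin n → ℂ} {F : ℂ → ℝ} (hF : ContinuousOn F (Ω \ range x)) (hFK : IntegrableOn F (Ω \ K))
    (hΩ : IsOpen Ω)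
    (hx : ∀ j, ∃ C, ∀ᶠ z in 𝓝[≠] (x j), |F z| ≤ C * ‖z - x j‖⁻¹) : IntegrableOn F Ω := by
  have h1 : ∀ j, ∃ C, ∃ s > 0, ∀ z ∈ Metric.ball (x j) s \ {x j}, |F z| ≤ C * ‖z - x j‖⁻¹ := by
    intro j
    obtain ⟨C, hC⟩ := hx j
    obtain ⟨s, hs, h⟩ := Metric.mem_nhdsWithin_iff.1 hC
    exact ⟨C, s, hs, fun z hz => h ⟨hz.1, hz.2⟩⟩
  choose C s hs hC using h1
  have hKc : IsCompact (K \ ⋃ j, Metric.ball (x j) (s j)) :=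
    hK.diff (isOpen_iUnion fun _ => Metric.isOpen_ball)
  have hKs : K \ ⋃ j, Metric.ball (x j) (s j) ⊆ Ω \ range x := by
    rintro z ⟨hz, hz'⟩
    refine ⟨hKΩ hz, ?_⟩
    rintro ⟨j, rfl⟩
    exact hz' (mem_iUnion.2 ⟨j, Metric.mem_ball_self (hs j)⟩)
  have hcov : Ω ⊆ (Ω \ K) ∪ (K \ ⋃ j, Metric.ball (x j) (s j)) ∪
      ⋃ j, ((Ω \ range x) ∩ Metric.ball (x j) (s j) ∪ {x j}) := by
    intro z hz
    by_cases hzK : z ∈ K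
    · by_cases h : z ∈ ⋃ j, Metric.ball (x j) (s j)
      · right
        by_cases hzx : z ∈ range x
        · obtain ⟨j, rfl⟩ := hzx
          exact mem_iUnion.2 ⟨j, Or.inr rfl⟩
        · obtain ⟨j, hj⟩ := mem_iUnion.1 h
          exact mem_iUnion.2 ⟨j, Or.inl ⟨⟨hz, hzx⟩, hj⟩⟩
      · exact Or.inl (Or.inr ⟨hzK, h⟩)
    · exact Or.inl (Or.inl ⟨hz, hzK⟩)
  refine IntegrableOn.mono_set ((hFK.union ((hF.mono hKs).integrableOn_compact hKc)).union ?_) hcov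
  rw [integrableOn_finite_iUnion]
  intro j
  refine IntegrableOn.union ?_ (by simp [IntegrableOn, Measure.restrict_singleton])
  have hm : MeasurableSet ((Ω \ range x) ∩ Metric.ball (x j) (s j)) :=
    (isOpen_diff_range hΩ).measurableSet.inter measurableSet_ball
  refine Integrable.mono' ((integrableOn_inv_norm_sub
    (Metric.isBounded_ball.subset inter_subset_right) (x j)).const_mul (C j))
    ((hF.mono inter_subset_left).aestronglyMeasurable hm) ?_
  filter_upwards [ae_restrict_mem hm] with z hz
  exact hC j z ⟨hz.2, fun h => hz.1.2 ⟨j, h.symm⟩⟩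

section

variable {Ω S : Set ℂ} {n : ℕ} {x y : Fin n → ℂ} {v w H K X : ℂ → ℂ}

/-- Since `X` is `1/2`-Lipschitz, `id + X` shrinks distances by at most a factor `2`; in particular
it is injective. -/
theorem norm_sub_le_two_mul (hX : Differentiable ℝ X) (hX2 : ∀ z, ‖fderiv ℝ X z‖ ≤ 1 / 2)
    (z z' : ℂ) : ‖z - z'‖ ≤ 2 * ‖(z + X z) - (z' + X z')‖ := by
  have h1 := (convex_univ (𝕜 := ℝ) (E := ℂ)).norm_image_sub_le_of_norm_fderiv_le (f := X)
    (fun z _ => hX z) (fun z _ => hX2 z) (mem_univ z') (mem_univ z)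
  have h2 : z - z' = ((z + X z) - (z' + X z')) - (X z - X z') := by ring
  have h3 := norm_sub_le ((z + X z) - (z' + X z')) (X z - X z')
  rw [← h2] at h3
  linarith

/-- Comparison of the renormalised energies of two singular maps by an inner variation: the phase
difference is an admissible test function for the current of the first map. -/
theorem renormalised_energy_comparison (hΩ : IsOpen Ω) (hΩb : Bornology.IsBounded Ω)
    (hx : Function.Injective x) (hxΩ : ∀ j, x j ∈ Ω) (hv : IsCurrent (Ω \ range x) v H)
    (hw : IsCurrent (Ω \ range y) w K)
    (hres : ∀ j, ∃ C, ∀ᶠ z in 𝓝[≠] (x j), |(H z * (z - x j)).re| ≤ C * ‖z - x j‖)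
    (hpole : ∀ j, ∃ C, ∀ᶠ z in 𝓝[≠] (x j), ‖H z‖ ≤ C * ‖z - x j‖⁻¹)
    (hreg : ∀ j, ∃ C, ∀ᶠ z in 𝓝[≠] (x j), ‖K (z + (y j - x j)) - H z‖ ≤ C)
    (hHfin : ∃ C, IsCompact C ∧ C ⊆ Ω ∧ IntegrableOn (fun z => ‖H z‖ ^ 2) (Ω \ C))
    (hKfin : ∃ C, IsCompact C ∧ C ⊆ Ω ∧ IntegrableOn (fun z => ‖K z‖ ^ 2) (Ω \ C))
    (hX : ContDiff ℝ 1 X) (hX2 : ∀ z, ‖fderiv ℝ X z‖ ≤ 1 / 2) (hS : IsCompact S) (hSΩ : S ⊆ Ω)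
    (hXS : ∀ z ∉ S, X z = 0) (hXΩ : ∀ z ∈ Ω, z + X z ∈ Ω)
    {s : ℝ} (hs : 0 < s) (hXx : ∀ j, ∀ z ∈ Metric.ball (x j) s, X z = y j - x j)
    (hbd : ∀ p ∈ frontier Ω, Tendsto (fun z => w z / v z) (𝓝[Ω] p) (𝓝 1))
    (hclose : ∀ z ∈ Ω \ range x, ‖w (z + X z) / v z - 1‖ < 1)
    {m : ℂ → ℝ} (hm : IntegrableOn m Ω)
    (hmle : ∀ z ∈ Ω \ range x, stressDot (K (z + X z)) (fderiv ℝ X z) +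
      4 * ‖fderiv ℝ X z‖ ^ 2 * ‖K (z + X z)‖ ^ 2 ≤ m z)
    {c : ℝ → ℝ} {a b : ℝ}
    (ha : Tendsto (fun ρ => (∫ z in perforated Ω x ρ, ‖H z‖ ^ 2) - c ρ) (𝓝[>] 0) (𝓝 a))
    (hb : Tendsto (fun ρ => (∫ z in perforated Ω y ρ, ‖K z‖ ^ 2) - c ρ) (𝓝[>] 0) (𝓝 b)) :
    a - ∫ z in Ω, m z ≤ b := by
  have hXd : Differentiable ℝ X := hX.differentiable (by norm_num)
  have hX' : Continuous (fderiv ℝ X) := hX.continuous_fderiv (by norm_num)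
  have hT := isOpen_diff_range (x := x) hΩ
  set Φ : ℂ → ℂ := fun z => z + X z with hΦ
  have hΦd : ∀ z, HasFDerivAt Φ (ContinuousLinearMap.id ℝ ℂ + fderiv ℝ X z) z := fun z =>
    (hasFDerivAt_id z).add (hXd z).hasFDerivAt
  have hΦx : ∀ j, Φ (x j) = y j := fun j => by
    rw [hΦ]; simp only [hXx j _ (Metric.mem_ball_self hs)]; ring
  have hΦlow := norm_sub_le_two_mul hXd hX2
  have hΦinj : Function.Injective Φ := fun z z' h => by
    have := hΦlow z z'
    rw [show z + X z = z' + X z' from h, sub_self, norm_zero, mul_zero] at this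
    exact sub_eq_zero.1 (norm_le_zero_iff.1 this)
  have hΦT : ∀ z ∈ Ω \ range x, Φ z ∈ Ω \ range y := by
    rintro z ⟨hz, hzx⟩
    refine ⟨hXΩ z hz, ?_⟩
    rintro ⟨j, hj⟩
    rw [← hΦx j] at hj
    exact hzx ⟨j, hΦinj hj⟩
  -- On the disk of radius `s` the map is a translation and respects disks of radius `ρ`. Outside
  -- it, points stay at distance at least `s / 2` from `y j`, hence the restriction on `ρ`.
  have hperf : ∀ ρ ∈ Ioo 0 (s / 2), MapsTo Φ (perforated Ω x ρ) (perforated Ω y ρ) := by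
    rintro ρ hρ z ⟨hz, hzx⟩
    refine ⟨hXΩ z hz, fun h => ?_⟩
    obtain ⟨j, hj⟩ := mem_iUnion.1 h
    rw [Metric.mem_ball, dist_eq_norm] at hj
    by_cases hzj : z ∈ Metric.ball (x j) s
    · refine hzx (mem_iUnion.2 ⟨j, ?_⟩)
      rw [Metric.mem_ball, dist_eq_norm]
      have : z - x j = Φ z - y j := by rw [hΦ]; simp only [hXx j z hzj]; ring
      rwa [this]
    · have h1 := hΦlow z (x j)
      have h2 : ‖z - x j‖ ≤ 2 * ‖Φ z - Φ (x j)‖ := h1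
      rw [hΦx j] at h2
      rw [Metric.mem_ball, dist_eq_norm, not_lt] at hzj
      linarith [hρ.2]
  set Q : ℂ → ℂ := fun z =>
    ofForm ((curForm (K (Φ z))).comp (ContinuousLinearMap.id ℝ ℂ + fderiv ℝ X z)) with hQ
  have hΦc : Continuous Φ := continuous_id.add hX.continuous
  have hKc : ContinuousOn (fun z => K (Φ z)) (Ω \ range x) :=
    hw.differentiableOn.continuousOn.comp hΦc.continuousOn hΦT
  have hQc : ContinuousOn Q (Ω \ range x) :=
    continuous_ofForm.comp_continuousOn ((continuous_curForm.comp_continuousOn hKc).clm_comp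
      (continuousOn_const.add hX'.continuousOn))
  set ψ : ℂ → ℝ := fun z => Complex.arg (w (Φ z) / v z) with hψ
  have hψd : ∀ z ∈ Ω \ range x, HasFDerivAt ψ (curForm (Q z - H z)) z := by
    intro z hz
    have hz' := hΦT z hz
    have h1 : HasFDerivAt (fun z => w (Φ z)) ((curForm (Q z)).smulRight (Complex.I * w (Φ z))) z := by
      refine ((hw.hasFDerivAt _ hz').comp z (hΦd z)).congr_fderiv ?_
      rw [hQ, curForm_ofForm]
      ext ξ; simp; ring
    have hvz := hv.ne_zero hz
    have h2 := h1.mul (hv.inv.hasFDerivAt z hz)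
    refine hasFDerivAt_arg_comp (div_ne_zero (hw.ne_zero hz') hvz) ?_ ?_
    · simp only [div_eq_mul_inv]
      refine h2.congr_fderiv ?_
      ext ξ
      simp [sub_mul]
      ring
    · rw [Complex.mem_slitPlane_iff]
      left
      have h3 := (Complex.abs_re_le_norm _).trans_lt (hclose z hz)
      rw [Complex.sub_re, Complex.one_re, abs_lt] at h3
      have h4 : (w (Φ z) / v z).re = (w (z + X z) / v z).re := rfl
      linarith [h3.1]
  have hψf : ∀ z ∈ Ω \ range x, fderiv ℝ ψ z = curForm (Q z - H z) := fun z hz =>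
    (hψd z hz).fderiv
  have hψ1 : ContDiffOn ℝ 1 ψ (Ω \ range x) := by
    refine contDiffOn_one_of_continuousOn_fderiv hT
      (fun z hz => (hψd z hz).differentiableAt.differentiableWithinAt) ?_
    exact (continuous_curForm.comp_continuousOn (hQc.sub hv.differentiableOn.continuousOn)).congr
      hψf
  have hout : ∀ z ∉ S, Φ z = z := fun z hz => by rw [hΦ]; simp [hXS z hz]
  have hXout : ∀ z ∉ S, fderiv ℝ X z = 0 := fun z hz => by
    have : X =ᶠ[𝓝 z] fun _ => 0 := by
      filter_upwards [hS.isClosed.isOpen_compl.mem_nhds hz] with z' hz' using hXS z' hz'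
    rw [this.fderiv_eq]; simp
  have hQout : ∀ z ∉ S, Q z = K z := fun z hz => by
    simp only [hQ]
    rw [hout z hz, hXout z hz, add_zero, ContinuousLinearMap.comp_id, ofForm_curForm]
  set F : ℂ → ℝ := fun z => curDot (H z) (fderiv ℝ ψ z) with hF
  have hFc : ContinuousOn F (Ω \ range x) := by
    refine continuous_curDot.comp_continuousOn (hv.differentiableOn.continuousOn.prodMk ?_)
    exact hψ1.continuousOn_fderiv_of_isOpen hT (by norm_num)
  have hFabs : ∀ z ∈ Ω \ range x, |F z| ≤ 2 * ‖H z‖ * ‖Q z - H z‖ := fun z hz => by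
    refine (abs_curDot_le _ _).trans ?_
    rw [hψf z hz]
    gcongr
    exact norm_curForm_le _
  -- Near the boundary `Q = K` and both currents are square integrable. At a vortex `H` has a simple
  -- pole, but `Q - H` is bounded because the singular parts coincide after translation.
  have hFint : IntegrableOn F Ω := by
    obtain ⟨C₁, hC₁, hC₁Ω, hi₁⟩ := hHfin
    obtain ⟨C₂, hC₂, hC₂Ω, hi₂⟩ := hKfin
    have hCc : IsCompact (C₁ ∪ C₂ ∪ S) := (hC₁.union hC₂).union hS
    refine integrableOn_of_simple_poles hCc
      (union_subset (union_subset hC₁Ω hC₂Ω) hSΩ) hFc ?_ hΩ ?_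
    · have hmeas : MeasurableSet (Ω \ (C₁ ∪ C₂ ∪ S)) := hΩ.measurableSet.diff hCc.measurableSet
      have hmeas' : MeasurableSet ((Ω \ (C₁ ∪ C₂ ∪ S)) \ range x) :=
        hmeas.diff (finite_range x).measurableSet
      have hae : ((Ω \ (C₁ ∪ C₂ ∪ S)) \ range x : Set ℂ) =ᵐ[volume] (Ω \ (C₁ ∪ C₂ ∪ S) : Set ℂ) :=
        sdiff_null_ae_eq_self ((finite_range x).measure_zero _)
      refine IntegrableOn.congr_set_ae ?_ hae.symm
      have j1 := (hi₁.mono_set (sdiff_subset_sdiff_right (fun z hz => Or.inl (Or.inl hz)) :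
        Ω \ (C₁ ∪ C₂ ∪ S) ⊆ Ω \ C₁))
      have j2 := (hi₂.mono_set (sdiff_subset_sdiff_right (fun z hz => Or.inl (Or.inr hz)) :
        Ω \ (C₁ ∪ C₂ ∪ S) ⊆ Ω \ C₂))
      refine Integrable.mono' (IntegrableOn.mono_set ((j1.const_mul 3).add j2) sdiff_subset)
        ((hFc.mono (fun z hz => ⟨hz.1.1, hz.2⟩)).aestronglyMeasurable hmeas') ?_
      filter_upwards [ae_restrict_mem hmeas'] with z hz
      refine (hFabs z ⟨hz.1.1, hz.2⟩).trans ?_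
      rw [hQout z fun h => hz.1.2 (Or.inr h)]
      have k1 := norm_sub_le (K z) (H z)
      have k2 := norm_nonneg (H z)
      calc 2 * ‖H z‖ * ‖K z - H z‖ ≤ 2 * ‖H z‖ * (‖K z‖ + ‖H z‖) := by gcongr
        _ ≤ 3 * ‖H z‖ ^ 2 + ‖K z‖ ^ 2 := by nlinarith [sq_nonneg (‖H z‖ - ‖K z‖)]
    · intro j
      obtain ⟨C₁, hC₁⟩ := hpole j
      obtain ⟨C₂, hC₂⟩ := hreg j
      refine ⟨2 * C₁ * C₂, ?_⟩
      have hnear : ∀ᶠ z in 𝓝[≠] (x j), z ∈ Ω \ range x := by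
        have e1 : ((Ω \ range x) ∪ {x j}) ∈ 𝓝 (x j) := by
          have : IsOpen (Ω \ ((range x) \ {x j})) :=
            hΩ.sdiff ((finite_range x).subset sdiff_subset).isClosed
          refine mem_of_superset (this.mem_nhds ⟨hxΩ j, fun h => h.2 rfl⟩) ?_
          rintro z ⟨hz, hz'⟩
          by_cases hzj : z = x j
          · exact Or.inr hzj
          · exact Or.inl ⟨hz, fun h => hz' ⟨h, hzj⟩⟩
        filter_upwards [mem_nhdsWithin_of_mem_nhds e1, self_mem_nhdsWithin] with z hz hz'
        exact hz.resolve_right hz'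
      filter_upwards [hC₁, hC₂, hnear, mem_nhdsWithin_of_mem_nhds
        (Metric.ball_mem_nhds (x j) hs)] with z h1 h2 h3 h4
      refine (hFabs z h3).trans ?_
      have hQz : Q z = K (z + (y j - x j)) := by
        have : X =ᶠ[𝓝 z] fun _ => y j - x j := by
          filter_upwards [Metric.isOpen_ball.mem_nhds h4] with z' hz' using hXx j z' hz'
        simp only [hQ]
        rw [this.fderiv_eq, fderiv_const_apply, add_zero, ContinuousLinearMap.comp_id,
          ofForm_curForm, hΦ]
        simp only [hXx j z h4]
      rw [hQz]
      have k1 := norm_nonneg (K (z + (y j - x j)) - H z)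
      have k2 := norm_nonneg (H z)
      have k3 := k2.trans h1
      calc 2 * ‖H z‖ * ‖K (z + (y j - x j)) - H z‖ ≤ 2 * (C₁ * ‖z - x j‖⁻¹) * C₂ := by gcongr
        _ = _ := by ring
  -- The phase difference is bounded by `π` and tends to `0` at the boundary, where `X` vanishes and
  -- the two maps share their values; it is therefore an admissible test function.
  have hF0 : ∫ z in Ω, F z = 0 := by
    refine setIntegral_curDot_fderiv_eq_zero_of_vanishing hΩ hΩb hx hv.differentiableOn hres hψ1
      (M := Real.pi) (fun z => Complex.abs_arg_le_pi _) (fun ε hε => ?_) hFint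
    have hlim : ∀ p ∈ frontier Ω, ∀ᶠ z in 𝓝[Ω] p, |Complex.arg (w z / v z)| ≤ ε := by
      intro p hp
      have h1 : ContinuousAt (fun z => |Complex.arg z|) 1 :=
        (Complex.continuousAt_arg (by simp [Complex.slitPlane])).abs
      have h2 := h1.tendsto.comp (hbd p hp)
      rw [Complex.arg_one, abs_zero] at h2
      filter_upwards [h2.eventually (gt_mem_nhds hε)] with z hz using hz.le
    obtain ⟨C, hC, hCΩ, hCP⟩ := exists_compact_of_eventually_nhdsWithin_frontier hΩ hΩb hlim
    refine ⟨C ∪ S, hC.union hS, union_subset hCΩ hSΩ, fun z hz hzC => ?_⟩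
    have := hCP z hz fun h => hzC (Or.inl h)
    simp only [hψ]
    rwa [hout z fun h => hzC (Or.inr h)]
  have hKperf : ∀ ρ > 0, IntegrableOn (fun z => ‖K z‖ ^ 2) (perforated Ω y ρ) := fun ρ hρ => by
    obtain ⟨C, hC, hCΩ, hi⟩ := hKfin
    exact integrableOn_norm_sq_perforated hw.differentiableOn hC hCΩ hi hρ
  have hHperf : ∀ ρ > 0, IntegrableOn (fun z => ‖H z‖ ^ 2) (perforated Ω x ρ) := fun ρ hρ => by
    obtain ⟨C, hC, hCΩ, hi⟩ := hHfin
    exact integrableOn_norm_sq_perforated hv.differentiableOn hC hCΩ hi hρ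
  have hl1 := (ha.add ((tendsto_setIntegral_perforated hΩ.measurableSet x hFint).const_mul 2)).sub
    (tendsto_setIntegral_perforated hΩ.measurableSet x hm)
  rw [hF0, mul_zero, add_zero] at hl1
  refine le_of_tendsto_of_tendsto hl1 hb ?_
  filter_upwards [Ioo_mem_nhdsGT (by positivity : 0 < s / 2)] with ρ hρ
  have hmx := measurableSet_perforated hΩ.measurableSet x ρ
  have hcv : ∀ z ∈ perforated Ω x ρ, HasFDerivWithinAt Φ
      (ContinuousLinearMap.id ℝ ℂ + fderiv ℝ X z) (perforated Ω x ρ) z := fun z _ =>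
    (hΦd z).hasFDerivWithinAt
  have hinj : InjOn Φ (perforated Ω x ρ) := hΦinj.injOn
  have himg : Φ '' perforated Ω x ρ ⊆ perforated Ω y ρ := (hperf ρ hρ).image_subset
  have hKimg := (hKperf ρ hρ.1).mono_set himg
  have i1 := (integrableOn_image_iff_integrableOn_abs_det_fderiv_smul volume hmx hcv hinj
    (fun z => ‖K z‖ ^ 2)).1 hKimg
  have i2 := integral_image_eq_integral_abs_det_fderiv_smul volume hmx hcv hinj
    (fun z => ‖K z‖ ^ 2)
  -- Only an inclusion of the image is needed, since a lower bound for the energy of the second map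
  -- is sought.
  have i3 : ∫ z in Φ '' perforated Ω x ρ, ‖K z‖ ^ 2 ≤ ∫ z in perforated Ω y ρ, ‖K z‖ ^ 2 :=
    setIntegral_mono_set (hKperf ρ hρ.1) (ae_of_all _ fun z => sq_nonneg _)
      himg.eventuallyLE
  have hsub := perforated_subset Ω x ρ
  have iH := hHperf ρ hρ.1
  have iF := (hFint.mono_set hsub).const_mul 2
  have im := hm.mono_set hsub
  have i4 : ∫ z in perforated Ω x ρ, (‖H z‖ ^ 2 + 2 * F z - m z) ≤
      ∫ z in perforated Ω x ρ,
        |(ContinuousLinearMap.id ℝ ℂ + fderiv ℝ X z).det| • ‖K (Φ z)‖ ^ 2 := by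
    refine setIntegral_mono_on ((iH.add iF).sub im) i1 hmx fun z hz => ?_
    have hzT := perforated_subset_diff_range Ω x hρ.1 hz
    have h1 := le_abs_det_mul_norm_sq (H z) (K (Φ z)) (fderiv ℝ X z)
    have h2 := hmle z hzT
    have h3 : F z = curDot (H z) (curForm (Q z - H z)) := by
      simp only [hF]; rw [hψf z hzT]
    rw [h3, smul_eq_mul]
    have h4 : K (Φ z) = K (z + X z) := rfl
    rw [← h4] at h2
    linarith
  have i5 : ∫ z in perforated Ω x ρ, (‖H z‖ ^ 2 + 2 * F z - m z) =
      (∫ z in perforated Ω x ρ, ‖H z‖ ^ 2) + 2 * (∫ z in perforated Ω x ρ, F z) -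
        ∫ z in perforated Ω x ρ, m z := by
    have iA : Integrable (fun z => ‖H z‖ ^ 2 + 2 * F z) (volume.restrict (perforated Ω x ρ)) :=
      iH.add iF
    rw [integral_sub iA im, integral_add iH iF, integral_const_mul]
  linarith

end

/-! ### Families of singular harmonic maps -/

/-- Hölder's inequality on a space of finite measure reduces every exponent `p ≥ 1` to `p = 1`. -/
theorem tendsto_lintegral_of_eLpNorm {ι E : Type*} [NormedAddCommGroup E] {l : Filter ι}
    {μ : Measure ℂ} [IsFiniteMeasure μ] {p : ℝ≥0∞} (hp : 1 ≤ p) {F : ι → ℂ → E}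
    (hF : ∀ᶠ i in l, AEStronglyMeasurable (F i) μ)
    (h : Tendsto (fun i => eLpNorm (F i) p μ) l (𝓝 0)) :
    Tendsto (fun i => ∫⁻ z, ‖F i z‖ₑ ∂μ) l (𝓝 0) := by
  set c := μ univ ^ (1 / (1 : ℝ≥0∞).toReal - 1 / p.toReal) with hc
  have hc' : c ≠ ⊤ := by
    refine ENNReal.rpow_ne_top_of_nonneg ?_ (measure_ne_top _ _)
    rw [ENNReal.toReal_one, one_div_one, one_div, sub_nonneg]
    by_cases hpt : p = ⊤
    · simp [hpt]
    · refine inv_le_one_of_one_le₀ ?_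
      rw [← ENNReal.toReal_one]
      exact (ENNReal.toReal_le_toReal ENNReal.one_ne_top hpt).2 hp
  have h2 : Tendsto (fun i => eLpNorm (F i) p μ * c) l (𝓝 0) := by
    simpa using ENNReal.Tendsto.mul_const h (Or.inr hc')
  refine tendsto_of_tendsto_of_tendsto_of_le_of_le' tendsto_const_nhds h2
    (Eventually.of_forall fun _ => zero_le) ?_
  filter_upwards [hF] with i hi
  rw [← eLpNorm_one_eq_lintegral_enorm]
  exact eLpNorm_le_eLpNorm_mul_rpow_measure_univ hp hi

theorem IsCurrent.aestronglyMeasurable {Ω : Set ℂ} (hΩ : IsOpen Ω) {n : ℕ} {x : Fin n → ℂ}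
    {u H : ℂ → ℂ} (h : IsCurrent (Ω \ range x) u H) :
    AEStronglyMeasurable u (volume.restrict Ω) := by
  have h1 := h.continuousOn.aestronglyMeasurable (μ := volume) (isOpen_diff_range hΩ).measurableSet
  have h2 : volume.restrict (Ω \ range x) = volume.restrict Ω :=
    Measure.restrict_congr_set (sdiff_null_ae_eq_self ((finite_range x).measure_zero _))
  rwa [h2] at h1

section

variable {Ω : Set ℂ} {g : frontier Ω → Circle} {n : ℕ} {d : Fin n → ℤ} {p : ℝ≥0∞}
  {U : Set (Fin n → ℂ)} {u f : (Fin n → ℂ) → ℂ → ℂ}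

/-- The current `f + vortexCur d x` of `u_x`, for every configuration `x`. -/
structure HasCurrents (Ω : Set ℂ) (d : Fin n → ℤ) (U : Set (Fin n → ℂ))
    (u f : (Fin n → ℂ) → ℂ → ℂ) : Prop where
  differentiableOn : ∀ x ∈ U, DifferentiableOn ℂ (f x) Ω
  isCurrent : ∀ x ∈ U, IsCurrent (Ω \ range x) (u x) (fun z => f x z + vortexCur d x z)

theorem IsSingularHarmonicFamily.exists_hasCurrents (hΩ : IsOpen Ω)
    (hu : IsSingularHarmonicFamily p Ω g d U u) : ∃ f, HasCurrents Ω d U u f := by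
  have h : ∀ x : Fin n → ℂ, ∃ f, x ∈ U → DifferentiableOn ℂ f Ω ∧
      IsCurrent (Ω \ range x) (u x) (fun z => f z + vortexCur d x z) := fun x => by
    by_cases hx : x ∈ U
    · obtain ⟨f, hf⟩ := (hu.singularHarmonic x hx).exists_isCurrent hΩ
      exact ⟨f, fun _ => hf⟩
    · exact ⟨0, fun h => absurd h hx⟩
  choose f hf using h
  exact ⟨f, fun x hx => (hf x hx).1, fun x hx => (hf x hx).2⟩

variable (hΩ : IsSmoothBoundedDomain Ω) (hp : 1 ≤ p) (hU : IsOpen U)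
  (hUΩ : U ⊆ configSpace Ω n) (hu : IsSingularHarmonicFamily p Ω g d U u)
  (hf : HasCurrents Ω d U u f) {x₀ : Fin n → ℂ} (hx₀ : x₀ ∈ U)

/-- The singularities of nearby maps stay in the `η`-disks around those of `u x₀`. All these maps
thus have currents on one common domain, as the convergence lemmas require. -/
theorem eventually_isCurrent (hU : IsOpen U) (hf : HasCurrents Ω d U u f) (hx₀ : x₀ ∈ U) {η : ℝ}
    (hη : 0 < η) : ∀ᶠ y in 𝓝 x₀, IsCurrent (Ω \ ⋃ j, Metric.closedBall (x₀ j) η) (u y)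
      (fun z => f y z + vortexCur d y z) := by
  filter_upwards [hU.mem_nhds hx₀, Metric.closedBall_mem_nhds x₀ hη] with y hy hyη
  refine (hf.isCurrent y hy).mono fun z hz => ⟨hz.1, ?_⟩
  rintro ⟨j, rfl⟩
  exact hz.2 (mem_iUnion.2 ⟨j, (dist_le_pi_dist y x₀ j).trans hyη⟩)

include hΩ hp hU hu hf hx₀ in
theorem tendsto_lintegral_sub {O : Set ℂ} (hO : O ⊆ Ω) :
    Tendsto (fun y => ∫⁻ z in O, ‖u y z - u x₀ z‖ₑ) (𝓝 x₀) (𝓝 0) ∧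
      Tendsto (fun y => ∫⁻ z in O, ‖fderiv ℝ (u y) z - fderiv ℝ (u x₀) z‖ₑ) (𝓝 x₀) (𝓝 0) := by
  have : IsFiniteMeasure (volume.restrict Ω) :=
    ⟨by rw [Measure.restrict_apply_univ]; exact hΩ.isBounded.measure_lt_top⟩
  obtain ⟨h1, h2⟩ := hu.continuous x₀ hx₀
  rw [hU.nhdsWithin_eq hx₀] at h1 h2
  have hm : ∀ y ∈ U, AEStronglyMeasurable (u y) (volume.restrict Ω) := fun y hy =>
    (hf.isCurrent y hy).aestronglyMeasurable hΩ.isOpen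
  have k1 := tendsto_lintegral_of_eLpNorm hp (by
    filter_upwards [hU.mem_nhds hx₀] with y hy using (hm y hy).sub (hm x₀ hx₀)) h1
  have k2 := tendsto_lintegral_of_eLpNorm hp (Eventually.of_forall fun y =>
    ((measurable_fderiv ℝ (u y)).sub (measurable_fderiv ℝ (u x₀))).aestronglyMeasurable) h2
  exact ⟨tendsto_of_tendsto_of_tendsto_of_le_of_le tendsto_const_nhds k1 (fun _ => zero_le)
      fun y => lintegral_mono_set hO,
    tendsto_of_tendsto_of_tendsto_of_le_of_le tendsto_const_nhds k2 (fun _ => zero_le)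
      fun y => lintegral_mono_set hO⟩

include hΩ hp hU hu hf hx₀ in
theorem tendstoUniformlyOn_family_current {K : Set ℂ} (hK : IsCompact K)
    (hKΩ : K ⊆ Ω \ range x₀) :
    TendstoUniformlyOn (fun y z => f y z + vortexCur d y z)
        (fun z => f x₀ z + vortexCur d x₀ z) (𝓝 x₀) K ∧
      TendstoUniformlyOn u (u x₀) (𝓝 x₀) K := by
  obtain ⟨η, hη, hKη⟩ : ∃ η > 0, ∀ j, Disjoint K (Metric.closedBall (x₀ j) η) := by
    have h1 : ∀ j, ∀ᶠ η in 𝓝[>] (0 : ℝ), Disjoint K (Metric.closedBall (x₀ j) η) := by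
      intro j
      obtain ⟨s, hs, h⟩ := Metric.isOpen_iff.1 hK.isClosed.isOpen_compl (x₀ j)
        fun h => (hKΩ h).2 ⟨j, rfl⟩
      filter_upwards [Ioo_mem_nhdsGT hs] with η hη
      exact disjoint_left.2 fun z hz hz' => h (Metric.closedBall_subset_ball hη.2 hz') hz
    obtain ⟨η, h⟩ := ((eventually_all.2 h1).and self_mem_nhdsWithin).exists
    exact ⟨η, h.2, h.1⟩
  have hO : IsOpen (Ω \ ⋃ j, Metric.closedBall (x₀ j) η) :=
    hΩ.isOpen.sdiff (isClosed_iUnion_of_finite fun _ => Metric.isClosed_closedBall)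
  have hKO : K ⊆ Ω \ ⋃ j, Metric.closedBall (x₀ j) η := fun z hz => ⟨(hKΩ hz).1, fun h => by
    obtain ⟨j, hj⟩ := mem_iUnion.1 h
    exact disjoint_left.1 (hKη j) hz hj⟩
  have hc := eventually_isCurrent hU hf hx₀ hη
  obtain ⟨k1, k2⟩ := tendsto_lintegral_sub hΩ hp hU hu hf hx₀
    (sdiff_subset : Ω \ ⋃ j, Metric.closedBall (x₀ j) η ⊆ Ω)
  exact ⟨tendstoUniformlyOn_current hO hc.self_of_nhds hc k1 k2 hK hKO,
    tendstoUniformlyOn_map hO hc.self_of_nhds hc k1 k2 hK hKO⟩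

include hΩ hp hU hUΩ hu hf hx₀ in
theorem tendstoUniformlyOn_family {r : ℝ} (hr : 0 < r) :
    TendstoUniformlyOn u (u x₀) (𝓝 x₀) (Ω \ ⋃ j, Metric.ball (x₀ j) r) := by
  obtain ⟨s, hs, hsΩ, -⟩ := exists_radius hΩ.isOpen (hUΩ hx₀)
  set η := min s (r / 2) with hη
  have hη0 : 0 < η := by positivity
  have hηr : η < r := by have := min_le_right s (r / 2); linarith
  have hc := eventually_isCurrent hU hf hx₀ hη0
  obtain ⟨k1, k2⟩ := tendsto_lintegral_sub hΩ hp hU hu hf hx₀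
    (sdiff_subset : Ω \ ⋃ j, Metric.closedBall (x₀ j) η ⊆ Ω)
  refine tendstoUniformlyOn_of_boundary hΩ (isCompact_iUnion fun j => isCompact_closedBall _ _)
    (iUnion_subset fun j => (Metric.closedBall_subset_closedBall (min_le_left _ _)).trans (hsΩ j))
    hc.self_of_nhds hc ?_ k1 k2 (isOpen_iUnion fun _ => Metric.isOpen_ball)
    (iUnion_mono fun j => Metric.closedBall_subset_ball hηr)
  filter_upwards [hU.mem_nhds hx₀] with y hy z hz
  have := (hu.boundary y hy ⟨z, hz⟩).sub (hu.boundary x₀ hx₀ ⟨z, hz⟩)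
  rwa [sub_self] at this

/-! #### Behaviour near a vortex -/

theorem eventually_norm_regPart_le (hΩ : IsOpen Ω) {x : Fin n → ℂ} (hx : x ∈ configSpace Ω n)
    {f : ℂ → ℂ} (hf : DifferentiableOn ℂ f Ω) (j : Fin n) :
    ∃ C, ∀ᶠ z in 𝓝 (x j), ‖regPart d x f j z‖ ≤ C := by
  have h1 : ContinuousAt (regPart d x f j) (x j) :=
    (differentiableAt_regPart (hf.differentiableAt (hΩ.mem_nhds (hx.1 j)))
      fun k hk => hx.2 j k hk.symm).continuousAt
  refine ⟨‖regPart d x f j (x j)‖ + 1, ?_⟩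
  filter_upwards [h1.norm.eventually (gt_mem_nhds (lt_add_one _))] with z hz using hz.le

/-- Multiplied by `z - x j`, the vortex term becomes `-i d_j`, which is purely imaginary because the
degree is real: a vortex current is tangential, and only the regular part has a radial component. -/
theorem exists_abs_re_mul_le (hΩ : IsOpen Ω) {x : Fin n → ℂ} (hx : x ∈ configSpace Ω n)
    {f : ℂ → ℂ} (hf : DifferentiableOn ℂ f Ω) (j : Fin n) :
    ∃ C, ∀ᶠ z in 𝓝[≠] (x j), |((f z + vortexCur d x z) * (z - x j)).re| ≤ C * ‖z - x j‖ := by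
  obtain ⟨C, hC⟩ := eventually_norm_regPart_le (d := d) hΩ hx hf j
  refine ⟨C, ?_⟩
  filter_upwards [mem_nhdsWithin_of_mem_nhds hC, self_mem_nhdsWithin] with z hz hzj
  have hz0 : z - x j ≠ 0 := sub_ne_zero.2 hzj
  have h1 : (f z + vortexCur d x z) * (z - x j) =
      -((d j : ℝ) * Complex.I) + regPart d x f j z * (z - x j) := by
    rw [add_vortexCur_eq d x f j z]
    field_simp
    push_cast
    ring
  rw [h1, Complex.add_re, Complex.neg_re, Complex.re_ofReal_mul, Complex.I_re, mul_zero, neg_zero,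
    zero_add]
  refine (Complex.abs_re_le_norm _).trans ?_
  rw [norm_mul]
  gcongr

theorem exists_norm_current_le (hΩ : IsOpen Ω) {x : Fin n → ℂ} (hx : x ∈ configSpace Ω n)
    {f : ℂ → ℂ} (hf : DifferentiableOn ℂ f Ω) (j : Fin n) :
    ∃ C, ∀ᶠ z in 𝓝[≠] (x j), ‖f z + vortexCur d x z‖ ≤ C * ‖z - x j‖⁻¹ := by
  obtain ⟨C, hC⟩ := eventually_norm_regPart_le (d := d) hΩ hx hf j
  refine ⟨|(d j : ℝ)| + C, ?_⟩
  filter_upwards [mem_nhdsWithin_of_mem_nhds hC, self_mem_nhdsWithin,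
    mem_nhdsWithin_of_mem_nhds (Metric.ball_mem_nhds (x j) one_pos)] with z hz hzj hz1
  have hz0 : 0 < ‖z - x j‖ := norm_pos_iff.2 (sub_ne_zero.2 hzj)
  have hC0 : 0 ≤ C := (norm_nonneg _).trans hz
  rw [Metric.mem_ball, dist_eq_norm] at hz1
  rw [add_vortexCur_eq d x f j z, add_mul]
  refine (norm_add_le _ _).trans (add_le_add ?_ (hz.trans ?_))
  · simp [div_eq_mul_inv]
  · exact le_mul_of_one_le_right hC0 (one_le_inv_iff₀.2 ⟨hz0, hz1.le⟩)

/-- The currents of two singular maps, moved to the same vortex, differ by a regular function. -/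
theorem current_sub_current_eq {x y : Fin n → ℂ} {f f' : ℂ → ℂ} (j : Fin n) (z : ℂ) :
    (f' (z + (y j - x j)) + vortexCur d y (z + (y j - x j))) - (f z + vortexCur d x z) =
      regPart d y f' j (z + (y j - x j)) - regPart d x f j z := by
  rw [add_vortexCur_eq d y f' j, add_vortexCur_eq d x f j]
  have : z + (y j - x j) - y j = z - x j := by ring
  rw [this]
  ring

theorem exists_norm_current_sub_le (hΩ : IsOpen Ω) {x y : Fin n → ℂ} (hx : x ∈ configSpace Ω n)
    (hy : y ∈ configSpace Ω n) {f f' : ℂ → ℂ} (hf : DifferentiableOn ℂ f Ω)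
    (hf' : DifferentiableOn ℂ f' Ω) (j : Fin n) :
    ∃ C, ∀ᶠ z in 𝓝[≠] (x j), ‖(f' (z + (y j - x j)) + vortexCur d y (z + (y j - x j))) -
      (f z + vortexCur d x z)‖ ≤ C := by
  obtain ⟨C, hC⟩ := eventually_norm_regPart_le (d := d) hΩ hx hf j
  obtain ⟨C', hC'⟩ := eventually_norm_regPart_le (d := d) hΩ hy hf' j
  have h1 : Tendsto (fun z => z + (y j - x j)) (𝓝 (x j)) (𝓝 (y j)) := by
    have : Continuous fun z : ℂ => z + (y j - x j) := by fun_prop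
    simpa using this.tendsto (x j)
  refine ⟨C' + C, ?_⟩
  filter_upwards [mem_nhdsWithin_of_mem_nhds hC, mem_nhdsWithin_of_mem_nhds (h1.eventually hC')]
    with z h2 h3
  rw [current_sub_current_eq]
  exact (norm_sub_le _ _).trans (add_le_add h3 h2)

/-- A map with bounded differential in a punctured disk that is close to `1` on the circle. -/
theorem norm_sub_one_le_of_punctured_ball {w : ℂ → ℂ} {a : ℂ} {s M ε : ℝ}
    (hd : ∀ z ∈ Metric.closedBall a s, z ≠ a → DifferentiableAt ℝ w z ∧ ‖fderiv ℝ w z‖ ≤ M)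
    (hs : ∀ z ∈ Metric.sphere a s, ‖w z - 1‖ ≤ ε) {z : ℂ} (hz : z ∈ Metric.ball a s)
    (hza : z ≠ a) : ‖w z - 1‖ ≤ ε + M * s := by
  have hn : 0 < ‖z - a‖ := norm_pos_iff.2 (sub_ne_zero.2 hza)
  rw [Metric.mem_ball, dist_eq_norm] at hz
  set t := s / ‖z - a‖ with ht
  have ht1 : 1 < t := by rw [ht, one_lt_div hn]; exact hz
  set z' : ℂ := a + t • (z - a) with hz'
  have hz's : z' ∈ Metric.sphere a s := by
    rw [mem_sphere_iff_norm, hz', add_sub_cancel_left, norm_smul, Real.norm_eq_abs,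
      abs_of_pos (by linarith), ht]
    field_simp
  have hseg : ∀ y ∈ segment ℝ z z', y ∈ Metric.closedBall a s ∧ y ≠ a := by
    rintro y ⟨b, c, hb, hc, hbc, rfl⟩
    have h1 : b • z + c • z' - a = (b + c * t) • (z - a) := by
      have : a = (b + c) • a := by rw [hbc, one_smul]
      conv_lhs => rw [this]
      rw [hz']
      simp only [Complex.real_smul]; push_cast; ring
    have h2 : 0 < b + c * t := by nlinarith
    have h3 : b + c * t ≤ t := by nlinarith
    refine ⟨?_, fun h => ?_⟩
    · rw [mem_closedBall_iff_norm, h1, norm_smul, Real.norm_eq_abs, abs_of_pos h2]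
      calc (b + c * t) * ‖z - a‖ ≤ t * ‖z - a‖ := by gcongr
        _ = s := by rw [ht]; field_simp
    · rw [h, sub_self, eq_comm, smul_eq_zero] at h1
      exact h1.elim h2.ne' (sub_ne_zero.2 hza)
  have h4 := (convex_segment z z').norm_image_sub_le_of_norm_fderiv_le
    (fun y hy => (hd y (hseg y hy).1 (hseg y hy).2).1)
    (fun y hy => (hd y (hseg y hy).1 (hseg y hy).2).2) (right_mem_segment ℝ z z')
    (left_mem_segment ℝ z z')
  have hM : 0 ≤ M := (norm_nonneg _).trans
    (hd z (mem_closedBall_iff_norm.2 hz.le) hza).2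
  have h5 : ‖z - z'‖ ≤ s := by
    have : z - z' = -((t - 1) • (z - a)) := by
      rw [hz']; simp only [Complex.real_smul]; push_cast; ring
    rw [this, norm_neg, norm_smul, Real.norm_eq_abs, abs_of_pos (by linarith)]
    have : t * ‖z - a‖ = s := by rw [ht]; field_simp
    nlinarith
  have h6 := norm_add_le (w z - w z') (w z' - 1)
  rw [sub_add_sub_cancel] at h6
  have h7 : M * ‖z - z'‖ ≤ M * s := by gcongr
  linarith [hs z' hz's]

end

/-! ### Inner variations moving the vortices -/

/-- Cut-off functions `χ j`, supported in the compact set `S`, equal to `1` near `x j` and to `0`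
near the other points. -/
structure IsCutoffSystem (Ω : Set ℂ) {n : ℕ} (x : Fin n → ℂ) (r : ℝ) (S : Set ℂ)
    (χ : Fin n → ℂ → ℝ) : Prop where
  pos : 0 < r
  contDiff : ∀ j, ContDiff ℝ 1 (χ j)
  eq_one : ∀ j, ∀ z ∈ Metric.ball (x j) r, χ j z = 1
  eq_zero : ∀ j k, j ≠ k → ∀ z ∈ Metric.ball (x k) r, χ j z = 0
  isCompact : IsCompact S
  subset : S ⊆ Ω
  eq_zero_off : ∀ j, ∀ z ∉ S, χ j z = 0

/-- The vector field `∑ χ j • h j`. -/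
noncomputable def variation {n : ℕ} (χ : Fin n → ℂ → ℝ) (h : Fin n → ℂ) (z : ℂ) : ℂ :=
  ∑ j, χ j z • h j

namespace IsCutoffSystem

variable {Ω S : Set ℂ} {n : ℕ} {x : Fin n → ℂ} {r : ℝ} {χ : Fin n → ℂ → ℝ}

theorem contDiff_variation (hχ : IsCutoffSystem Ω x r S χ) (h : Fin n → ℂ) :
    ContDiff ℝ 1 (variation χ h) :=
  ContDiff.sum fun j _ => (hχ.contDiff j).smul contDiff_const

theorem fderiv_variation (hχ : IsCutoffSystem Ω x r S χ) (h : Fin n → ℂ) (z : ℂ) :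
    fderiv ℝ (variation χ h) z = ∑ j, (fderiv ℝ (χ j) z).smulRight (h j) := by
  refine HasFDerivAt.fderiv ?_
  unfold variation
  exact HasFDerivAt.fun_sum fun j _ =>
    (((hχ.contDiff j).differentiable (by norm_num)) z).hasFDerivAt.smul_const (h j)

theorem variation_eq_zero (hχ : IsCutoffSystem Ω x r S χ) (h : Fin n → ℂ) {z : ℂ} (hz : z ∉ S) :
    variation χ h z = 0 :=
  Finset.sum_eq_zero fun j _ => by rw [hχ.eq_zero_off j z hz, zero_smul]

theorem variation_eq (hχ : IsCutoffSystem Ω x r S χ) (h : Fin n → ℂ) (k : Fin n) {z : ℂ}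
    (hz : z ∈ Metric.ball (x k) r) : variation χ h z = h k := by
  rw [variation, Finset.sum_eq_single k]
  · rw [hχ.eq_one k z hz, one_smul]
  · intro j _ hj
    rw [hχ.eq_zero j k hj z hz, zero_smul]
  · simp

theorem ball_subset (hχ : IsCutoffSystem Ω x r S χ) (k : Fin n) : Metric.ball (x k) r ⊆ S := by
  intro z hz
  by_contra h
  have := hχ.eq_one k z hz
  rw [hχ.eq_zero_off k z h] at this
  exact zero_ne_one this

theorem notMem_ball (hχ : IsCutoffSystem Ω x r S χ) {j k : Fin n} (hjk : j ≠ k) {z : ℂ}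
    (hz : z ∈ Metric.ball (x k) r) : z ∉ Metric.ball (x j) r := fun h => by
  have := hχ.eq_one j z h
  rw [hχ.eq_zero j k hjk z hz] at this
  exact zero_ne_one this

theorem fderiv_variation_eq_zero (hχ : IsCutoffSystem Ω x r S χ) (h : Fin n → ℂ) {z : ℂ}
    (hz : z ∉ S \ ⋃ j, Metric.ball (x j) r) : fderiv ℝ (variation χ h) z = 0 := by
  by_cases hzS : z ∈ S
  · have h1 : z ∈ ⋃ j, Metric.ball (x j) r := by_contra fun h => hz ⟨hzS, h⟩
    obtain ⟨k, hk⟩ := mem_iUnion.1 h1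
    have : variation χ h =ᶠ[𝓝 z] fun _ => h k := by
      filter_upwards [Metric.isOpen_ball.mem_nhds hk] with w hw using hχ.variation_eq h k hw
    rw [this.fderiv_eq]; simp
  · have : variation χ h =ᶠ[𝓝 z] fun _ => 0 := by
      filter_upwards [hχ.isCompact.isClosed.isOpen_compl.mem_nhds hzS] with w hw
      exact hχ.variation_eq_zero h hw
    rw [this.fderiv_eq]; simp

theorem exists_bound (hχ : IsCutoffSystem Ω x r S χ) : ∃ C > 0, ∀ h z,
    ‖variation χ h z‖ ≤ C * ‖h‖ ∧ ‖fderiv ℝ (variation χ h) z‖ ≤ C * ‖h‖ := by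
  have hb : ∀ j, ∃ C, ∀ z, |χ j z| ≤ C ∧ ‖fderiv ℝ (χ j) z‖ ≤ C := by
    intro j
    have hc : HasCompactSupport (χ j) := HasCompactSupport.intro hχ.isCompact (hχ.eq_zero_off j)
    obtain ⟨C₁, h₁⟩ := (hχ.contDiff j).continuous.bounded_above_of_compact_support hc
    obtain ⟨C₂, h₂⟩ := ((hχ.contDiff j).continuous_fderiv
      (by norm_num)).bounded_above_of_compact_support (hc.fderiv (𝕜 := ℝ))
    exact ⟨max C₁ C₂, fun z => ⟨(h₁ z).trans (le_max_left _ _), (h₂ z).trans (le_max_right _ _)⟩⟩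
  choose C hC using hb
  have hC0 : ∀ j, 0 ≤ C j := fun j => (abs_nonneg _).trans (hC j 0).1
  have hpos : 0 < 1 + ∑ j, C j := by
    have := Finset.sum_nonneg fun j (_ : j ∈ Finset.univ) => hC0 j
    linarith
  refine ⟨1 + ∑ j, C j, hpos, fun h z => ⟨?_, ?_⟩⟩
  · calc ‖variation χ h z‖ ≤ ∑ j, ‖χ j z • h j‖ := norm_sum_le _ _
      _ ≤ ∑ j, C j * ‖h‖ := by
          refine Finset.sum_le_sum fun j _ => ?_
          rw [norm_smul]
          exact mul_le_mul (hC j z).1 (norm_le_pi_norm h j) (norm_nonneg _) (hC0 j)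
      _ = (∑ j, C j) * ‖h‖ := by rw [Finset.sum_mul]
      _ ≤ _ := by gcongr; linarith
  · rw [hχ.fderiv_variation]
    calc _ ≤ ∑ j, ‖(fderiv ℝ (χ j) z).smulRight (h j)‖ := norm_sum_le _ _
      _ ≤ ∑ j, C j * ‖h‖ := by
          refine Finset.sum_le_sum fun j _ => ?_
          rw [ContinuousLinearMap.norm_smulRight_apply]
          exact mul_le_mul (hC j z).2 (norm_le_pi_norm h j) (norm_nonneg _) (hC0 j)
      _ = (∑ j, C j) * ‖h‖ := by rw [Finset.sum_mul]
      _ ≤ _ := by gcongr; linarith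

end IsCutoffSystem

/-- Locally uniform convergence is not affected by composition with small variations. -/
theorem eventually_norm_comp_variation_sub_le {n : ℕ} {x₀ : Fin n → ℂ} {O K : Set ℂ}
    (hO : IsOpen O) (hK : IsCompact K) (hKO : K ⊆ O) {F : (Fin n → ℂ) → ℂ → ℂ} {F₀ : ℂ → ℂ}
    (hF₀ : ContinuousOn F₀ O)
    (hF : ∀ K, IsCompact K → K ⊆ O → TendstoUniformlyOn F F₀ (𝓝 x₀) K)
    {X : (Fin n → ℂ) → ℂ → ℂ} {C : ℝ} (hX : ∀ h z, ‖X h z‖ ≤ C * ‖h‖) {ε : ℝ} (hε : 0 < ε) :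
    ∀ᶠ p : (Fin n → ℂ) × (Fin n → ℂ) in 𝓝 (x₀, x₀), ∀ z ∈ K,
      ‖F p.2 (z + X (p.2 - p.1) z) - F₀ z‖ ≤ ε := by
  obtain ⟨R, hR, hRO⟩ := hK.exists_cthickening_subset_open hO hKO
  have h1 := Metric.tendstoUniformlyOn_iff.1 (hF _ (hK.cthickening (r := R)) hRO) (ε / 2)
    (by positivity)
  have h2 := hK.uniformContinuousAt_of_continuousAt F₀
    (fun a ha => hF₀.continuousAt (hO.mem_nhds (hKO ha)))
    (Metric.dist_mem_uniformity (by positivity : 0 < ε / 2))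
  obtain ⟨δ, hδ, hδ2⟩ := Metric.mem_uniformity_dist.1 h2
  have h3 : Tendsto (fun p : (Fin n → ℂ) × (Fin n → ℂ) => C * ‖p.2 - p.1‖) (𝓝 (x₀, x₀))
      (𝓝 0) := by
    have : Continuous fun p : (Fin n → ℂ) × (Fin n → ℂ) => C * ‖p.2 - p.1‖ := by fun_prop
    simpa using this.tendsto (x₀, x₀)
  have h4 : Tendsto (fun p : (Fin n → ℂ) × (Fin n → ℂ) => p.2) (𝓝 (x₀, x₀)) (𝓝 x₀) :=
    continuous_snd.tendsto (x₀, x₀)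
  filter_upwards [h4.eventually h1, h3.eventually (gt_mem_nhds (lt_min hδ hR))] with p hp1 hp2 z hz
  have h5 := (hX (p.2 - p.1) z).trans_lt hp2
  set z' := z + X (p.2 - p.1) z with hz'
  have h6 : dist z z' < min δ R := by rw [dist_comm, hz', dist_eq_norm, add_sub_cancel_left]; exact h5
  have h7 : z' ∈ Metric.cthickening R K :=
    Metric.mem_cthickening_of_dist_le z' z R K hz (by
      rw [dist_comm]; exact (h6.trans_le (min_le_right _ _)).le)
  have h8 := hp1 z' h7
  have h9 : dist (F₀ z) (F₀ z') < ε / 2 := hδ2 (h6.trans_le (min_le_left _ _)) hz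
  rw [← dist_eq_norm]
  have := dist_triangle (F p.2 z') (F₀ z') (F₀ z)
  rw [dist_comm] at h8 h9
  linarith

section

variable {Ω S : Set ℂ} {g : frontier Ω → Circle} {n : ℕ} {d : Fin n → ℤ} {p : ℝ≥0∞}
  {U : Set (Fin n → ℂ)} {u f : (Fin n → ℂ) → ℂ → ℂ} {x₀ : Fin n → ℂ} {r : ℝ} {χ : Fin n → ℂ → ℝ}

/-- Near a vortex, moved maps are close as soon as they are so on a circle together with their
currents. -/
theorem norm_div_sub_one_lt_near_vortex (hΩ : IsOpen Ω) (hf : HasCurrents Ω d U u f)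
    (hχ : IsCutoffSystem Ω x₀ r S χ) {x y : Fin n → ℂ} (hx : x ∈ U) (hy : y ∈ U)
    (hxr : ∀ j, dist (x j) (x₀ j) < r / 8) (hyr : ∀ j, dist (y j) (x₀ j) < r / 8) (j : Fin n)
    (h1 : ∀ z ∈ Metric.sphere (x j) (3 / 4 * r), ‖u y (z + (y j - x j)) / u x z - 1‖ ≤ 1 / 2)
    (h2 : ∀ z ∈ Metric.sphere (x j) (3 / 4 * r),
      ‖(f y (z + (y j - x j)) + vortexCur d y (z + (y j - x j))) -
        (f x z + vortexCur d x z)‖ ≤ (4 * r)⁻¹)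
    {z : ℂ} (hz : z ∈ Metric.ball (x j) (3 / 4 * r)) (hzx : z ≠ x j) :
    ‖u y (z + (y j - x j)) / u x z - 1‖ < 1 := by
  have hr := hχ.pos
  have hB : ∀ w ∈ Metric.closedBall (x j) (3 / 4 * r), w ∈ Metric.ball (x₀ j) r := fun w hw => by
    have := dist_triangle w (x j) (x₀ j)
    have := hxr j
    rw [Metric.mem_closedBall] at hw
    rw [Metric.mem_ball]; linarith
  have hB' : ∀ w ∈ Metric.closedBall (x j) (3 / 4 * r), w + (y j - x j) ∈ Metric.ball (x₀ j) r :=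
    fun w hw => by
      have h1 := dist_triangle (w + (y j - x j)) (y j) (x₀ j)
      have h2 : dist (w + (y j - x j)) (y j) = dist w (x j) := by
        rw [dist_eq_norm, dist_eq_norm]; congr 1; ring
      have := hyr j
      rw [Metric.mem_closedBall] at hw
      rw [Metric.mem_ball]; linarith
  have hnear : ∀ {x : Fin n → ℂ}, (∀ j, dist (x j) (x₀ j) < r / 8) → ∀ k, k ≠ j → ∀ w,
      w ∈ Metric.ball (x₀ j) r → w ≠ x k := by
    rintro x hxr k hk w hw rfl
    refine hχ.notMem_ball hk hw ?_
    rw [Metric.mem_ball]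
    linarith [hxr k]
  have hball : Metric.ball (x₀ j) r ⊆ Ω := (hχ.ball_subset j).trans hχ.subset
  have hreg : ∀ {x : Fin n → ℂ}, x ∈ U → (∀ j, dist (x j) (x₀ j) < r / 8) → ∀ w,
      w ∈ Metric.ball (x₀ j) r → DifferentiableAt ℂ (regPart d x (f x) j) w :=
    fun {x} hx hxr w hw => differentiableAt_regPart
      ((hf.differentiableOn x hx).differentiableAt (hΩ.mem_nhds (hball hw)))
      fun k hk => hnear hxr k hk w hw
  set k : ℂ → ℂ := fun w =>
    regPart d y (f y) j (w + (y j - x j)) - regPart d x (f x) j w with hk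
  have hkd : ∀ w ∈ Metric.closedBall (x j) (3 / 4 * r), DifferentiableAt ℂ k w := fun w hw => by
    refine DifferentiableAt.fun_sub ?_ (hreg hx hxr w (hB w hw))
    exact (hreg hy hyr _ (hB' w hw)).comp (f := fun w => w + (y j - x j)) w (by fun_prop)
  -- The poles at the moved vortex cancel, so the difference of currents extends holomorphically
  -- over the disk and the maximum modulus principle carries the bound from the circle inwards.
  have hkb : ∀ w ∈ Metric.closedBall (x j) (3 / 4 * r), ‖k w‖ ≤ (4 * r)⁻¹ := by
    intro w hw
    have hr34 : 3 / 4 * r ≠ 0 := by positivity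
    refine Complex.norm_le_of_forall_mem_frontier_norm_le (U := Metric.ball (x j) (3 / 4 * r))
      Metric.isBounded_ball ?_ ?_ ?_
    · refine DifferentiableOn.diffContOnCl ?_
      rw [closure_ball _ hr34]
      exact fun w hw => (hkd w hw).differentiableWithinAt
    · intro w hw
      rw [frontier_ball _ hr34] at hw
      have := h2 w hw
      rwa [current_sub_current_eq] at this
    · rwa [closure_ball _ hr34]
  have hT : ∀ w ∈ Metric.closedBall (x j) (3 / 4 * r), w ≠ x j →
      w ∈ Ω \ range x ∧ w + (y j - x j) ∈ Ω \ range y := by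
    intro w hw hwx
    refine ⟨⟨hball (hB w hw), ?_⟩, ⟨hball (hB' w hw), ?_⟩⟩
    · rintro ⟨i, hi⟩
      by_cases hij : i = j
      · exact hwx (hij ▸ hi.symm)
      · exact hnear hxr i hij w (hB w hw) hi.symm
    · rintro ⟨i, hi⟩
      by_cases hij : i = j
      · subst hij
        refine hwx ?_
        linear_combination -hi
      · exact hnear hyr i hij _ (hB' w hw) hi.symm
  have hcur : ∀ w ∈ Metric.closedBall (x j) (3 / 4 * r), w ≠ x j →
      DifferentiableAt ℝ (fun w => u y (w + (y j - x j)) / u x w) w ∧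
        ‖fderiv ℝ (fun w => u y (w + (y j - x j)) / u x w) w‖ ≤ (4 * r)⁻¹ := by
    intro w hw hwx
    obtain ⟨t1, t2⟩ := hT w hw hwx
    have c1 := ((hf.isCurrent y hy).comp_add_const (y j - x j)).mono
      (inter_subset_left (t := Ω \ range x))
    have c2 := (hf.isCurrent x hx).mono
      (inter_subset_right (s := (fun w => w + (y j - x j)) ⁻¹' (Ω \ range y)))
    have c3 := c1.div c2
    have hmem : w ∈ (fun w => w + (y j - x j)) ⁻¹' (Ω \ range y) ∩ (Ω \ range x) := ⟨t2, t1⟩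
    refine ⟨(c3.hasFDerivAt w hmem).differentiableAt, (c3.norm_fderiv_le hmem).trans ?_⟩
    rw [current_sub_current_eq]
    exact hkb w hw
  have := norm_sub_one_le_of_punctured_ball hcur h1 hz hzx
  -- The total bound is `1/2 + 3/16 < 1`.
  have h3 : (4 * r)⁻¹ * (3 / 4 * r) = 3 / 16 := by field_simp; norm_num
  rw [h3] at this
  linarith

variable (hΩ : IsSmoothBoundedDomain Ω) (hp : 1 ≤ p) (hU : IsOpen U)
  (hUΩ : U ⊆ configSpace Ω n) (hu : IsSingularHarmonicFamily p Ω g d U u)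
  (hf : HasCurrents Ω d U u f) (hx₀ : x₀ ∈ U) (hχ : IsCutoffSystem Ω x₀ r S χ)

include hΩ hp hU hu hf hx₀ hχ

theorem eventually_currents_near {ε : ℝ} (hε : 0 < ε) {t : ℝ} (ht : 0 < t) :
    ∀ᶠ q : (Fin n → ℂ) × (Fin n → ℂ) in 𝓝 (x₀, x₀), ∀ z ∈ S \ ⋃ j, Metric.ball (x₀ j) t,
      ‖(f q.2 (z + variation χ (q.2 - q.1) z) +
          vortexCur d q.2 (z + variation χ (q.2 - q.1) z)) - (f x₀ z + vortexCur d x₀ z)‖ ≤ ε ∧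
      ‖(f q.1 z + vortexCur d q.1 z) - (f x₀ z + vortexCur d x₀ z)‖ ≤ ε ∧
      ‖u q.2 (z + variation χ (q.2 - q.1) z) - u x₀ z‖ ≤ ε := by
  obtain ⟨C, hC, hCb⟩ := hχ.exists_bound
  have hO := isOpen_diff_range (x := x₀) hΩ.isOpen
  have hK : IsCompact (S \ ⋃ j, Metric.ball (x₀ j) t) :=
    hχ.isCompact.diff (isOpen_iUnion fun _ => Metric.isOpen_ball)
  have hKO : S \ ⋃ j, Metric.ball (x₀ j) t ⊆ Ω \ range x₀ :=
    (sdiff_subset_sdiff_left hχ.subset).trans (perforated_subset_diff_range Ω x₀ ht)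
  have hcur := hf.isCurrent x₀ hx₀
  have hunif := fun K hK hKO =>
    tendstoUniformlyOn_family_current (K := K) hΩ hp hU hu hf hx₀ hK hKO
  have e1 := eventually_norm_comp_variation_sub_le hO hK hKO hcur.differentiableOn.continuousOn
    (fun K hK hKO => (hunif K hK hKO).1) (fun h z => (hCb h z).1) hε
  have e2 := eventually_norm_comp_variation_sub_le hO hK hKO hcur.continuousOn
    (fun K hK hKO => (hunif K hK hKO).2) (fun h z => (hCb h z).1) hε
  have e3 := (continuous_fst.tendsto (x₀, x₀)).eventually
    (Metric.tendstoUniformlyOn_iff.1 (hunif _ hK hKO).1 ε hε)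
  filter_upwards [e1, e2, e3] with q h1 h2 h3 z hz
  refine ⟨h1 z hz, ?_, h2 z hz⟩
  have := h3 z hz
  rw [dist_comm, dist_eq_norm] at this
  exact this.le

include hUΩ in
-- This makes the phase difference in the energy comparison single-valued. Away from the vortices it
-- follows from uniform convergence up to the boundary; inside the disks the variation is a
-- translation and `norm_div_sub_one_lt_near_vortex` takes over.
theorem eventually_norm_div_sub_one_lt :
    ∀ᶠ q : (Fin n → ℂ) × (Fin n → ℂ) in 𝓝 (x₀, x₀), ∀ z ∈ Ω \ range q.1,
      ‖u q.2 (z + variation χ (q.2 - q.1) z) / u q.1 z - 1‖ < 1 := by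
  have hr := hχ.pos
  have hr4 : 0 < (4 * r)⁻¹ := by positivity
  have hr8 : 0 < r / 8 := by positivity
  have e0 := Metric.tendstoUniformlyOn_iff.1
    (tendstoUniformlyOn_family hΩ hp hU hUΩ hu hf hx₀ (by positivity : 0 < r / 2)) (1 / 4)
    (by norm_num)
  -- Both configurations are compared with `x₀`: two errors of `1/4` in the maps give `1/2`, and two
  -- errors of half of `(4 * r)⁻¹` in the currents give the bound required on the circles.
  have e1 := eventually_currents_near hΩ hp hU hu hf hx₀ hχ
    (by positivity : 0 < min (1 / 4) ((4 * r)⁻¹ / 2)) (by positivity : 0 < r / 2)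
  have hfst := continuous_fst.tendsto (x₀, x₀)
  have hsnd := continuous_snd.tendsto (x₀, x₀)
  filter_upwards [hfst.eventually e0, hsnd.eventually e0, e1, hfst.eventually (hU.mem_nhds hx₀),
    hsnd.eventually (hU.mem_nhds hx₀), hfst.eventually (Metric.ball_mem_nhds x₀ hr8),
    hsnd.eventually (Metric.ball_mem_nhds x₀ hr8)] with q h1 h2 h3 hq1 hq2 hd1 hd2
  have hd1' : ∀ j, dist (q.1 j) (x₀ j) < r / 8 := fun j => (dist_le_pi_dist _ _ j).trans_lt hd1
  have hd2' : ∀ j, dist (q.2 j) (x₀ j) < r / 8 := fun j => (dist_le_pi_dist _ _ j).trans_lt hd2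
  have hfar : ∀ z ∈ Ω \ ⋃ j, Metric.ball (x₀ j) (r / 2),
      ‖u q.2 (z + variation χ (q.2 - q.1) z) / u q.1 z - 1‖ ≤ 1 / 2 := by
    intro z hz
    have hz1 : z ∈ Ω \ range q.1 := ⟨hz.1, by
      rintro ⟨j, rfl⟩
      refine hz.2 (mem_iUnion.2 ⟨j, ?_⟩)
      rw [Metric.mem_ball]; linarith [hd1' j]⟩
    have k1 := h1 z hz
    rw [dist_eq_norm] at k1
    have k2 : ‖u q.2 (z + variation χ (q.2 - q.1) z) - u x₀ z‖ ≤ 1 / 4 := by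
      by_cases hzS : z ∈ S
      · exact (h3 z ⟨hzS, hz.2⟩).2.2.trans (min_le_left _ _)
      · rw [hχ.variation_eq_zero _ hzS, add_zero, ← dist_eq_norm, dist_comm]
        exact (h2 z hz).le
    have hc := hf.isCurrent q.1 hq1
    rw [div_sub_one (hc.ne_zero hz1), norm_div, hc.norm_eq_one z hz1, div_one]
    have k3 := norm_add_le (u q.2 (z + variation χ (q.2 - q.1) z) - u x₀ z) (u x₀ z - u q.1 z)
    rw [sub_add_sub_cancel] at k3
    linarith
  intro z hz
  by_cases hzf : z ∈ ⋃ j, Metric.ball (x₀ j) (r / 2)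
  · obtain ⟨j, hj⟩ := mem_iUnion.1 hzf
    have hvar : ∀ w ∈ Metric.closedBall (q.1 j) (3 / 4 * r),
        variation χ (q.2 - q.1) w = q.2 j - q.1 j := fun w hw => by
      refine hχ.variation_eq _ j ?_
      have := dist_triangle w (q.1 j) (x₀ j)
      have := hd1' j
      rw [Metric.mem_closedBall] at hw
      rw [Metric.mem_ball]; linarith
    have hsph : ∀ w ∈ Metric.sphere (q.1 j) (3 / 4 * r),
        w ∈ S \ ⋃ j, Metric.ball (x₀ j) (r / 2) := by
      intro w hw
      have hwd := Metric.mem_sphere.1 hw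
      have t1 := dist_triangle w (q.1 j) (x₀ j)
      have t2 := dist_triangle w (x₀ j) (q.1 j)
      rw [dist_comm (x₀ j)] at t2
      have t3 := hd1' j
      have hwb : w ∈ Metric.ball (x₀ j) r := by rw [Metric.mem_ball]; linarith
      refine ⟨hχ.ball_subset j hwb, fun h => ?_⟩
      obtain ⟨k, hk⟩ := mem_iUnion.1 h
      by_cases hkj : k = j
      · subst hkj
        rw [Metric.mem_ball] at hk; linarith
      · exact hχ.notMem_ball hkj hwb (Metric.ball_subset_ball (by linarith) hk)
    have hzb : z ∈ Metric.ball (q.1 j) (3 / 4 * r) := by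
      have := dist_triangle z (x₀ j) (q.1 j)
      rw [dist_comm (x₀ j)] at this
      have := hd1' j
      rw [Metric.mem_ball] at hj ⊢; linarith
    rw [hvar z (Metric.ball_subset_closedBall hzb)]
    refine norm_div_sub_one_lt_near_vortex hΩ.isOpen hf hχ hq1 hq2 hd1' hd2' j (fun w hw => ?_)
      (fun w hw => ?_) hzb fun h => hz.2 ⟨j, h.symm⟩
    · rw [← hvar w (Metric.sphere_subset_closedBall hw)]
      exact hfar w ⟨hχ.subset (hsph w hw).1, (hsph w hw).2⟩
    · obtain ⟨k1, k2, -⟩ := h3 w (hsph w hw)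
      rw [hvar w (Metric.sphere_subset_closedBall hw)] at k1
      have k3 := min_le_right (1 / 4) ((4 * r)⁻¹ / 2)
      have k4 := norm_sub_le ((f q.2 (w + (q.2 j - q.1 j)) + vortexCur d q.2 (w + (q.2 j - q.1 j))) -
        (f x₀ w + vortexCur d x₀ w)) ((f q.1 w + vortexCur d q.1 w) - (f x₀ w + vortexCur d x₀ w))
      rw [sub_sub_sub_cancel_right] at k4
      linarith
  · exact (hfar z ⟨hz.1, hzf⟩).trans_lt (by norm_num)

end

/-! ### Differentiability of the renormalised energy -/

theorem stressDot_add (H : ℂ) (A B : ℂ →L[ℝ] ℂ) :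
    stressDot H (A + B) = stressDot H A + stressDot H B := by
  simp only [stressDot, _root_.add_apply]
  rw [← Complex.add_re]; ring_nf

theorem stressDot_smul (H : ℂ) (c : ℝ) (A : ℂ →L[ℝ] ℂ) :
    stressDot H (c • A) = c * stressDot H A := by
  simp only [stressDot, _root_.smul_apply, Complex.real_smul]
  rw [← Complex.re_ofReal_mul]; ring_nf

theorem stressDot_zero (H : ℂ) : stressDot H 0 = 0 := by simp [stressDot]

theorem continuousOn_stressDot {s : Set ℂ} {H : ℂ → ℂ} {A : ℂ → ℂ →L[ℝ] ℂ} (hH : ContinuousOn H s)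
    (hA : ContinuousOn A s) : ContinuousOn (fun z => stressDot (H z) (A z)) s :=
  Complex.continuous_re.comp_continuousOn ((hH.pow 2).mul
    ((hA.clm_apply continuousOn_const).add
      (continuousOn_const.mul (hA.clm_apply continuousOn_const))))

section

variable {Ω S : Set ℂ} {n : ℕ} {x₀ : Fin n → ℂ} {r : ℝ} {χ : Fin n → ℂ → ℝ} {H₀ : ℂ → ℂ}

theorem variation_add (χ : Fin n → ℂ → ℝ) (h k : Fin n → ℂ) :
    variation χ (h + k) = fun z => variation χ h z + variation χ k z := by
  funext z
  simp [variation, Finset.sum_add_distrib]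

theorem variation_smul (χ : Fin n → ℂ → ℝ) (c : ℝ) (h : Fin n → ℂ) :
    variation χ (c • h) = fun z => c • variation χ h z := by
  funext z
  simp only [variation, Finset.smul_sum, Pi.smul_apply]
  exact Finset.sum_congr rfl fun j _ => smul_comm _ _ _

namespace IsCutoffSystem

/-- The fields are locally constant near the vortices and zero off `S`, so their derivatives live in
this set. It stays away from the vortices, which is why the first variation needs no
renormalisation. -/
theorem isCompact_transition (hχ : IsCutoffSystem Ω x₀ r S χ) :
    IsCompact (S \ ⋃ j, Metric.ball (x₀ j) r) :=
  hχ.isCompact.diff (isOpen_iUnion fun _ => Metric.isOpen_ball)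

theorem transition_subset (hχ : IsCutoffSystem Ω x₀ r S χ) :
    S \ ⋃ j, Metric.ball (x₀ j) r ⊆ Ω \ range x₀ :=
  (sdiff_subset_sdiff_left hχ.subset).trans (perforated_subset_diff_range Ω x₀ hχ.pos)

theorem integrableOn_stressDot (hχ : IsCutoffSystem Ω x₀ r S χ) (hΩ : IsOpen Ω)
    (hH₀ : ContinuousOn H₀ (Ω \ range x₀)) (h : Fin n → ℂ) :
    IntegrableOn (fun z => stressDot (H₀ z) (fderiv ℝ (variation χ h) z)) Ω := by
  refine IntegrableOn.of_forall_sdiff_eq_zero (s := S \ ⋃ j, Metric.ball (x₀ j) r) ?_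
    hΩ.measurableSet fun z hz => ?_
  · refine ContinuousOn.integrableOn_compact hχ.isCompact_transition ?_
    have h1 : Continuous (fderiv ℝ (variation χ h)) :=
      (hχ.contDiff_variation h).continuous_fderiv (by norm_num)
    exact continuousOn_stressDot (hH₀.mono hχ.transition_subset) h1.continuousOn
  · rw [hχ.fderiv_variation_eq_zero h hz.2, stressDot_zero]

/-- The first variation, as a linear form. -/
noncomputable def firstVariation (hχ : IsCutoffSystem Ω x₀ r S χ) (hΩ : IsOpen Ω)
    (hH₀ : ContinuousOn H₀ (Ω \ range x₀)) : (Fin n → ℂ) →L[ℝ] ℝ :=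
  LinearMap.toContinuousLinearMap
    { toFun := fun h => -∫ z in Ω, stressDot (H₀ z) (fderiv ℝ (variation χ h) z)
      map_add' := fun h k => by
        rw [← neg_add, ← integral_add (hχ.integrableOn_stressDot hΩ hH₀ h)
          (hχ.integrableOn_stressDot hΩ hH₀ k)]
        simp_rw [variation_add, ← stressDot_add]
        congr 2
        funext z
        rw [fderiv_fun_add ((hχ.contDiff_variation h).differentiable (by norm_num) z)
          ((hχ.contDiff_variation k).differentiable (by norm_num) z)]
      map_smul' := fun c h => by
        rw [RingHom.id_apply, smul_eq_mul, mul_neg, ← integral_const_mul]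
        simp_rw [variation_smul, ← stressDot_smul]
        congr 2
        funext z
        rw [fderiv_fun_const_smul ((hχ.contDiff_variation h).differentiable (by norm_num) z)] }

theorem firstVariation_apply (hχ : IsCutoffSystem Ω x₀ r S χ) (hΩ : IsOpen Ω)
    (hH₀ : ContinuousOn H₀ (Ω \ range x₀)) (h : Fin n → ℂ) :
    hχ.firstVariation hΩ hH₀ h = -∫ z in Ω, stressDot (H₀ z) (fderiv ℝ (variation χ h) z) := rfl

end IsCutoffSystem

end

section

variable {Ω S : Set ℂ} {g : frontier Ω → Circle} {n : ℕ} {d : Fin n → ℤ} {p : ℝ≥0∞}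
  {U : Set (Fin n → ℂ)} {u f : (Fin n → ℂ) → ℂ → ℂ} {x₀ : Fin n → ℂ} {r : ℝ} {χ : Fin n → ℂ → ℝ}
  (hΩ : IsSmoothBoundedDomain Ω) (hg : IsC1Datum g) (hp : 1 ≤ p) (hU : IsOpen U)
  (hUΩ : U ⊆ configSpace Ω n) (hu : IsSingularHarmonicFamily p Ω g d U u)
  (hf : HasCurrents Ω d U u f)

include hΩ hg hUΩ hu hf

theorem exists_compact_integrableOn_family {x : Fin n → ℂ} (hx : x ∈ U) :
    ∃ K, IsCompact K ∧ K ⊆ Ω ∧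
      IntegrableOn (fun z => ‖f x z + vortexCur d x z‖ ^ 2) (Ω \ K) := by
  obtain ⟨G, hG, hGg⟩ := hg
  refine IsCurrent.exists_compact_integrableOn hΩ.isOpen hΩ.isBounded
    (finite_range x).isCompact (hf.isCurrent x hx) hG (fun y hy => ?_) (fun y hy => ?_) ?_
  · have := hu.boundary x hx ⟨y, hy⟩
    rwa [← hGg ⟨y, hy⟩] at this
  · have := hGg ⟨y, hy⟩
    simp only at this
    rw [this]; exact Circle.norm_coe _
  · rintro _ ⟨j, rfl⟩; exact (hUΩ hx).1 j

theorem tendsto_truncatedEnergy_family {x : Fin n → ℂ} (hx : x ∈ U) :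
    Tendsto (fun ρ => truncatedEnergy Ω d u ρ x) (𝓝[>] 0) (𝓝 (renormEnergy Ω d u x)) := by
  obtain ⟨K, hK, hKΩ, hi⟩ := exists_compact_integrableOn_family hΩ hg hUΩ hu hf hx
  exact tendsto_truncatedEnergy hΩ.isOpen (hUΩ hx) (hf.differentiableOn x hx) (hf.isCurrent x hx)
    fun ρ hρ => integrableOn_norm_sq_perforated (hf.isCurrent x hx).differentiableOn hK hKΩ hi hρ

theorem tendsto_energy_family {x : Fin n → ℂ} (hx : x ∈ U) :
    Tendsto (fun ρ => (∫ z in perforated Ω x ρ, ‖f x z + vortexCur d x z‖ ^ 2) -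
      2 * Real.pi * (∑ j, (d j : ℝ) ^ 2) * Real.log (1 / ρ)) (𝓝[>] 0)
      (𝓝 (renormEnergy Ω d u x)) := by
  refine (tendsto_truncatedEnergy_family hΩ hg hUΩ hu hf hx).congr' ?_
  filter_upwards [self_mem_nhdsWithin] with ρ hρ
  rw [truncatedEnergy]
  congr 1
  refine setIntegral_congr_fun (measurableSet_perforated hΩ.isOpen.measurableSet x ρ)
    fun z hz => ?_
  exact (hf.isCurrent x hx).gradSq_eq (perforated_subset_diff_range Ω x hρ hz)

variable (hx₀ : x₀ ∈ U)

include hp hU hx₀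

/-- The comparison theorem is applied to `q.1` and `q.2`, and the current in the stress term is then
frozen at `x₀`. Both this replacement and the quadratic error only involve the transition region,
where the moved currents converge uniformly. The estimate is uniform in both configurations, which
is the form that strict differentiability demands. -/
theorem eventually_energy_lower_bound (hχ : IsCutoffSystem Ω x₀ r S χ) {ε : ℝ} (hε : 0 < ε) :
    ∀ᶠ q : (Fin n → ℂ) × (Fin n → ℂ) in 𝓝 (x₀, x₀),
      renormEnergy Ω d u q.1 -
        (∫ z in Ω, stressDot (f x₀ z + vortexCur d x₀ z)
          (fderiv ℝ (variation χ (q.2 - q.1)) z)) - ε * ‖q.2 - q.1‖ ≤ renormEnergy Ω d u q.2 := by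
  have hr := hχ.pos
  obtain ⟨C, hC, hCb⟩ := hχ.exists_bound
  set H₀ : ℂ → ℂ := fun z => f x₀ z + vortexCur d x₀ z with hH₀
  have hH₀c : ContinuousOn H₀ (Ω \ range x₀) :=
    (hf.isCurrent x₀ hx₀).differentiableOn.continuousOn
  set T : Set ℂ := S \ ⋃ j, Metric.ball (x₀ j) r with hT
  have hTc : IsCompact T := hχ.isCompact_transition
  obtain ⟨M, hM⟩ := hTc.exists_bound_of_continuousOn (hH₀c.mono hχ.transition_subset)
  set M' := |M| with hM'
  have hM'0 : 0 ≤ M' := abs_nonneg _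
  replace hM : ∀ z ∈ T, ‖H₀ z‖ ≤ M' := fun z hz => (hM z hz).trans (le_abs_self M)
  set μT := volume.real T with hμT
  have hμT0 : 0 ≤ μT := measureReal_nonneg
  -- Pointwise error allowed per unit of `‖h‖`: integrated over `T` it costs at most `ε`. Half is
  -- spent on freezing the current, through `ε₂`, and half on the quadratic error, through the
  -- smallness of `q.2 - q.1`.
  set ε₁ := ε / (1 + μT) with hε₁
  have hε₁0 : 0 < ε₁ := by positivity
  set ε₂ := min 1 (ε₁ / (4 * (2 * M' + 1) * C)) with hε₂
  have hε₂0 : 0 < ε₂ := by positivity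
  obtain ⟨R, hR, hRΩ⟩ := hχ.isCompact.exists_cthickening_subset_open hΩ.isOpen hχ.subset
  have hsmall : ∀ t > 0, ∀ᶠ q : (Fin n → ℂ) × (Fin n → ℂ) in 𝓝 (x₀, x₀), ‖q.2 - q.1‖ < t := by
    intro t ht
    have : Continuous fun q : (Fin n → ℂ) × (Fin n → ℂ) => ‖q.2 - q.1‖ := by fun_prop
    have := this.tendsto (x₀, x₀)
    rw [sub_self, norm_zero] at this
    exact this.eventually (gt_mem_nhds ht)
  have hfst := continuous_fst.tendsto (x₀, x₀)
  have hsnd := continuous_snd.tendsto (x₀, x₀)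
  filter_upwards [eventually_currents_near hΩ hp hU hu hf hx₀ hχ hε₂0 hr,
    eventually_norm_div_sub_one_lt hΩ hp hU hUΩ hu hf hx₀ hχ,
    hfst.eventually (hU.mem_nhds hx₀), hsnd.eventually (hU.mem_nhds hx₀),
    hfst.eventually (Metric.ball_mem_nhds x₀ (by positivity : 0 < r / 2)),
    hsmall (1 / (2 * C)) (by positivity), hsmall (R / C) (by positivity),
    hsmall (ε₁ / (8 * C ^ 2 * (M' + 1) ^ 2)) (by positivity)]
    with q hq1 hq2 hqx hqy hqr hs1 hs2 hs3
  set x := q.1 with hx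
  set y := q.2 with hy
  set h := y - x with hh
  have hb1 : C * ‖h‖ ≤ 1 / 2 := by
    calc C * ‖h‖ ≤ C * (1 / (2 * C)) := by gcongr
      _ = 1 / 2 := by field_simp
  have hb2 : C * ‖h‖ ≤ R := by
    calc C * ‖h‖ ≤ C * (R / C) := by gcongr
      _ = R := by field_simp
  have hb3 : 4 * C ^ 2 * (M' + 1) ^ 2 * ‖h‖ ≤ ε₁ / 2 := by
    calc 4 * C ^ 2 * (M' + 1) ^ 2 * ‖h‖
        ≤ 4 * C ^ 2 * (M' + 1) ^ 2 * (ε₁ / (8 * C ^ 2 * (M' + 1) ^ 2)) := by gcongr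
      _ = ε₁ / 2 := by field_simp; norm_num
  have hb4 : 2 * ε₂ * (2 * M' + 1) * C ≤ ε₁ / 2 := by
    calc 2 * ε₂ * (2 * M' + 1) * C
        ≤ 2 * (ε₁ / (4 * (2 * M' + 1) * C)) * (2 * M' + 1) * C := by
          gcongr; exact min_le_right _ _
      _ = ε₁ / 2 := by field_simp; norm_num
  have hε₂1 : ε₂ ≤ 1 := min_le_left _ _
  set X := variation χ h with hX
  -- The frozen stress term plus the allowed error; outside `T` the derivative of `X` vanishes and
  -- no error occurs.
  set m : ℂ → ℝ := fun z => stressDot (H₀ z) (fderiv ℝ X z) +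
    T.indicator (fun _ => ε₁ * ‖h‖) z with hm
  have hi1 : IntegrableOn (fun z => stressDot (H₀ z) (fderiv ℝ X z)) Ω :=
    hχ.integrableOn_stressDot hΩ.isOpen hH₀c h
  have hTΩ : T ⊆ Ω := sdiff_subset.trans hχ.subset
  have hi2 : IntegrableOn (T.indicator fun _ => ε₁ * ‖h‖) Ω := by
    refine Integrable.integrableOn ((integrable_indicator_iff hTc.measurableSet).2 ?_)
    exact integrableOn_const hTc.measure_lt_top.ne
  have hint : ∫ z in Ω, m z ≤ (∫ z in Ω, stressDot (H₀ z) (fderiv ℝ X z)) + ε * ‖h‖ := by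
    rw [hm, integral_add hi1 hi2, setIntegral_indicator hTc.measurableSet,
      inter_eq_right.2 hTΩ, setIntegral_const, smul_eq_mul]
    refine add_le_add_right ?_ _
    calc μT * (ε₁ * ‖h‖) ≤ (1 + μT) * (ε₁ * ‖h‖) := by gcongr; linarith
      _ = ε * ‖h‖ := by rw [hε₁]; field_simp
  have hmle : ∀ z ∈ Ω \ range x,
      stressDot (f y (z + X z) + vortexCur d y (z + X z)) (fderiv ℝ X z) +
        4 * ‖fderiv ℝ X z‖ ^ 2 * ‖f y (z + X z) + vortexCur d y (z + X z)‖ ^ 2 ≤ m z := by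
    intro z _
    by_cases hz : z ∈ T
    · obtain ⟨k1, -, -⟩ := hq1 z hz
      set P := f y (z + X z) + vortexCur d y (z + X z) with hP
      replace k1 : ‖P - H₀ z‖ ≤ ε₂ := k1
      have k2 := hM z hz
      have k3 : ‖P‖ ≤ M' + ε₂ := by
        have := norm_add_le (P - H₀ z) (H₀ z)
        rw [sub_add_cancel] at this
        linarith
      have k4 := (hCb h z).2
      have k5 := (abs_le.1 (abs_stressDot_sub_le P (H₀ z) (fderiv ℝ X z))).2
      have k3' : ‖P‖ ≤ M' + 1 := k3.trans (by linarith)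
      have k3'' : ‖P‖ + ‖H₀ z‖ ≤ 2 * M' + 1 := by linarith
      have k6 : 2 * ‖P - H₀ z‖ * (‖P‖ + ‖H₀ z‖) * ‖fderiv ℝ X z‖ ≤ ε₁ / 2 * ‖h‖ := by
        calc _ ≤ 2 * ε₂ * (2 * M' + 1) * (C * ‖h‖) := by
              gcongr
          _ = (2 * ε₂ * (2 * M' + 1) * C) * ‖h‖ := by ring
          _ ≤ _ := by gcongr
      have k7 : 4 * ‖fderiv ℝ X z‖ ^ 2 * ‖P‖ ^ 2 ≤ ε₁ / 2 * ‖h‖ := by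
        calc _ ≤ 4 * (C * ‖h‖) ^ 2 * (M' + 1) ^ 2 := by
              gcongr
          _ = (4 * C ^ 2 * (M' + 1) ^ 2 * ‖h‖) * ‖h‖ := by ring
          _ ≤ _ := by gcongr
      simp only [hm, indicator_of_mem hz]
      linarith
    · simp only [hm, indicator_of_notMem hz]
      rw [hX, hχ.fderiv_variation_eq_zero h hz]
      simp [stressDot_zero]
  have hxc := hUΩ hqx
  have hyc := hUΩ hqy
  have hfx := hf.differentiableOn x hqx
  have hfy := hf.differentiableOn y hqy
  have hmain := renormalised_energy_comparison (S := S) (X := X) (s := r / 2) hΩ.isOpen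
    hΩ.isBounded (injective_of_mem_configSpace hxc) hxc.1 (hf.isCurrent x hqx)
    (hf.isCurrent y hqy) (exists_abs_re_mul_le hΩ.isOpen hxc hfx)
    (exists_norm_current_le hΩ.isOpen hxc hfx)
    (exists_norm_current_sub_le hΩ.isOpen hxc hyc hfx hfy)
    (exists_compact_integrableOn_family hΩ hg hUΩ hu hf hqx)
    (exists_compact_integrableOn_family hΩ hg hUΩ hu hf hqy)
    (hχ.contDiff_variation h) (fun z => ((hCb h z).2).trans hb1) hχ.isCompact hχ.subset
    (fun z hz => hχ.variation_eq_zero h hz) (fun z hz => ?_) (by positivity) (fun j z hz => ?_)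
    (fun w hw => ?_) hq2 (hi1.add hi2) hmle (tendsto_energy_family hΩ hg hUΩ hu hf hqx)
    (tendsto_energy_family hΩ hg hUΩ hu hf hqy)
  · have hmain' : renormEnergy Ω d u x - ∫ z in Ω, m z ≤ renormEnergy Ω d u y := hmain
    linarith
  · by_cases hzS : z ∈ S
    · refine hRΩ (Metric.mem_cthickening_of_dist_le _ z R S hzS ?_)
      rw [dist_eq_norm, add_sub_cancel_left]
      exact ((hCb h z).1).trans hb2
    · rwa [hX, hχ.variation_eq_zero h hzS, add_zero]
  · refine hχ.variation_eq h j ?_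
    have t1 := dist_triangle z (x j) (x₀ j)
    have t2 := (dist_le_pi_dist x x₀ j).trans_lt hqr
    rw [Metric.mem_ball] at hz ⊢
    linarith
  · have k := (hu.boundary y hqy ⟨w, hw⟩).div (hu.boundary x hqx ⟨w, hw⟩) (Circle.coe_ne_zero _)
    rwa [div_self (Circle.coe_ne_zero _)] at k

/-- A lower bound valid for all pairs near the diagonal point is two-sided: exchanging the two
configurations changes the sign of the linear term and turns the lower bound into the matching upper
bound. -/
theorem hasStrictFDerivAt_renormEnergy (hχ : IsCutoffSystem Ω x₀ r S χ) :
    HasStrictFDerivAt (renormEnergy Ω d u) (hχ.firstVariation hΩ.isOpen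
      (hf.isCurrent x₀ hx₀).differentiableOn.continuousOn) x₀ := by
  refine HasStrictFDerivAt.of_isLittleO (Asymptotics.isLittleO_iff.2 fun ε hε => ?_)
  set L := hχ.firstVariation hΩ.isOpen
    (hf.isCurrent x₀ hx₀).differentiableOn.continuousOn with hL
  have h1 := eventually_energy_lower_bound hΩ hg hp hU hUΩ hu hf hx₀ hχ hε
  have h2 := (continuous_swap.tendsto (x₀, x₀)).eventually h1
  filter_upwards [h1, h2] with q hq1 hq2
  simp only [Prod.fst_swap, Prod.snd_swap] at hq2
  have e1 : ∀ h, (∫ z in Ω, stressDot (f x₀ z + vortexCur d x₀ z)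
      (fderiv ℝ (variation χ h) z)) = -L h := fun h => by
    rw [hL, IsCutoffSystem.firstVariation_apply, neg_neg]
  rw [e1] at hq1 hq2
  have e2 : L (q.2 - q.1) = -L (q.1 - q.2) := by rw [← map_neg, neg_sub]
  rw [e2, norm_sub_rev] at hq1
  rw [Real.norm_eq_abs, abs_le]
  constructor <;> linarith

end

/-- A function that is strictly differentiable at all points of an open set is of class `C¹`. -/
theorem contDiffOn_one_of_hasStrictFDerivAt {E F : Type*} [NormedAddCommGroup E] [NormedSpace ℝ E]
    [NormedAddCommGroup F] [NormedSpace ℝ F] {W : E → F} {U : Set E} (hU : IsOpen U)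
    (h : ∀ x ∈ U, ∃ L : E →L[ℝ] F, HasStrictFDerivAt W L x) : ContDiffOn ℝ 1 W U := by
  have hd : ∀ x ∈ U, HasStrictFDerivAt W (fderiv ℝ W x) x := fun x hx => by
    obtain ⟨L, hL⟩ := h x hx
    rwa [hL.hasFDerivAt.fderiv]
  refine contDiffOn_one_of_continuousOn_fderiv hU
    (fun x hx => (hd x hx).hasFDerivAt.differentiableAt.differentiableWithinAt) fun x₀ hx₀ => ?_
  refine ContinuousAt.continuousWithinAt (Metric.continuousAt_iff'.2 fun ε hε => ?_)
  have h1 := (Asymptotics.isLittleO_iff.1 (hd x₀ hx₀).isLittleO) (half_pos hε)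
  have hdiag : Tendsto (fun x : E => (x, x)) (𝓝 x₀) (𝓝 (x₀, x₀)) :=
    (continuous_id.prodMk continuous_id).tendsto x₀
  -- The strict estimate at `x₀` also holds for pairs near `(x, x)`, so `W - fderiv ℝ W x₀` has
  -- Lipschitz-type increments at `x`, which bounds the difference of the two derivatives.
  filter_upwards [hdiag.eventually h1.eventually_nhds, hU.mem_nhds hx₀] with x hx hxU
  have h3 := (hd x hxU).hasFDerivAt.sub (fderiv ℝ W x₀).hasFDerivAt
  have hpair : Tendsto (fun y : E => (y, x)) (𝓝 x) (𝓝 (x, x)) :=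
    (continuous_id.prodMk continuous_const).tendsto x
  have h4 := h3.le_of_lip' (half_pos hε).le (by
    filter_upwards [hpair.eventually hx] with y hy
    have : W y - fderiv ℝ W x₀ y - (W x - fderiv ℝ W x₀ x) =
        W y - W x - fderiv ℝ W x₀ (y - x) := by rw [map_sub]; abel
    rwa [Pi.sub_apply, Pi.sub_apply, this])
  rw [dist_eq_norm]
  exact h4.trans_lt (half_lt_self hε)

/-! ### Cut-off functions -/

section

variable {Ω : Set ℂ} {n : ℕ} {x : Fin n → ℂ}

theorem exists_isCutoffSystem (hΩ : IsOpen Ω) (hx : x ∈ configSpace Ω n) :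
    ∃ r S χ, IsCutoffSystem Ω x r S χ := by
  obtain ⟨r, hr, hrΩ, hrx⟩ := exists_radius hΩ hx
  have h : ∀ j, ∃ κ : ℂ → ℝ, ∃ L : Set ℂ, ContDiff ℝ 1 κ ∧
      (∀ z ∈ Metric.closedBall (x j) (r / 2), κ z = 1) ∧ IsCompact L ∧ L ⊆ Metric.ball (x j) r ∧
      ∀ z ∉ L, κ z = 0 := by
    intro j
    obtain ⟨κ, V, L, h1, -, h3, h4, h5, h6, h7, -⟩ := exists_cutoff
      (isCompact_closedBall (x j) (r / 2)) (Metric.isOpen_ball (x := x j) (ε := r))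
      (Metric.closedBall_subset_ball (by linarith))
    exact ⟨κ, L, h1, fun z hz => h4 z (h3 hz), h5, h6, h7⟩
  choose κ L h1 h2 h3 h4 h5 using h
  refine ⟨r / 2, ⋃ j, L j, κ, by positivity, h1,
    fun j z hz => h2 j z (Metric.ball_subset_closedBall hz), fun j k hjk z hz => h5 j z fun h => ?_,
    isCompact_iUnion h3, iUnion_subset fun j =>
      (h4 j).trans (Metric.ball_subset_closedBall.trans (hrΩ j)),
    fun j z hz => h5 j z fun h => hz (mem_iUnion.2 ⟨j, h⟩)⟩
  have k1 := Metric.mem_ball.1 (h4 j h)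
  have k2 := Metric.mem_ball.1 hz
  have k3 := hrx j k hjk
  rw [← dist_eq_norm] at k3
  have k4 := dist_triangle_left (x j) (x k) z
  linarith

/-- The ball misses the frontier, so it is covered by the interior and the exterior of `Ω`; being
connected and centred in the interior, it lies in the interior. -/
theorem closedBall_subset_of_lt_infDist {Ω : Set ℂ} {a : ℂ} (ha : a ∈ Ω) {s : ℝ} (hs : 0 ≤ s)
    (h : s < Metric.infDist a (frontier Ω)) : Metric.closedBall a s ⊆ Ω := by
  have hd : Disjoint (Metric.closedBall a s) (frontier Ω) := disjoint_left.2 fun z hz hz' => by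
    have := Metric.infDist_le_dist_of_mem (x := a) hz'
    rw [Metric.mem_closedBall, dist_comm] at hz
    linarith
  have hcov : Metric.closedBall a s ⊆ interior Ω ∪ (closure Ω)ᶜ := fun z hz => by
    by_contra hz'
    rw [mem_union, not_or, mem_compl_iff, not_not] at hz'
    exact disjoint_left.1 hd hz ⟨hz'.2, hz'.1⟩
  have hdisj : Disjoint (interior Ω) (closure Ω)ᶜ :=
    disjoint_compl_right.mono_left (interior_subset.trans subset_closure)
  have hai : a ∈ interior Ω :=
    (hcov (Metric.mem_closedBall_self hs)).resolve_right fun h => h (subset_closure ha)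
  exact ((convex_closedBall a s).isPreconnected.subset_left_of_subset_union isOpen_interior
    isClosed_closure.isOpen_compl hdisj hcov ⟨a, Metric.mem_closedBall_self hs, hai⟩).trans
    interior_subset

/-- The supports of radius `2 δ` may overlap; it is enough that each avoids a small disk around
every other vortex. The radius `r < δ` of these disks comes from the strictness of the separation
hypothesis. -/
theorem IsCutoff.exists_isCutoffSystem {χ : ℂ → ℝ} (hχ : IsCutoff χ) (hx : ∀ j, x j ∈ Ω) {δ : ℝ}
    (hδ : 0 < δ) (hδx : ∀ j k, j ≠ k → 2 * δ < dist (x j) (x k))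
    (hδΩ : ∀ j, 2 * δ < Metric.infDist (x j) (frontier Ω)) :
    ∃ r S, IsCutoffSystem Ω x r S fun j z => χ ((z - x j) / (δ : ℂ)) := by
  have hnorm : ∀ j z, ‖(z - x j) / (δ : ℂ)‖ = dist z (x j) / δ := fun j z => by
    rw [norm_div, Complex.norm_real, Real.norm_of_nonneg hδ.le, dist_eq_norm]
  have hev : ∀ᶠ r in 𝓝[>] (0 : ℝ), ∀ j k, j ≠ k → r + 2 * δ < dist (x j) (x k) := by
    refine eventually_all.2 fun j => eventually_all.2 fun k => ?_
    by_cases hjk : j = k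
    · simp [hjk]
    · filter_upwards [Ioo_mem_nhdsGT (sub_pos.2 (hδx j k hjk))] with r hr _
      linarith [hr.2]
  obtain ⟨r, ⟨hr1, hr2⟩, hr3⟩ := ((hev.and (Ioo_mem_nhdsGT hδ)).and self_mem_nhdsWithin).exists
  refine ⟨r, ⋃ j, Metric.closedBall (x j) (2 * δ), hr3, fun j => ?_, fun j z hz => ?_,
    fun j k hjk z hz => ?_, isCompact_iUnion fun j => isCompact_closedBall _ _,
    iUnion_subset fun j => closedBall_subset_of_lt_infDist (hx j) (by positivity) (hδΩ j),
    fun j z hz => ?_⟩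
  · exact (hχ.smooth.of_le (by simp)).comp (by fun_prop)
  · refine hχ.eq_one _ ?_
    rw [mem_ball_zero_iff, hnorm, div_lt_one hδ]
    exact (Metric.mem_ball.1 hz).trans hr2.2
  · refine hχ.eq_zero _ ?_
    rw [mem_ball_zero_iff, hnorm, not_lt, le_div_iff₀ hδ]
    have k1 := hr1 j k hjk
    have k2 := Metric.mem_ball.1 hz
    have k3 := dist_triangle_left (x j) (x k) z
    linarith
  · refine hχ.eq_zero _ ?_
    rw [mem_ball_zero_iff, hnorm, not_lt, le_div_iff₀ hδ]
    by_contra! h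
    exact hz (mem_iUnion.2 ⟨j, Metric.mem_closedBall.2 h.le⟩)

end

/-! ### The stress-energy tensor of a current and the theorem. -/

/-- In terms of the current, the tensor is symmetric and trace free, with diagonal entries `± Re H²`
and off-diagonal entry `-Im H²`. Its contraction with `DX` therefore only sees `∂₁X + i ∂₂X`. -/
theorem IsCurrent.matInner_stressEnergy {O : Set ℂ} {u H : ℂ → ℂ} (h : IsCurrent O u H) {z : ℂ}
    (hz : z ∈ O) (X : ℂ → ℂ) :
    matInner (stressEnergy u z) (jacobian X z) = stressDot (H z) (fderiv ℝ X z) := by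
  have h1 : pd X 0 z = fderiv ℝ X z 1 := by simp [pd, e]
  have h2 : pd X 1 z = fderiv ℝ X z Complex.I := by simp [pd, e]
  have hn : ‖H z‖ ^ 2 = (H z).re * (H z).re + (H z).im * (H z).im := by
    rw [← Complex.normSq_eq_norm_sq, Complex.normSq_apply]
  simp only [matInner, stressEnergy, jacobian, Fin.sum_univ_two, Matrix.of_apply, h1, h2,
    h.pd_zero hz, h.pd_one hz, h.inner_aux hz, h.gradSq_eq hz, hn]
  simp [e, stressDot, sq, Complex.inner]
  ring

end SingularHarmonic

theorem mainTheorem4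
    (Ω : Set ℂ) (hΩ : SingularHarmonic.IsSmoothBoundedDomain Ω)
    (g : frontier Ω → Circle) (hg : SingularHarmonic.IsC1Datum g)
    (n : ℕ) (d : Fin n → ℤ)
    (p : ℝ≥0∞) (hp1 : 1 ≤ p) (hp2 : p < 2)
    (U : Set (Fin n → ℂ)) (hU : IsOpen U) (hUΩ : U ⊆ SingularHarmonic.configSpace Ω n)
    (u : (Fin n → ℂ) → ℂ → ℂ)
    (hu : SingularHarmonic.IsSingularHarmonicFamily p Ω g d U u) :
    -- the renormalised energy is well defined on `U`
    (∀ x ∈ U,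
      (∀ ρ : ℝ, 0 < ρ →
        IntegrableOn (SingularHarmonic.gradSq (u x)) (SingularHarmonic.perforated Ω x ρ)) ∧
      Tendsto (fun ρ => SingularHarmonic.truncatedEnergy Ω d u ρ x) (𝓝[>] 0)
        (𝓝 (SingularHarmonic.renormEnergy Ω d u x))) ∧
    -- its differential is given by the stress-energy tensor
    (∀ x ∈ U,
      DifferentiableAt ℝ (SingularHarmonic.renormEnergy Ω d u) x ∧
      ∀ (χ : ℂ → ℝ), SingularHarmonic.IsCutoff χ →
      ∀ δ : ℝ, 0 < δ →
        (∀ j k, j ≠ k → 2 * δ < dist (x j) (x k)) →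
        (∀ j, 2 * δ < Metric.infDist (x j) (frontier Ω)) →
        ∀ h : Fin n → ℂ,
          IntegrableOn
            (fun z => SingularHarmonic.matInner (SingularHarmonic.stressEnergy (u x) z)
              (SingularHarmonic.jacobian (SingularHarmonic.cutoffField χ δ x h) z)) Ω ∧
          fderiv ℝ (SingularHarmonic.renormEnergy Ω d u) x h =
            -∫ z in Ω, SingularHarmonic.matInner (SingularHarmonic.stressEnergy (u x) z)
              (SingularHarmonic.jacobian (SingularHarmonic.cutoffField χ δ x h) z)) ∧
    -- and it is of class `C¹`
    ContDiffOn ℝ 1 (SingularHarmonic.renormEnergy Ω d u) U := by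
  obtain ⟨f, hf⟩ := hu.exists_hasCurrents hΩ.isOpen
  -- Every cut-off system yields the derivative. By uniqueness of derivatives the formula may be
  -- read with the prescribed cut-off, while differentiability and `C¹` use an auxiliary one that
  -- always exists.
  have hstrict : ∀ x (hx : x ∈ U) r S χ (hχ : SingularHarmonic.IsCutoffSystem Ω x r S χ),
      HasStrictFDerivAt (SingularHarmonic.renormEnergy Ω d u) (hχ.firstVariation hΩ.isOpen
        (hf.isCurrent x hx).differentiableOn.continuousOn) x := fun x hx r S χ hχ =>
    SingularHarmonic.hasStrictFDerivAt_renormEnergy hΩ hg hp1 hU hUΩ hu hf hx hχ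
  refine ⟨fun x hx => ⟨fun ρ hρ => ?_, ?_⟩, fun x hx => ⟨?_, ?_⟩, ?_⟩
  · obtain ⟨K, hK, hKΩ, hi⟩ :=
      SingularHarmonic.exists_compact_integrableOn_family hΩ hg hUΩ hu hf hx
    refine IntegrableOn.congr_fun (SingularHarmonic.integrableOn_norm_sq_perforated
      (hf.isCurrent x hx).differentiableOn hK hKΩ hi hρ) (fun z hz => ?_)
      (SingularHarmonic.measurableSet_perforated hΩ.isOpen.measurableSet x ρ)
    exact ((hf.isCurrent x hx).gradSq_eq
      (SingularHarmonic.perforated_subset_diff_range Ω x hρ hz)).symm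
  · exact SingularHarmonic.tendsto_truncatedEnergy_family hΩ hg hUΩ hu hf hx
  · obtain ⟨r, S, χ, hχ⟩ := SingularHarmonic.exists_isCutoffSystem hΩ.isOpen (hUΩ hx)
    exact (hstrict x hx r S χ hχ).hasFDerivAt.differentiableAt
  · intro χ hχ δ hδ hδx hδΩ h
    obtain ⟨r, S, hsys⟩ := hχ.exists_isCutoffSystem (hUΩ hx).1 hδ hδx hδΩ
    have hcur := hf.isCurrent x hx
    have hae : (fun z => SingularHarmonic.stressDot (f x z + SingularHarmonic.vortexCur d x z)
        (fderiv ℝ (SingularHarmonic.cutoffField χ δ x h) z)) =ᵐ[volume.restrict Ω]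
        fun z => SingularHarmonic.matInner (SingularHarmonic.stressEnergy (u x) z)
          (SingularHarmonic.jacobian (SingularHarmonic.cutoffField χ δ x h) z) := by
      filter_upwards [SingularHarmonic.ae_mem_diff_range hΩ.isOpen.measurableSet x] with z hz
      exact (hcur.matInner_stressEnergy hz _).symm
    constructor
    · exact (hsys.integrableOn_stressDot hΩ.isOpen hcur.differentiableOn.continuousOn h).congr hae
    · rw [(hstrict x hx r S _ hsys).hasFDerivAt.fderiv, hsys.firstVariation_apply,
        integral_congr_ae hae.symm]
      rfl
  · refine SingularHarmonic.contDiffOn_one_of_hasStrictFDerivAt hU fun x hx => ?_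
    obtain ⟨r, S, χ, hχ⟩ := SingularHarmonic.exists_isCutoffSystem hΩ.isOpen (hUΩ hx)
    exact ⟨_, hstrict x hx r S χ hχ⟩
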